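/- **Renormalization of the chemical potential.** *Lattices and fields.* Let $L\ge 3$ be odd, $n\ge 0$, $T,S\ge1$, $N=n+1$, $L_{tp}=L^{2N}T$, $L_{sp}=L^{N}S$. Let $\mathcal X=(\mathbb Z/T)\times(\mathbb Z/S)^3$ (unit lattice) and, for $0\le j\le N$, let $\mathcal X_j$ be its refinement with time spacing $L^{-2j}$ and space spacing $L^{-j}$ (with the same periods). Put $\langle f,g\rangle_j=L^{-5j}\sum_{u\in\mathcal X_j}f(u)g(u)$, and let $*$ denote adjoints for these bilinear forms. *Operators.* Let $h_0=\nabla^*H\nabla$ on $\mathbb Z^3$, where $H$ is a translation invariant, real, symmetric operator on functions of bonds with exponentially decaying kernel and strictly positive spectrum. Let $\hat h_0$ be its symbol; we also write $h_0$ for its periodizations. Let $D_0=1-e^{-h_0}-e^{-h_0}\partial_0$ with $\partial_0$ the forward time difference, on $(\mathbb Z/L_{tp})\times(\mathbb Z/L_{sp})^3$, and let $D_N$ be $L^{2N}D_0$ transported to $\mathcal X_N$ by the scaling $(u_0,\mathbf u)\mapsto(L^{2N}u_0,L^N\mathbf u)$. Fix $\mathfrak q\ge1$. One block spin average is $(Q\psi)(y)=\sum_x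 q(x)\psi(y+x)$, where $q$ is the $\mathfrak q$-fold convolution of the normalized indicator function of the centred box with sides $L^2,L,L,L$; $Q_j$, from functions on $\mathcal X_j$ to functions on $\mathcal X$, is the composition of $j$ (rescaled) such averages, and $\mathfrak Q_N=\big(1+\sum_{j=1}^{N-1}L^{-2j}Q_jQ_j^*\big)^{-1}$. Set $$A_N(\psi_*,\psi,\phi_*,\phi,\mu,\mathcal V)=\langle\psi_*-Q_N\phi_*,\mathfrak Q_N(\psi-Q_N\phi)\rangle_0+\langle\phi_*,D_N\phi\rangle_N+\mathcal V(\phi_*,\phi)-\mu\langle\phi_*,\phi\rangle_N .$$ The background fields $\phi_{(*)N}(\psi_*,\psi,\mu,\mathcal V)$ are the (germ at the origin of the) functions $(\phi_*,\phi)$ of $(\psi_*,\psi)$ that are analytic near $0$, vanish at $0$ and are critical points of $A_N$ with respect to $(\phi_*,\phi)$. *Symmetries.* "Invariant" means invariant under lattice translations, under the spatial reflections, and under time reflection combined with complex conjugation and exchange of starred and unstarred fields (acting on the fields $\psi_{(*)\nu}$ below as on $\partial_\nu\psi_{(*)}$). A quartic is an invariant monomial $\int K(u_1,\dots,u_4)\,\phi_*(u_1)\phi(u_2)\phi_*(u_3)\phi(u_4)$.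 On $\mathcal X_N$ the translations are those of $\mathcal X$; for the scale $n$ interaction $\mathcal V_n$ (which lives on the lattice $\mathcal X_N$ dilated by $L^2$ in time and $L$ in space) they are those of the unit lattice of scale $n$. Let $(\mathbb S\mathcal V_n)(\phi_*,\phi)=\mathcal V_n(\mathbb S^{-1}\phi_*,\mathbb S^{-1}\phi)$, where $(\mathbb S\alpha)(u)=L^{3/2}\alpha(L^2u_0,L\mathbf u)$. For quartics $\mathcal V_n$, $\delta\mathcal V$ let $$A^{\rm var}(\psi_*,\psi,\delta\mu,\delta\mathcal V)=A_N(\psi_*,\psi,\phi_*,\phi,L^2\mu_n+\delta\mu,\mathbb S\mathcal V_n)\Big|_{\phi_{(*)}=\phi_{(*)N}(\psi_*,\psi,L^2\mu_n+\delta\mu,\mathbb S\mathcal V_n+\delta\mathcal V)}-A_N(\psi_*,\psi,\phi_*,\phi,L^2\mu_n,\mathbb S\mathcal V_n)\Big|_{\phi_{(*)}=\phi_{(*)N}(\psi_*,\psi,L^2\mu_n,\mathbb S\mathcal V_n)} .$$ *Mass extraction and norm.* Consider functions $\mathcal F(\tilde\psi_*,\tilde\psi)$ of fields $\tilde\psi_{(*)}=(\psi_{(*)},\{\psi_{(*)\nu}\}_{\nu=0}^3)$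 on $\mathcal X$ that are analytic near $0$. If $\int dx\,dx'\,\psi_*(x)K(x,x')\psi(x')$ is the part of $\mathcal F$ of degree one in each of $\psi_*$ and $\psi$ and of degree zero in the other fields, then $\ell(\mathcal F)=\int dx'\,K(0,x')$. For a kernel $f$ with $p\ge1$ arguments, $\|f\|_{\mathfrak m}=\max_i\sup_{x_i}\sum_{x_k,\,k\ne i}|f(x_1,\dots,x_p)|\,e^{\mathfrak m\tau(x_1,\dots,x_p)}$ with $\tau$ the minimal length of a tree having $x_1,\dots,x_p$ among its vertices; $\|f\|_{\mathfrak m}=|f|$ if $p=0$. The norm of $\mathcal F$ with mass $\mathfrak m$ and weights $\kappa,\kappa'$ is the sum, over all monomials of the power series of $\mathcal F$, of $\|\text{kernel}\|_{\mathfrak m}$ times a factor $\kappa$ for each field $\psi_{(*)}$ and $\kappa'$ for each field $\psi_{(*)\nu}$. *Parameters.* Let $m>0$ and $0<\varepsilon<\frac1{12}$. Let $V_0(x_1,x_2,x_3,x_4)$ be an invariant kernel on $(\mathbb Z/L_{tp})\times\mathbb Z^3$, symmetric under $x_1\leftrightarrow x_3$ and under $x_2\leftrightarrow x_4$, with $0<\mathfrak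 v_0=2\|V_0\|_{2m}<\infty$, and $$\mu_*=2\int dx_1dx_2dx_3\,V_0(0,x_1,x_2,x_3)D_0^{-1}(x_3,0),$$ where $D_0^{-1}(x,0)$ is the inverse Fourier transform of $\big(1-e^{-\hat h_0(\mathbf k)}e^{ik_0}\big)^{-1}$ on $(\mathbb Z/L_{tp})\times\mathbb Z^3$. Let $\mu_*+\mathfrak v_0^{4/3-16\varepsilon}\le\mu_0\le\mathfrak v_0^{8/9+\varepsilon}$ and let $\mu_n\in\mathbb R$ with $|\mu_n|\le4\mathfrak v_0^{5\varepsilon}$. With $r=\frac{\log\mathfrak v_0}{\log(\mu_0-\mu_*)}$ put $$\bar\kappa=\frac{L^{(\frac12+\frac13r)(n+1)}}{\mathfrak v_0^{1/3-\varepsilon}},\qquad\bar\kappa'=\frac{L^{(\frac32-r-\varepsilon)(n+1)}}{\mathfrak v_0^{1/3-\varepsilon}},\qquad\mathfrak e_{\rm fl}(n)=L^{(\frac23-4\varepsilon)rn}\,\mathfrak v_0^{1/3-2\varepsilon}.$$ **Statement.** There is $\rho_{\max}\in(0,\frac18]$, depending only on $H$ and $\mathfrak q$, such that for every $\rho_{\rm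 bg}\in(0,\rho_{\max}]$ and all $L,\varepsilon,m$ as above there is $\bar{\mathfrak v}>0$ (depending only on $H,\mathfrak q,\rho_{\rm bg},L,\varepsilon,m$) such that the following holds for all $n,T,S$ and all $V_0$ with $0<\mathfrak v_0\le\bar{\mathfrak v}$, and all $\mu_0,\mu_n$ as above and every quartic $\mathcal V_n$. Let $\tilde{\mathcal E}_{\rm fl}(\tilde\psi_*,\tilde\psi)$ be any function that is analytic near $0$, vanishes at $0$, is invariant and particle number preserving, and whose norm with mass $2m$ and weights $\bar\kappa,\bar\kappa'$ is at most $\mathfrak e_{\rm fl}(n)$ (in particular the effective action produced by the $n$-th fluctuation integral). Then $\ell(\tilde{\mathcal E}_{\rm fl})$ is real, and there is a unique $\delta\mu_n\in[-\rho_{\rm bg},\rho_{\rm bg}]$ such that $$\ell\big(A^{\rm var}(\cdot,\cdot,\delta\mu_n,\delta\mathcal V)\big)+\ell(\tilde{\mathcal E}_{\rm fl})=0\qquad\text{for all quartics }\delta\mathcal V\text{ on }\mathcal X_N .$$ Furthermore, $\delta\mu_n$ has the same sign as $\ell(\tilde{\mathcal E}_{\rm fl})$ and $$\tfrac14|\ell(\tilde{\mathcal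 E}_{\rm fl})|\le|\delta\mu_n|\le\tfrac94|\ell(\tilde{\mathcal E}_{\rm fl})|\le\frac{3}{\bar\kappa^2}\,\mathfrak e_{\rm fl}(n).$$ -/

import Mathlib

open Filter Topology Matrix
open scoped ComplexConjugate ENNReal

noncomputable section

namespace BoseFlow

/-! ### Lattices -/

/-- The discrete torus `(ℤ/t) × (ℤ/s)³` (time first). As `ZMod 0 = ℤ`, `Lat t 0` is the lattice
`(ℤ/t) × ℤ³` with infinite spatial directions. -/
abbrev Lat (t s : ℕ) : Type := ZMod t × (Fin 3 → ZMod s)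

/-- Number of sites in the time direction of the lattice obtained from a unit lattice with time
period `T` by `j` refinements (each refines time by `L ^ 2`). -/
def tSize (L T : ℕ) : ℕ → ℕ
  | 0 => T
  | j + 1 => L ^ 2 * tSize L T j

/-- The same in a spatial direction (each refinement refines space by `L`). -/
def sSize (L S : ℕ) : ℕ → ℕ
  | 0 => S
  | j + 1 => L * sSize L S j

instance tSize_neZero (L T : ℕ) [NeZero L] [NeZero T] : (j : ℕ) → NeZero (tSize L T j)
  | 0 => inferInstanceAs (NeZero T)
  | j + 1 => by
      have := tSize_neZero L T j
      exact ⟨mul_ne_zero (pow_ne_zero 2 (NeZero.ne L)) (NeZero.ne (tSize L T j))⟩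

instance sSize_neZero (L S : ℕ) [NeZero L] [NeZero S] : (j : ℕ) → NeZero (sSize L S j)
  | 0 => inferInstanceAs (NeZero S)
  | j + 1 => by
      have := sSize_neZero L S j
      exact ⟨mul_ne_zero (NeZero.ne L) (NeZero.ne (sSize L S j))⟩

/-- The lattice with spacings `L ^ (-2j)` (time) and `L ^ (-j)` (space) that refines the unit
lattice `Lat T S`. Its points are labelled by integer coordinates: the label `(i₀, i)` stands for
the point `(L ^ (-2j) i₀, L ^ (-j) i)`. -/
abbrev FineLat (L T S j : ℕ) : Type := Lat (tSize L T j) (sSize L S j)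

section Geometry
variable {t s : ℕ}

/-- Unit vector in the time direction. -/
def eT : Lat t s := (1, 0)

/-- Unit vector in a spatial direction. -/
def eS (i : Fin 3) : Lat t s := (0, Pi.single i 1)

/-- Time reflection `R₀`. -/
def reflT (x : Lat t s) : Lat t s := (-x.1, x.2)

/-- Spatial reflection `R_i`. -/
def reflS (i : Fin 3) (x : Lat t s) : Lat t s := (x.1, Function.update x.2 i (-x.2 i))

/-- Euclidean distance on the torus (minimum over representatives). -/
def latDist (x y : Lat t s) : ℝ :=
  Real.sqrt (((x.1 - y.1).valMinAbs : ℝ) ^ 2 + ∑ i, ((x.2 i - y.2 i).valMinAbs : ℝ) ^ 2)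

open Classical in
/-- The length of a finite graph with vertices in the lattice. -/
def graphLength (H : (⊤ : SimpleGraph (Lat t s)).Subgraph) : ℝ :=
  (1 / 2) * ∑ᶠ e : Lat t s × Lat t s, if H.Adj e.1 e.2 then latDist e.1 e.2 else 0

/-- The tree length: minimal length of a finite tree that has the given points among its
vertices. -/
def treeLength {p : ℕ} (v : Fin p → Lat t s) : ℝ :=
  sInf {ℓ : ℝ | ∃ H : (⊤ : SimpleGraph (Lat t s)).Subgraph,
    H.verts.Finite ∧ H.coe.IsTree ∧ (∀ i, v i ∈ H.verts) ∧ ℓ = graphLength H}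

/-- The `ℓ¹`–`ℓ^∞` norm with mass `𝔪` of a kernel on a unit lattice: all arguments but one are
summed against the weight `exp (𝔪 τ)`, and then the maximum is taken over the remaining one and
over its position. -/
def kernelNorm (𝔪 : ℝ) {p : ℕ} (f : (Fin p → Lat t s) → ℂ) : ℝ≥0∞ :=
  if p = 0 then ∑' v, ENNReal.ofReal ‖f v‖
  else ⨆ (i : Fin p) (x : Lat t s), ∑' v : {v : Fin p → Lat t s // v i = x},
    ENNReal.ofReal (‖f v.1‖ * Real.exp (𝔪 * treeLength v.1))

end Geometry

/-! ### The kinetic energy and the operators `D_j` -/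

/-- The Fourier transform of a function on `ℤ³`. -/
def fourierZ3 (f : (Fin 3 → ℤ) → ℝ) (k : Fin 3 → ℝ) : ℂ :=
  ∑' z : Fin 3 → ℤ, (f z : ℂ) * Complex.exp (-Complex.I * ((∑ i, k i * (z i : ℝ) : ℝ) : ℂ))

/-- The data of a one-particle kinetic energy operator `h₀ = ∇* H ∇` on `ℤ³`: `H` is a real,
symmetric, translation invariant operator on functions of the bonds of `ℤ³` (a bond is a pair
(starting point, direction)), with exponentially decaying kernel and strictly positive spectrum. -/
structure KineticOperator where
  H : Fin 3 → Fin 3 → (Fin 3 → ℤ) → ℝ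
  symm : ∀ i j z, H i j z = H j i (-z)
  decay : ∃ C δ : ℝ, 0 < δ ∧
    ∀ i j z, |H i j z| ≤ C * Real.exp (-δ * Real.sqrt (∑ l, (z l : ℝ) ^ 2))
  pos : ∃ c : ℝ, 0 < c ∧ ∀ (k : Fin 3 → ℝ) (w : Fin 3 → ℂ),
    c * ∑ i, ‖w i‖ ^ 2 ≤ (∑ i, ∑ j, conj (w i) * fourierZ3 (H i j) k * w j).re

namespace KineticOperator
variable (K : KineticOperator)

/-- The symbol of `h₀ = ∇* H ∇` on `ℤ³`. -/
def symbol (k : Fin 3 → ℝ) : ℂ :=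
  ∑ i, ∑ j, conj (Complex.exp (Complex.I * (k i : ℂ)) - 1) * fourierZ3 (K.H i j) k *
    (Complex.exp (Complex.I * (k j : ℂ)) - 1)

variable (s : ℕ)

/-- The periodization of `H` to the spatial torus `(ℤ/s)³`. -/
def bondMatrix (i j : Fin 3) : Matrix (Fin 3 → ZMod s) (Fin 3 → ZMod s) ℂ :=
  Matrix.of fun x y => ((∑' z : Fin 3 → ℤ,
    if (fun l => (z l : ZMod s)) = x - y then K.H i j z else 0 : ℝ) : ℂ)

/-- The forward difference in direction `i` on the spatial torus. -/
def gradMatrix (i : Fin 3) : Matrix (Fin 3 → ZMod s) (Fin 3 → ZMod s) ℂ :=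
  Matrix.of fun x y => (if y = x + Pi.single i 1 then 1 else 0) - (if y = x then 1 else 0)

/-- `h₀ = ∇* H ∇` on the spatial torus. -/
def hMatrix [NeZero s] : Matrix (Fin 3 → ZMod s) (Fin 3 → ZMod s) ℂ :=
  ∑ i, ∑ j, (gradMatrix s i)ᵀ * K.bondMatrix s i j * gradMatrix s j

variable (t : ℕ)

/-- `exp (-h₀)`, acting on the spatial variables of functions on `(ℤ/t) × (ℤ/s)³`. -/
def heatMatrix [NeZero s] : Matrix (Lat t s) (Lat t s) ℂ :=
  Matrix.of fun x y => if x.1 = y.1 then NormedSpace.exp (-(K.hMatrix s)) x.2 y.2 else 0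

/-- The forward time difference `∂₀`. -/
def timeDiffMatrix : Matrix (Lat t s) (Lat t s) ℂ :=
  Matrix.of fun x y => (if y = x + eT then 1 else 0) - (if y = x then 1 else 0)

/-- `D₀ = 1 - exp (-h₀) - exp (-h₀) ∂₀`. -/
def D0 [NeZero t] [NeZero s] : Matrix (Lat t s) (Lat t s) ℂ :=
  1 - K.heatMatrix s t - K.heatMatrix s t * timeDiffMatrix s t

/-- `D_j = L ^ (2j) 𝕃⁻ʲ D₀ 𝕃ʲ`, acting on functions on the fine lattice; in integer coordinates the
conjugation with `𝕃ʲ` is invisible. -/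
def D (L T S : ℕ) [NeZero L] [NeZero T] [NeZero S] (j : ℕ) :
    Matrix (FineLat L T S j) (FineLat L T S j) ℂ :=
  (L : ℂ) ^ (2 * j) • K.D0 (sSize L S j) (tSize L T j)

/-- The kernel `D₀⁻¹(x, 0)` on `(ℤ/t) × ℤ³`, as an inverse Fourier transform. -/
def D0Inv [NeZero t] (x : Lat t 0) : ℂ :=
  (1 / (t : ℂ)) * ∑ l : ZMod t, (1 / (2 * (Real.pi : ℂ)) ^ 3) *
    ∫ k in Set.Icc (fun _ : Fin 3 => -Real.pi) (fun _ => Real.pi),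
      Complex.exp (Complex.I * ((2 * Real.pi * (l.val : ℝ) / (t : ℝ) * (x.1.val : ℝ) +
          ∑ i, k i * ((x.2 i).valMinAbs : ℝ) : ℝ) : ℂ)) /
        (1 - Complex.exp (-K.symbol k) *
          Complex.exp (Complex.I * ((2 * Real.pi * (l.val : ℝ) / (t : ℝ) : ℝ) : ℂ)))

end KineticOperator

/-! ### Block spin averaging -/

section Averaging
variable (L t s : ℕ)

/-- The discrete box with sides `L², L, L, L` centred at the origin (`L` odd). -/
def box : Finset (ℤ × (Fin 3 → ℤ)) :=
  Finset.Icc (-(((L : ℤ) ^ 2 - 1) / 2)) (((L : ℤ) ^ 2 - 1) / 2) ×ˢ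
    Fintype.piFinset fun _ => Finset.Icc (-(((L : ℤ) - 1) / 2)) (((L : ℤ) - 1) / 2)

/-- Averaging over translates of the box, i.e. convolution with its normalized indicator. -/
def boxMatrix : Matrix (Lat t s) (Lat t s) ℂ :=
  Matrix.of fun x y => (1 / (L : ℂ) ^ 5) *
    ∑ z ∈ box L, if y = x + ((z.1 : ZMod t), fun i => (z.2 i : ZMod s)) then 1 else 0

/-- Restriction to the sublattice `L² ℤ × L ℤ³`. -/
def sampleMatrix : Matrix (Lat t s) (Lat (L ^ 2 * t) (L * s)) ℂ :=
  Matrix.of fun y x =>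
    if x = (((L ^ 2 * y.1.val : ℕ) : ZMod (L ^ 2 * t)),
        fun i => ((L * (y.2 i).val : ℕ) : ZMod (L * s))) then 1 else 0

/-- One block spin average, `(Qψ)(y) = ∑ₓ q(x) ψ(y + x)` for `y` in the sublattice, whose profile
`q` is the `𝔮`-fold convolution of the normalized indicator function of the box. -/
def stepQ (𝔮 : ℕ) [NeZero L] [NeZero t] [NeZero s] :
    Matrix (Lat t s) (Lat (L ^ 2 * t) (L * s)) ℂ :=
  have : NeZero (L ^ 2 * t) := ⟨mul_ne_zero (pow_ne_zero 2 (NeZero.ne L)) (NeZero.ne t)⟩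
  have : NeZero (L * s) := ⟨mul_ne_zero (NeZero.ne L) (NeZero.ne s)⟩
  sampleMatrix L t s * boxMatrix L (L ^ 2 * t) (L * s) ^ 𝔮

end Averaging

section BlockSpin
variable (𝔮 L T S : ℕ) [NeZero L] [NeZero T] [NeZero S]

/-- `Q_j`: the composition of `j` block spin averages, from the fine lattice of generation `j` to
the unit lattice. -/
def Q : (j : ℕ) → Matrix (Lat T S) (FineLat L T S j) ℂ
  | 0 => (1 : Matrix (Lat T S) (Lat T S) ℂ)
  | j + 1 => Q j * stepQ L (tSize L T j) (sSize L S j) 𝔮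

/-- The adjoint `Q_j*` with respect to the pairings `⟨f, g⟩_j = L ^ (-5j) ∑ f g` and
`⟨f, g⟩₀ = ∑ f g`. -/
def Qstar (j : ℕ) : Matrix (FineLat L T S j) (Lat T S) ℂ :=
  (L : ℂ) ^ (5 * j) • (Q 𝔮 L T S j)ᵀ

/-- `𝔔_N = (1 + ∑_{j=1}^{N-1} L ^ (-2j) Q_j Q_j*)⁻¹` (block spin parameter `a = 1`). -/
def frakQ (N : ℕ) : Matrix (Lat T S) (Lat T S) ℂ :=
  (1 + ∑ j ∈ Finset.Ico 1 N, ((L : ℂ) ^ (2 * j))⁻¹ • (Q 𝔮 L T S j * Qstar 𝔮 L T S j))⁻¹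

end BlockSpin

/-! ### Interactions -/

/-- A (two-field) functional `V(φ_*, φ)`. -/
abbrev Functional (t s : ℕ) : Type := (Lat t s → ℂ) → (Lat t s → ℂ) → ℂ

/-- Quartic monomials `∫ K(u₁,…,u₄) φ_*(u₁) φ(u₂) φ_*(u₃) φ(u₄)` (so particle number preserving),
on the fine lattice of generation `j`, that are invariant under the symmetry group: translations by
vectors of the unit lattice, spatial reflections, and time reflection combined with complex
conjugation and exchange of `φ_*` and `φ`. -/
def IsQuartic (L j : ℕ) {t s : ℕ} [NeZero t] [NeZero s] (V : Functional t s) : Prop :=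
  (∃ K : (Fin 4 → Lat t s) → ℂ, ∀ φs φ,
    V φs φ = ∑ u : Fin 4 → Lat t s, K u * φs (u 0) * φ (u 1) * φs (u 2) * φ (u 3)) ∧
  (∀ (y₀ : ℤ) (y : Fin 3 → ℤ) (φs φ : Lat t s → ℂ),
    let w : Lat t s := ((((L : ℤ) ^ (2 * j) * y₀ : ℤ) : ZMod t),
      fun i => (((L : ℤ) ^ j * y i : ℤ) : ZMod s))
    V (fun u => φs (u + w)) (fun u => φ (u + w)) = V φs φ) ∧
  (∀ (i : Fin 3) (φs φ : Lat t s → ℂ),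
    V (fun u => φs (reflS i u)) (fun u => φ (reflS i u)) = V φs φ) ∧
  (∀ φs φ : Lat t s → ℂ,
    V (fun u => conj (φ (reflT u))) (fun u => conj (φs (reflT u))) = conj (V φs φ))

/-- The scaled functional `(𝕊V)(φ_*, φ) = V(𝕊⁻¹φ_*, 𝕊⁻¹φ)`, where `𝕊` multiplies by `L ^ (3/2)` and
moves a field to the next finer lattice (which has the same integer coordinates). -/
def scaled (L : ℕ) {t s : ℕ} (V : Functional t s) : Functional t s := fun φs φ =>
  V (fun u => (((L : ℝ) ^ (-(3 / 2) : ℝ) : ℝ) : ℂ) * φs u)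
    (fun u => (((L : ℝ) ^ (-(3 / 2) : ℝ) : ℝ) : ℂ) * φ u)

/-- The kernel `V₀` of the initial interaction `½ ∫ V₀(x₁,…,x₄) ψ_*(x₁) ψ(x₂) ψ_*(x₃) ψ(x₄)` on
`(ℤ/t) × ℤ³`, with the symmetries of the model. -/
structure InitialInteraction (t : ℕ) where
  V : (Fin 4 → Lat t 0) → ℂ
  translation : ∀ v y, V (fun i => v i + y) = V v
  exchange_star : ∀ v, V (v ∘ Equiv.swap 0 2) = V v
  exchange : ∀ v, V (v ∘ Equiv.swap 1 3) = V v
  reflection : ∀ (i : Fin 3) v, V (fun l => reflS i (v l)) = V v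
  time_reversal : ∀ v, V ![reflT (v 1), reflT (v 0), reflT (v 3), reflT (v 2)] = conj (V v)

namespace InitialInteraction
variable {t : ℕ} (V₀ : InitialInteraction t)

/-- The coupling constant `𝔳₀ = 2 ‖V₀‖_{2m}`. -/
def coupling (m : ℝ) : ℝ := 2 * (kernelNorm (2 * m) V₀.V).toReal

/-- `μ_* = 2 ∫ dx₁ dx₂ dx₃ V₀(0, x₁, x₂, x₃) D₀⁻¹(x₃, 0)`, which is a real number. -/
def muStar (K : KineticOperator) [NeZero t] : ℝ :=
  (2 * ∑' x : Fin 3 → Lat t 0, V₀.V ![0, x 0, x 1, x 2] * K.D0Inv t (x 2)).re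

end InitialInteraction

/-! ### The action, background fields and `A^var` -/

section Action
variable (K : KineticOperator) (𝔮 L T S : ℕ) [NeZero L] [NeZero T] [NeZero S] (N : ℕ)

/-- The dominant part
`A_N = ⟨ψ_* - Q_N φ_*, 𝔔_N (ψ - Q_N φ)⟩₀ + ⟨φ_*, D_N φ⟩_N + V(φ_*, φ) - μ ⟨φ_*, φ⟩_N`
of the action (`N ≥ 1`). -/
def action (μ : ℝ) (V : Functional (tSize L T N) (sSize L S N))
    (ψs ψ : Lat T S → ℂ) (φs φ : FineLat L T S N → ℂ) : ℂ :=
  (ψs - Q 𝔮 L T S N *ᵥ φs) ⬝ᵥ (frakQ 𝔮 L T S N *ᵥ (ψ - Q 𝔮 L T S N *ᵥ φ))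
    + ((L : ℂ) ^ (5 * N))⁻¹ * (φs ⬝ᵥ (K.D L T S N *ᵥ φ))
    + V φs φ
    - (μ : ℂ) * (((L : ℂ) ^ (5 * N))⁻¹ * (φs ⬝ᵥ φ))

/-- Background fields `(φ_*, φ)` as functions of `(ψ_*, ψ)` near the origin: analytic, vanishing at
the origin, and critical for the action with respect to `(φ_*, φ)`. -/
def IsBackgroundField (μ : ℝ) (V : Functional (tSize L T N) (sSize L S N))
    (Φ : (Lat T S → ℂ) × (Lat T S → ℂ) →
      (FineLat L T S N → ℂ) × (FineLat L T S N → ℂ)) : Prop :=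
  AnalyticAt ℂ Φ 0 ∧ Φ 0 = 0 ∧
    ∀ᶠ ψ in 𝓝 (0 : (Lat T S → ℂ) × (Lat T S → ℂ)),
      fderiv ℂ (fun φ : (FineLat L T S N → ℂ) × (FineLat L T S N → ℂ) =>
        action K 𝔮 L T S N μ V ψ.1 ψ.2 φ.1 φ.2) (Φ ψ) = 0

/-- The background fields `φ_{(*)N}(ψ_*, ψ, μ, V)`. Only their germ at the origin matters. -/
def backgroundField (μ : ℝ) (V : Functional (tSize L T N) (sSize L S N)) :
    (Lat T S → ℂ) × (Lat T S → ℂ) →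
      (FineLat L T S N → ℂ) × (FineLat L T S N → ℂ) :=
  Classical.epsilon (IsBackgroundField K 𝔮 L T S N μ V)

/-- `A^var(ψ_*, ψ, δμ, δV)` at step `N = n + 1`, for the chemical potential `μ'` (which is `L² μ_n`)
and the interaction `W` (which is `𝕊 V_n`); `δV` enters through the background fields only. -/
def actionVar (μ' : ℝ) (W : Functional (tSize L T N) (sSize L S N)) (δμ : ℝ)
    (δV : Functional (tSize L T N) (sSize L S N)) (ψs ψ : Lat T S → ℂ) : ℂ :=
  let Φ₁ := backgroundField K 𝔮 L T S N (μ' + δμ) (W + δV) (ψs, ψ)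
  let Φ₀ := backgroundField K 𝔮 L T S N μ' W (ψs, ψ)
  action K 𝔮 L T S N (μ' + δμ) W ψs ψ Φ₁.1 Φ₁.2 - action K 𝔮 L T S N μ' W ψs ψ Φ₀.1 Φ₀.2

end Action

/-! ### Analytic functions of the fields and of their derivatives -/

/-- The ten fields `ψ_*, ψ, ψ_{*ν}, ψ_ν` (`ν = 0,…,3`): the flag is `true` for the starred fields,
`none` stands for the field itself, and `some ν` for the field representing `∂_ν ψ_{(*)}`. -/
abbrev Species : Type := Bool × Option (Fin 4)

/-- The pairs `(ψ̃_*, ψ̃)` of extended fields on the unit lattice. -/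
abbrev TildeField (T S : ℕ) : Type := Species → Lat T S → ℂ

section TildeFunctions
variable {T S : ℕ}

/-- Translation of all fields. -/
def translateField (y : Lat T S) (α : TildeField T S) : TildeField T S :=
  fun σ x => α σ (x + y)

/-- Spatial reflection: `ψ_{(*)}(x) ↦ ψ_{(*)}(R_i x)`, and correspondingly for derivative fields. -/
def reflectField (i : Fin 3) (α : TildeField T S) : TildeField T S := fun σ x =>
  if σ.2 = some i.succ then -α σ (reflS i x - eS i) else α σ (reflS i x)

/-- Time reversal: `ψ_*(x) ↦ conj (ψ(R₀ x))`, `ψ(x) ↦ conj (ψ_*(R₀ x))`, and correspondingly for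
derivative fields. -/
def reverseField (α : TildeField T S) : TildeField T S := fun σ x =>
  if σ.2 = some 0 then -conj (α (!σ.1, σ.2) (reflT x - eT))
  else conj (α (!σ.1, σ.2) (reflT x))

/-- The phase rotation `ψ̃_* ↦ e^{-iθ} ψ̃_*`, `ψ̃ ↦ e^{iθ} ψ̃`. -/
def rotateField (θ : ℝ) (α : TildeField T S) : TildeField T S := fun σ x =>
  Complex.exp ((if σ.1 then -1 else 1) * Complex.I * (θ : ℂ)) * α σ x

variable [NeZero T] [NeZero S]

/-- Functions that are analytic near the origin, vanish at the origin, are invariant under the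
symmetry group, and preserve particle number. -/
structure IsInvariantAnalytic (F : TildeField T S → ℂ) : Prop where
  analytic : AnalyticAt ℂ F 0
  zero : F 0 = 0
  translation : ∀ y, ∀ᶠ α in 𝓝 (0 : TildeField T S), F (translateField y α) = F α
  reflection : ∀ i, ∀ᶠ α in 𝓝 (0 : TildeField T S), F (reflectField i α) = F α
  reversal : ∀ᶠ α in 𝓝 (0 : TildeField T S), F (reverseField α) = conj (F α)
  number : ∀ θ : ℝ, ∀ᶠ α in 𝓝 (0 : TildeField T S), F (rotateField θ α) = F α

/-- The field that is one for the species `σ` at the site `x`, and zero elsewhere. -/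
def deltaField (σ : Species) (x : Lat T S) : TildeField T S := Pi.single σ (Pi.single x 1)

/-- The kernel of the degree `p` part of the power series of `F` at the origin:
`F = ∑_p ∑_{σ ∈ Species^p} ∫ dx₁ … dx_p f_{p,σ}(x₁,…,x_p) α_{σ₁}(x₁) ⋯ α_{σ_p}(x_p)`. -/
def seriesKernel (F : TildeField T S → ℂ) (p : ℕ) (σ : Fin p → Species)
    (v : Fin p → Lat T S) : ℂ :=
  ((p.factorial : ℂ))⁻¹ * iteratedFDeriv ℂ p F 0 (fun i => deltaField (σ i) (v i))

/-- The norm with mass `𝔪` that gives weight `κ` to the fields `ψ_{(*)}` and `κ'` to the fields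
`ψ_{(*)ν}`. -/
def fieldNorm (𝔪 κ κ' : ℝ) (F : TildeField T S → ℂ) : ℝ≥0∞ :=
  ∑' p : ℕ, ∑ σ : Fin p → Species,
    (∏ i, ENNReal.ofReal (if (σ i).2 = none then κ else κ')) * kernelNorm 𝔪 (seriesKernel F p σ)

/-- The mass extraction operator: if `∫ dx dx' ψ_*(x) K(x, x') ψ(x')` is the part of `F` of degree
one in each of `ψ_*` and `ψ` and zero in the derivative fields, `ℓ(F) = ∫ dx' K(0, x')`. -/
def massExtraction (F : TildeField T S → ℂ) : ℂ :=
  ∑ x' : Lat T S,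
    iteratedFDeriv ℂ 2 F 0 ![deltaField (true, none) 0, deltaField (false, none) x']

/-- A function of `ψ_*` and `ψ` viewed as a function of the extended fields. -/
def ofFields (F : (Lat T S → ℂ) → (Lat T S → ℂ) → ℂ) : TildeField T S → ℂ :=
  fun α => F (α (true, none)) (α (false, none))

end TildeFunctions

/-! ### Weight factors -/

/-- `κ(n) = L ^ (η n) / 𝔳₀ ^ (1/3 - ε)`, `η = 1/2 + (1/3) log 𝔳₀ / log Δ`, with `Δ = μ₀ - μ_*`. -/
def kappa (L : ℕ) (ε v₀ Δ : ℝ) (n : ℕ) : ℝ :=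
  (L : ℝ) ^ ((1 / 2 + (1 / 3) * (Real.log v₀ / Real.log Δ)) * (n : ℝ)) / v₀ ^ (1 / 3 - ε)

/-- `κ'(n) = L ^ (η' n) / 𝔳₀ ^ (1/3 - ε)`, `η' = 3/2 - log 𝔳₀ / log Δ - ε`. -/
def kappa' (L : ℕ) (ε v₀ Δ : ℝ) (n : ℕ) : ℝ :=
  (L : ℝ) ^ ((3 / 2 - Real.log v₀ / Real.log Δ - ε) * (n : ℝ)) / v₀ ^ (1 / 3 - ε)

/-- `𝔢_fl(n) = L ^ (η_fl n) 𝔳₀ ^ (1/3 - 2ε)`, `η_fl = (2/3 - 4ε) log 𝔳₀ / log Δ`. -/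
def eFl (L : ℕ) (ε v₀ Δ : ℝ) (n : ℕ) : ℝ :=
  (L : ℝ) ^ ((2 / 3 - 4 * ε) * (Real.log v₀ / Real.log Δ) * (n : ℝ)) * v₀ ^ (1 / 3 - 2 * ε)

end BoseFlow

end

/-!
The mass `ℓ` of a function is its second derivative in the direction of one starred delta field and
one constant unstarred field. Only the response of the background fields to a *constant* `ψ`
therefore matters for the mass of the action. On constants the averages `Q_N` and `Q_N*` are
trivial, `D_N` vanishes, and `𝔔_N` is multiplication by the number `a = frakQInvConst⁻¹`, which lies
in `[8/9, 1]`. The linear response to `ψ = 1` is `φ = a / (a - μ)`, and quartic terms have no second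
derivative at the origin, so that the mass of the action at chemical potential `μ` is
`a - a² / (a - μ)`, whatever the interactions (`massExtraction_actionVar`). With `μ = L² μ_n` the
condition on `δμ` becomes the scalar equation

  `a² / (a - μ - δμ) - a² / (a - μ) = ℓ(E)`,

which is solved explicitly and injective in `δμ` (`exists_renormalization`).

For this computation to say something about `backgroundField`, background fields have to exist and
their linear response has to be unique, with a bound on `μ` that is uniform in the scale and the
volume. Existence follows from the inverse function theorem (`exists_analytic_critical`) once the
linearized operator `Q_N* 𝔔_N Q_N + D_N - μ` is injective
(`eq_zero_of_linOp_mulVec_eq_zero`). If it annihilates `φ`, the real part of the pairing with `φ`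
shows that `Q_N φ` is small compared with `φ`, since `D_N` has nonnegative real part; by the
equation `D_N φ` is small as well. In Fourier space, `D_N` controls one time difference and two
space differences (`KineticOperator.gradNorm_le`), and a multiscale Poincaré inequality
(`l2_le_Q_add_gradNorm`) bounds `φ` by `Q_N φ` and the differences; so `φ = 0`.

The mass of the invariant function `E` is real by time reversal and translation invariance
(`conj_massExtraction`), and `κ² |ℓ(E)|` is at most the norm of `E`
(`sq_mul_norm_massExtraction_le`). Finally `|μ_*|` is bounded by a constant times the coupling
(`InitialInteraction.abs_muStar_le`), because `1 / |k|²` is integrable in three dimensions. Hence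
`0 < μ₀ - μ_* < 1` for small coupling, the exponent `r` is positive, and the bound on `ℓ(E)` tends
to zero with the coupling, uniformly in the scale (`eFl_le`).
-/

noncomputable section

namespace BoseFlow

/-! ### The Euclidean norm on finite lattices -/

section EuclideanNorm
variable {ι ι' : Type*} [Fintype ι] [Fintype ι']

/-- The unweighted `ℓ²` norm of a field. -/
def l2 (f : ι → ℂ) : ℝ := ‖WithLp.toLp 2 f‖

lemma l2_sq (f : ι → ℂ) : l2 f ^ 2 = ∑ i, ‖f i‖ ^ 2 := by
  rw [l2, EuclideanSpace.norm_sq_eq]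

lemma l2_nonneg (f : ι → ℂ) : 0 ≤ l2 f := norm_nonneg _

lemma l2_add_le (f g : ι → ℂ) : l2 (f + g) ≤ l2 f + l2 g := by
  simp only [l2, WithLp.toLp_add]; exact norm_add_le _ _

lemma l2_sub_le (f g : ι → ℂ) : l2 (f - g) ≤ l2 f + l2 g := by
  simp only [l2, WithLp.toLp_sub]; exact norm_sub_le _ _

lemma l2_le_add_sub (f g : ι → ℂ) : l2 f ≤ l2 g + l2 (f - g) := by
  simpa using l2_add_le g (f - g)

lemma l2_smul (c : ℂ) (f : ι → ℂ) : l2 (c • f) = ‖c‖ * l2 f := by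
  simp only [l2, WithLp.toLp_smul]; exact norm_smul _ _

lemma l2_eq_zero {f : ι → ℂ} : l2 f = 0 ↔ f = 0 := by
  rw [l2, norm_eq_zero]; simp

lemma l2_comp_equiv (e : ι ≃ ι') (f : ι' → ℂ) : l2 (fun i => f (e i)) = l2 f := by
  rw [← sq_eq_sq₀ (l2_nonneg _) (l2_nonneg _), l2_sq, l2_sq]
  exact e.sum_comp fun i => ‖f i‖ ^ 2

lemma star_dotProduct_self (f : ι → ℂ) : star f ⬝ᵥ f = ((l2 f ^ 2 : ℝ) : ℂ) := by
  rw [l2_sq, dotProduct]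
  push_cast
  exact Finset.sum_congr rfl fun i _ => by
    rw [← Complex.conj_mul']; rfl

lemma norm_star_dotProduct_le (f g : ι → ℂ) : ‖star f ⬝ᵥ g‖ ≤ l2 f * l2 g := by
  have h := norm_inner_le_norm (𝕜 := ℂ) (WithLp.toLp 2 f) (WithLp.toLp 2 g)
  rwa [EuclideanSpace.inner_eq_star_dotProduct, dotProduct_comm] at h

end EuclideanNorm

/-! ### Fourier series on finite abelian groups -/

section Fourier
variable {G : Type*} [AddCommGroup G] [Fintype G]

/-- Orthogonality of characters. -/
lemma star_addChar_dotProduct [DecidableEq (AddChar G ℂ)] (ψ χ : AddChar G ℂ) :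
    star (ψ : G → ℂ) ⬝ᵥ (χ : G → ℂ) = if ψ = χ then (Fintype.card G : ℂ) else 0 := by
  have h : star (ψ : G → ℂ) ⬝ᵥ (χ : G → ℂ) = ∑ x, (χ - ψ) x := by
    simp only [dotProduct, Pi.star_apply, AddChar.sub_apply', div_eq_mul_inv, RCLike.star_def]
    refine Finset.sum_congr rfl fun x _ => ?_
    rw [mul_comm, ← AddChar.map_neg_eq_inv, AddChar.map_neg_eq_conj]
  rw [h, AddChar.sum_eq_ite]
  simp [sub_eq_zero, eq_comm]

lemma star_sum_addChar_dotProduct (a b : AddChar G ℂ → ℂ) :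
    star (∑ ψ, a ψ • (ψ : G → ℂ)) ⬝ᵥ (∑ ψ, b ψ • (ψ : G → ℂ)) =
      Fintype.card G * ∑ ψ, conj (a ψ) * b ψ := by
  classical
  rw [star_sum, sum_dotProduct, Finset.mul_sum]
  refine Finset.sum_congr rfl fun ψ _ => ?_
  rw [dotProduct_sum]
  simp only [star_smul, smul_dotProduct, dotProduct_smul, star_addChar_dotProduct, smul_eq_mul,
    mul_ite, mul_zero, Finset.sum_ite_eq, Finset.mem_univ, if_true, RCLike.star_def]
  ring

/-- Parseval's identity. -/
lemma l2_sum_addChar_sq (a : AddChar G ℂ → ℂ) :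
    l2 (∑ ψ, a ψ • (ψ : G → ℂ)) ^ 2 = Fintype.card G * ∑ ψ, ‖a ψ‖ ^ 2 := by
  have h := star_sum_addChar_dotProduct a a
  rw [star_dotProduct_self] at h
  have h2 : (Fintype.card G * ∑ ψ, conj (a ψ) * a ψ : ℂ) =
      ((Fintype.card G * ∑ ψ, ‖a ψ‖ ^ 2 : ℝ) : ℂ) := by
    push_cast
    congr 1
    exact Finset.sum_congr rfl fun ψ _ => by rw [← Complex.conj_mul']
  rw [h2] at h
  exact_mod_cast h

lemma exists_eq_sum_addChar (f : G → ℂ) :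
    ∃ a : AddChar G ℂ → ℂ, f = ∑ ψ, a ψ • (ψ : G → ℂ) := by
  classical
  refine ⟨(AddChar.complexBasis G).repr f, ?_⟩
  simpa only [AddChar.complexBasis_apply] using ((AddChar.complexBasis G).sum_repr f).symm

end Fourier

/-! ### The symbol of the kinetic energy -/

section Symbol

lemma summable_exp_neg_abs {δ : ℝ} (hδ : 0 < δ) :
    Summable fun z : ℤ => Real.exp (-δ * |(z : ℝ)|) := by
  have h : Summable fun n : ℕ => Real.exp (-δ * n) := by
    have := summable_geometric_of_lt_one (Real.exp_nonneg (-δ))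
      (Real.exp_lt_one_iff.2 (by linarith : -δ < 0))
    refine this.congr fun n => ?_
    rw [← Real.exp_nat_mul]; congr 1; ring
  refine Summable.of_nat_of_neg ?_ ?_
  · simpa using h
  · simpa using h

lemma summable_exp_neg_sqrt {δ : ℝ} (hδ : 0 < δ) :
    Summable fun z : Fin 3 → ℤ => Real.exp (-δ * Real.sqrt (∑ l, (z l : ℝ) ^ 2)) := by
  have h1 := summable_exp_neg_abs (by positivity : 0 < δ / 3)
  have h0 : ∀ z : ℤ, 0 ≤ Real.exp (-(δ / 3) * |(z : ℝ)|) := fun z => Real.exp_nonneg _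
  have h2 := (h1.mul_of_nonneg (h1.mul_of_nonneg h1 h0 h0) h0 fun p => mul_nonneg (h0 _) (h0 _))
  let e : (Fin 3 → ℤ) → ℤ × ℤ × ℤ := fun z => (z 0, z 1, z 2)
  have he : Function.Injective e := fun z w h => by
    simp only [e, Prod.mk.injEq] at h
    funext i; fin_cases i <;> simp [h]
  refine Summable.of_nonneg_of_le (fun _ => Real.exp_nonneg _) (fun z => ?_)
    (h2.comp_injective he)
  simp only [Function.comp, e, ← Real.exp_add]
  apply Real.exp_le_exp.2
  have hl : ∀ i, |(z i : ℝ)| ≤ Real.sqrt (∑ l, (z l : ℝ) ^ 2) := fun i => by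
    apply Real.abs_le_sqrt
    exact Finset.single_le_sum (f := fun l => (z l : ℝ) ^ 2) (fun _ _ => sq_nonneg _)
      (Finset.mem_univ i)
  have := hl 0; have := hl 1; have := hl 2
  nlinarith

namespace KineticOperator
variable (K : KineticOperator)

lemma summable_H (i j : Fin 3) : Summable fun z => |K.H i j z| := by
  obtain ⟨C, δ, hδ, h⟩ := K.decay
  exact Summable.of_nonneg_of_le (fun _ => abs_nonneg _) (h i j)
    ((summable_exp_neg_sqrt hδ).mul_left C)

/-- An upper bound for the symbol of `h₀`, uniform in the momentum. -/
def symbolBound : ℝ := ∑ i, ∑ j, 4 * ∑' z, |K.H i j z|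

lemma norm_fourierZ3_le (i j : Fin 3) (k : Fin 3 → ℝ) :
    ‖fourierZ3 (K.H i j) k‖ ≤ ∑' z, |K.H i j z| := by
  refine tsum_of_norm_bounded (K.summable_H i j).hasSum fun z => ?_
  rw [norm_mul, Complex.norm_real, Real.norm_eq_abs, Complex.norm_exp]
  simp

lemma conj_fourierZ3 (i j : Fin 3) (k : Fin 3 → ℝ) :
    conj (fourierZ3 (K.H i j) k) = fourierZ3 (K.H j i) k := by
  unfold fourierZ3
  rw [← (Equiv.neg (Fin 3 → ℤ)).tsum_eq (fun z => ((K.H j i z : ℝ) : ℂ) * _), Complex.conj_tsum]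
  refine tsum_congr fun z => ?_
  rw [map_mul, Complex.conj_ofReal, ← Complex.exp_conj, Equiv.neg_apply, K.symm i j z]
  congr 2
  simp

lemma norm_exp_sub_one_le (x : ℝ) : ‖Complex.exp (Complex.I * (x : ℂ)) - 1‖ ≤ 2 := by
  refine (norm_sub_le _ _).trans ?_
  rw [mul_comm, Complex.norm_exp_ofReal_mul_I]; norm_num

lemma symbol_im (k : Fin 3 → ℝ) : (K.symbol k).im = 0 := by
  rw [← Complex.conj_eq_iff_im, symbol, map_sum, Finset.sum_comm]
  simp only [map_sum, map_mul, conj_fourierZ3, Complex.conj_conj]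
  refine Finset.sum_congr rfl fun i _ => Finset.sum_congr rfl fun j _ => ?_
  ring

lemma norm_symbol_le (k : Fin 3 → ℝ) : ‖K.symbol k‖ ≤ K.symbolBound := by
  refine norm_sum_le_of_le _ fun i _ => norm_sum_le_of_le _ fun j _ => ?_
  rw [norm_mul, norm_mul, Complex.norm_conj]
  have h1 := norm_exp_sub_one_le (k i)
  have h2 := norm_exp_sub_one_le (k j)
  have h3 := K.norm_fourierZ3_le i j k
  calc _ ≤ 2 * (∑' z, |K.H i j z|) * 2 := by gcongr
    _ = _ := by ring

/-- A positive lower bound for the spectrum of `H`. -/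
def ellipticity : ℝ := K.pos.choose

lemma ellipticity_pos : 0 < K.ellipticity := K.pos.choose_spec.1

lemma le_symbol_re (k : Fin 3 → ℝ) :
    K.ellipticity * ∑ i, ‖Complex.exp (Complex.I * (k i : ℂ)) - 1‖ ^ 2 ≤ (K.symbol k).re :=
  K.pos.choose_spec.2 k fun i => Complex.exp (Complex.I * (k i : ℂ)) - 1

/-- The symbol of `h₀` as a real number. -/
def energy (k : Fin 3 → ℝ) : ℝ := (K.symbol k).re

lemma symbol_eq_energy (k : Fin 3 → ℝ) : K.symbol k = K.energy k :=
  Complex.ext rfl (by simpa using K.symbol_im k)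

lemma energy_nonneg (k : Fin 3 → ℝ) : 0 ≤ K.energy k :=
  le_trans (mul_nonneg K.ellipticity_pos.le (Finset.sum_nonneg fun _ _ => by positivity))
    (K.le_symbol_re k)

lemma energy_le (k : Fin 3 → ℝ) : K.energy k ≤ K.symbolBound :=
  (Complex.re_le_norm _).trans (K.norm_symbol_le k)

lemma symbolBound_nonneg : 0 ≤ K.symbolBound := (K.energy_nonneg 0).trans (K.energy_le 0)

end KineticOperator

/-- Bounds for `1 - e^{-h} z` with `|z| = 1` and `0 ≤ h ≤ B`: its real part is nonnegative, and its
modulus controls both the distance of `z` to `1` and `h`. For `D₀`, the factor `z` carries the time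
momentum and `h` is the kinetic energy. -/
lemma norm_one_sub_exp_mul {h B : ℝ} (h0 : 0 ≤ h) (hB : h ≤ B) {z : ℂ} (hz : ‖z‖ = 1) :
    0 ≤ (1 - (Real.exp (-h) : ℂ) * z).re ∧
    ‖z - 1‖ ≤ Real.exp B * ‖1 - (Real.exp (-h) : ℂ) * z‖ ∧
    h ≤ Real.exp B * ‖1 - (Real.exp (-h) : ℂ) * z‖ := by
  have hp1 : Real.exp (-h) ≤ 1 := Real.exp_le_one_iff.2 (by linarith)
  have hp0 := Real.exp_pos (-h)
  have hpB : 1 ≤ Real.exp B * Real.exp (-h) := by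
    rw [← Real.exp_add]; exact Real.one_le_exp (by linarith)
  have hB1 : 1 ≤ Real.exp B := Real.one_le_exp (by linarith)
  have hre : z.re ≤ 1 := (Complex.re_le_norm z).trans hz.le
  have hsq : z.re ^ 2 + z.im ^ 2 = 1 := by
    have := Complex.sq_norm z
    rw [hz, Complex.normSq_apply] at this; nlinarith
  set p := Real.exp (-h) with hp
  have n1 : ‖1 - (p : ℂ) * z‖ ^ 2 = (1 - p) ^ 2 + 2 * p * (1 - z.re) := by
    rw [Complex.sq_norm, Complex.normSq_apply]
    simp only [Complex.sub_re, Complex.one_re, Complex.re_ofReal_mul, Complex.sub_im,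
      Complex.one_im, Complex.im_ofReal_mul]
    nlinarith
  have n2 : ‖z - 1‖ ^ 2 = 2 * (1 - z.re) := by
    rw [Complex.sq_norm, Complex.normSq_apply]
    simp only [Complex.sub_re, Complex.one_re, Complex.sub_im, Complex.one_im]
    nlinarith
  refine ⟨?_, ?_, ?_⟩
  · simp only [Complex.sub_re, Complex.one_re, Complex.re_ofReal_mul]
    nlinarith
  · refine (pow_le_pow_iff_left₀ (norm_nonneg _) (by positivity) two_ne_zero).1 ?_
    rw [mul_pow, n1, n2]
    have : 0 ≤ 1 - z.re := by linarith
    have h3 : 1 ≤ Real.exp B ^ 2 * p := by nlinarith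
    nlinarith [mul_nonneg (sub_nonneg.2 h3) this,
      mul_nonneg (sq_nonneg (Real.exp B)) (sq_nonneg (1 - p))]
  · have h4 : 1 - p ≤ ‖1 - (p : ℂ) * z‖ := by
      refine (pow_le_pow_iff_left₀ (by linarith) (norm_nonneg _) two_ne_zero).1 ?_
      rw [n1]; nlinarith
    have h5 : h ≤ Real.exp B * (1 - p) := by
      have := Real.add_one_le_exp h
      have h6 : Real.exp h * p = 1 := by rw [hp, ← Real.exp_add]; simp
      have h7 : Real.exp h ≤ Real.exp B := Real.exp_le_exp.2 hB
      nlinarith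
    exact h5.trans (by gcongr)

end Symbol

/-! ### Characters diagonalize the kinetic operators -/

section Eigenvectors
variable {s : ℕ} [NeZero s]

/-- The momentum of a character of the spatial torus, with components in `(-π, π]`. -/
def momentum (χ : AddChar (Fin 3 → ZMod s) ℂ) (i : Fin 3) : ℝ := (χ (Pi.single i 1)).arg

lemma addChar_single (χ : AddChar (Fin 3 → ZMod s) ℂ) (i : Fin 3) :
    χ (Pi.single i 1) = Complex.exp (Complex.I * (momentum χ i : ℂ)) := by
  have h := Complex.norm_mul_exp_arg_mul_I (χ (Pi.single i 1))
  rw [AddChar.norm_apply] at h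
  rw [Complex.ofReal_one, one_mul] at h
  rw [momentum, mul_comm, h]

lemma addChar_intCast (χ : AddChar (Fin 3 → ZMod s) ℂ) (z : Fin 3 → ℤ) :
    χ (fun l => (z l : ZMod s)) =
      Complex.exp (Complex.I * ((∑ i, momentum χ i * (z i : ℝ) : ℝ) : ℂ)) := by
  have h : (fun l => (z l : ZMod s)) = ∑ i, z i • (Pi.single i 1 : Fin 3 → ZMod s) := by
    funext l
    simp [Finset.sum_apply, Pi.single_apply]
  rw [h, show χ (∑ i, z i • (Pi.single i 1 : Fin 3 → ZMod s)) =
    ∏ i, χ (z i • (Pi.single i 1 : Fin 3 → ZMod s)) from map_prod χ.toMonoidHom _ _]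
  push_cast
  rw [Finset.mul_sum, Complex.exp_sum]
  refine Finset.prod_congr rfl fun i _ => ?_
  rw [AddChar.map_zsmul_eq_zpow, addChar_single, ← Complex.exp_int_mul]
  congr 1; ring

namespace KineticOperator
variable (K : KineticOperator)

lemma bondMatrix_mulVec (i j : Fin 3) (χ : AddChar (Fin 3 → ZMod s) ℂ) :
    K.bondMatrix s i j *ᵥ χ = fourierZ3 (K.H i j) (momentum χ) • (χ : (Fin 3 → ZMod s) → ℂ) := by
  funext x
  have hs : ∀ y, Summable fun z : Fin 3 → ℤ =>
      (if (fun l => (z l : ZMod s)) = x - y then K.H i j z else 0 : ℝ) := fun y =>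
    Summable.of_norm_bounded (K.summable_H i j) fun z => by
      split_ifs <;> simp
  simp only [mulVec, dotProduct, bondMatrix, Matrix.of_apply, Complex.ofReal_tsum, ← tsum_mul_right]
  rw [← Summable.tsum_finsetSum fun y _ => (Complex.hasSum_ofReal.2
    (hs y).hasSum).summable.mul_right _, Pi.smul_apply, smul_eq_mul, fourierZ3, ← tsum_mul_right]
  refine tsum_congr fun z => ?_
  rw [Finset.sum_eq_single (x - fun l => (z l : ZMod s))]
  · rw [if_pos (by simp), sub_eq_add_neg, AddChar.map_add_eq_mul, AddChar.map_neg_eq_inv,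
      addChar_intCast, ← Complex.exp_neg, neg_mul]
    ring
  · intro y _ hy
    rw [if_neg (fun h => hy (by rw [h]; simp))]; simp
  · simp

lemma gradMatrix_mulVec (j : Fin 3) (χ : AddChar (Fin 3 → ZMod s) ℂ) :
    gradMatrix s j *ᵥ χ = (χ (Pi.single j 1) - 1) • (χ : (Fin 3 → ZMod s) → ℂ) := by
  funext x
  simp [mulVec, dotProduct, gradMatrix, sub_mul, Finset.sum_sub_distrib, AddChar.map_add_eq_mul,
    mul_comm (χ x)]

lemma gradMatrix_transpose_mulVec (j : Fin 3) (χ : AddChar (Fin 3 → ZMod s) ℂ) :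
    (gradMatrix s j)ᵀ *ᵥ χ = conj (χ (Pi.single j 1) - 1) • (χ : (Fin 3 → ZMod s) → ℂ) := by
  funext x
  simp only [mulVec, dotProduct, gradMatrix, Matrix.transpose_apply, Matrix.of_apply, sub_mul,
    Finset.sum_sub_distrib, ite_mul, one_mul, zero_mul, Finset.sum_ite_eq, Finset.mem_univ, if_true,
    Pi.smul_apply, smul_eq_mul, map_sub, map_one]
  rw [Finset.sum_eq_single (x - Pi.single j 1)]
  · rw [if_pos (by simp), sub_eq_add_neg x, AddChar.map_add_eq_mul, AddChar.map_neg_eq_conj]; ring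
  · intro y _ hy
    rw [if_neg (fun h => hy (by rw [h]; simp))]
  · simp

lemma hMatrix_mulVec (χ : AddChar (Fin 3 → ZMod s) ℂ) :
    K.hMatrix s *ᵥ χ = (K.energy (momentum χ) : ℂ) • (χ : (Fin 3 → ZMod s) → ℂ) := by
  rw [hMatrix, sum_mulVec, ← symbol_eq_energy, symbol, Finset.sum_smul]
  refine Finset.sum_congr rfl fun i _ => ?_
  rw [sum_mulVec, Finset.sum_smul]
  refine Finset.sum_congr rfl fun j _ => ?_
  rw [← mulVec_mulVec, ← mulVec_mulVec, gradMatrix_mulVec, mulVec_smul, bondMatrix_mulVec,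
    mulVec_smul, mulVec_smul, gradMatrix_transpose_mulVec, smul_smul, smul_smul,
    ← addChar_single, ← addChar_single]
  congr 1; ring

end KineticOperator

open scoped Matrix.Norms.L2Operator in
lemma exp_mulVec_of_mulVec_eq {ι : Type*} [Fintype ι] [DecidableEq ι] {A : Matrix ι ι ℂ}
    {v : ι → ℂ} {c : ℂ} (h : A *ᵥ v = c • v) :
    NormedSpace.exp A *ᵥ v = Complex.exp c • v := by
  have hpow : ∀ n : ℕ, (A ^ n) *ᵥ v = c ^ n • v := fun n => by
    induction n with
    | zero => simp
    | succ n ih => rw [pow_succ, ← mulVec_mulVec, h, mulVec_smul, ih, smul_smul, pow_succ, mul_comm]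
  have h1 := NormedSpace.exp_series_hasSum_exp' (𝕂 := ℂ) A
  have h2 := h1.map (⟨⟨fun M : Matrix ι ι ℂ => M *ᵥ v, zero_mulVec v⟩,
    fun M N => add_mulVec M N v⟩ : Matrix ι ι ℂ →+ (ι → ℂ))
    (by exact Continuous.matrix_mulVec continuous_id continuous_const)
  have h3 := (NormedSpace.exp_series_hasSum_exp' (𝕂 := ℂ) c).smul_const v
  rw [← Complex.exp_eq_exp_ℂ] at h3
  refine h2.unique (h3.congr_fun fun n => ?_)
  simp [Function.comp, smul_mulVec, hpow, smul_smul]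

variable {t : ℕ} [NeZero t]

/-- The restriction of a character of `(ℤ/t) × (ℤ/s)³` to the spatial torus. -/
def spatialChar (ψ : AddChar (Lat t s) ℂ) : AddChar (Fin 3 → ZMod s) ℂ :=
  ψ.compAddMonoidHom (AddMonoidHom.inr (ZMod t) (Fin 3 → ZMod s))

omit [NeZero s] [NeZero t] in
lemma spatialChar_apply (ψ : AddChar (Lat t s) ℂ) (y : Fin 3 → ZMod s) :
    spatialChar ψ y = ψ (0, y) := rfl

namespace KineticOperator
variable (K : KineticOperator)

lemma heatMatrix_mulVec (ψ : AddChar (Lat t s) ℂ) :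
    K.heatMatrix s t *ᵥ ψ =
      (Real.exp (-K.energy (momentum (spatialChar ψ))) : ℂ) • (ψ : Lat t s → ℂ) := by
  funext x
  have h1 : (-K.hMatrix s) *ᵥ (spatialChar ψ : (Fin 3 → ZMod s) → ℂ) =
      (-(K.energy (momentum (spatialChar ψ)) : ℂ)) • (spatialChar ψ : (Fin 3 → ZMod s) → ℂ) := by
    rw [neg_mulVec, hMatrix_mulVec, neg_smul]
  have h2 := congrFun (exp_mulVec_of_mulVec_eq h1) x.2
  have h3 : ∀ y : Lat t s, ψ y = ψ (y.1, 0) * ψ (0, y.2) := fun y => by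
    rw [← AddChar.map_add_eq_mul]; simp
  simp only [mulVec, dotProduct, heatMatrix, Matrix.of_apply, ite_mul, zero_mul,
    Fintype.sum_prod_type, Pi.smul_apply, smul_eq_mul] at h2 ⊢
  rw [Finset.sum_eq_single x.1]
  · simp only [if_true]
    rw [h3 x, mul_left_comm, Complex.ofReal_exp, Complex.ofReal_neg, ← spatialChar_apply, ← h2,
      Finset.mul_sum]
    refine Finset.sum_congr rfl fun y _ => ?_
    rw [h3 (x.1, y), spatialChar_apply]
    ring
  · intro b _ hb
    exact Finset.sum_eq_zero fun y _ => by rw [if_neg (Ne.symm hb)]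
  · simp

lemma timeDiffMatrix_mulVec (ψ : AddChar (Lat t s) ℂ) :
    timeDiffMatrix s t *ᵥ ψ = (ψ eT - 1) • (ψ : Lat t s → ℂ) := by
  funext x
  simp [mulVec, dotProduct, timeDiffMatrix, sub_mul, Finset.sum_sub_distrib,
    AddChar.map_add_eq_mul, mul_comm (ψ x)]

/-- The eigenvalue of `D₀` on a character. -/
def D0Symbol (ψ : AddChar (Lat t s) ℂ) : ℂ :=
  1 - (Real.exp (-K.energy (momentum (spatialChar ψ))) : ℂ) * ψ eT

lemma D0_mulVec (ψ : AddChar (Lat t s) ℂ) :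
    K.D0 s t *ᵥ ψ = K.D0Symbol ψ • (ψ : Lat t s → ℂ) := by
  rw [D0, sub_mulVec, sub_mulVec, one_mulVec, ← mulVec_mulVec, timeDiffMatrix_mulVec, mulVec_smul,
    heatMatrix_mulVec, D0Symbol]
  funext x
  simp only [Pi.sub_apply, Pi.smul_apply, smul_eq_mul]
  ring

/-- The constant in the bounds of difference operators by `D₀`. -/
def gradBound : ℝ := Real.exp K.symbolBound * (1 + K.ellipticity⁻¹)

lemma one_le_gradBound : 1 ≤ K.gradBound := by
  have h1 : 1 ≤ Real.exp K.symbolBound := Real.one_le_exp K.symbolBound_nonneg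
  have h2 := inv_pos.2 K.ellipticity_pos
  unfold gradBound; nlinarith

/-- Dissipativity of `D₀`, and its control of one time difference and two space differences. -/
lemma D0Symbol_bounds (ψ : AddChar (Lat t s) ℂ) :
    0 ≤ (K.D0Symbol ψ).re ∧ ‖ψ eT - 1‖ ≤ K.gradBound * ‖K.D0Symbol ψ‖ ∧
    ∑ i, ‖ψ (eS i) - 1‖ ^ 2 ≤ K.gradBound * ‖K.D0Symbol ψ‖ := by
  obtain ⟨h1, h2, h3⟩ := norm_one_sub_exp_mul (K.energy_nonneg (momentum (spatialChar ψ)))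
    (K.energy_le _) (AddChar.norm_apply ψ eT)
  change 0 ≤ (K.D0Symbol ψ).re at h1
  change _ ≤ _ * ‖K.D0Symbol ψ‖ at h2
  change _ ≤ _ * ‖K.D0Symbol ψ‖ at h3
  have hc := K.ellipticity_pos
  have hi := inv_pos.2 hc
  have he := Real.exp_pos K.symbolBound
  have hn := norm_nonneg (K.D0Symbol ψ)
  refine ⟨h1, h2.trans ?_, ?_⟩
  · unfold gradBound
    gcongr
    nlinarith
  · have h4 := K.le_symbol_re (momentum (spatialChar ψ))
    simp only [← addChar_single, spatialChar_apply] at h4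
    change K.ellipticity * (∑ i, ‖ψ (eS i) - 1‖ ^ 2) ≤ K.energy _ at h4
    have h5 : ∑ i, ‖ψ (eS i) - 1‖ ^ 2 ≤
        K.ellipticity⁻¹ * (Real.exp K.symbolBound * ‖K.D0Symbol ψ‖) := by
      rw [le_inv_mul_iff₀ hc]; exact h4.trans h3
    refine h5.trans ?_
    unfold gradBound
    nlinarith [mul_nonneg he.le hn]

end KineticOperator

end Eigenvectors

/-! ### Difference operators are controlled by `D_j` -/

section Differences
variable {t s : ℕ}

/-- Translation of a field. -/
def shift (e : Lat t s) (f : Lat t s → ℂ) : Lat t s → ℂ := fun x => f (x + e)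

variable [NeZero t] [NeZero s]

lemma shift_sum_addChar (e : Lat t s) (a : AddChar (Lat t s) ℂ → ℂ) :
    shift e (∑ ψ, a ψ • (ψ : Lat t s → ℂ)) - ∑ ψ, a ψ • (ψ : Lat t s → ℂ) =
      ∑ ψ, ((ψ e - 1) * a ψ) • (ψ : Lat t s → ℂ) := by
  funext x
  simp only [shift, Pi.sub_apply, Finset.sum_apply, Pi.smul_apply, smul_eq_mul,
    ← Finset.sum_sub_distrib, AddChar.map_add_eq_mul]
  exact Finset.sum_congr rfl fun ψ _ => by ring

lemma l2_shift (e : Lat t s) (f : Lat t s → ℂ) : l2 (shift e f) = l2 f :=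
  l2_comp_equiv (Equiv.addRight e) f

namespace KineticOperator
variable (K : KineticOperator)

lemma D0_mulVec_sum (a : AddChar (Lat t s) ℂ → ℂ) :
    K.D0 s t *ᵥ (∑ ψ, a ψ • (ψ : Lat t s → ℂ)) =
      ∑ ψ, (K.D0Symbol ψ * a ψ) • (ψ : Lat t s → ℂ) := by
  rw [mulVec_sum]
  refine Finset.sum_congr rfl fun ψ _ => ?_
  rw [mulVec_smul, D0_mulVec, smul_smul, mul_comm]

lemma re_star_dotProduct_D0_nonneg (f : Lat t s → ℂ) :
    0 ≤ (star f ⬝ᵥ (K.D0 s t *ᵥ f)).re := by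
  obtain ⟨a, rfl⟩ := exists_eq_sum_addChar f
  rw [D0_mulVec_sum, star_sum_addChar_dotProduct, ← Complex.ofReal_natCast, Complex.re_ofReal_mul,
    Complex.re_sum]
  refine mul_nonneg (by positivity) (Finset.sum_nonneg fun ψ _ => ?_)
  rw [mul_left_comm, Complex.conj_mul', ← Complex.ofReal_pow, Complex.re_mul_ofReal]
  exact mul_nonneg (K.D0Symbol_bounds ψ).1 (sq_nonneg _)

lemma l2_timeDiff_le (f : Lat t s → ℂ) :
    l2 (shift eT f - f) ≤ K.gradBound * l2 (K.D0 s t *ᵥ f) := by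
  obtain ⟨a, rfl⟩ := exists_eq_sum_addChar f
  have hC := K.one_le_gradBound
  refine (pow_le_pow_iff_left₀ (l2_nonneg _)
    (mul_nonneg (by linarith) (l2_nonneg _)) two_ne_zero).1 ?_
  rw [mul_pow, shift_sum_addChar, D0_mulVec_sum, l2_sum_addChar_sq, l2_sum_addChar_sq,
    mul_left_comm (K.gradBound ^ 2), Finset.mul_sum (a := K.gradBound ^ 2)]
  refine mul_le_mul_of_nonneg_left (Finset.sum_le_sum fun ψ _ => ?_) (by positivity)
  rw [← mul_pow, norm_mul, norm_mul, ← mul_assoc]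
  gcongr
  exact (K.D0Symbol_bounds ψ).2.1

lemma sum_l2_spaceDiff_sq_le (f : Lat t s → ℂ) :
    ∑ i, l2 (shift (eS i) f - f) ^ 2 ≤ K.gradBound * (l2 (K.D0 s t *ᵥ f) * l2 f) := by
  obtain ⟨a, rfl⟩ := exists_eq_sum_addChar f
  have hC := K.one_le_gradBound
  simp only [shift_sum_addChar, D0_mulVec_sum, l2_sum_addChar_sq, ← Finset.mul_sum]
  rw [Finset.sum_comm]
  have h1 : ∀ ψ : AddChar (Lat t s) ℂ, ∑ i, ‖(ψ (eS i) - 1) * a ψ‖ ^ 2 ≤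
      K.gradBound * (‖K.D0Symbol ψ * a ψ‖ * ‖a ψ‖) := fun ψ => by
    simp only [norm_mul, mul_pow, ← Finset.sum_mul]
    have := mul_le_mul_of_nonneg_right (K.D0Symbol_bounds ψ).2.2 (sq_nonneg ‖a ψ‖)
    linarith
  have h2 := Real.sum_mul_le_sqrt_mul_sqrt Finset.univ
    (fun ψ : AddChar (Lat t s) ℂ => ‖K.D0Symbol ψ * a ψ‖) (fun ψ => ‖a ψ‖)
  have h3 : ∀ b : AddChar (Lat t s) ℂ → ℂ, l2 (∑ ψ, b ψ • (ψ : Lat t s → ℂ)) =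
      Real.sqrt (Fintype.card (Lat t s)) * Real.sqrt (∑ ψ, ‖b ψ‖ ^ 2) := fun b => by
    rw [← Real.sqrt_mul (by positivity), ← l2_sum_addChar_sq, Real.sqrt_sq (l2_nonneg _)]
  rw [h3, h3]
  have h4 := Real.mul_self_sqrt (Nat.cast_nonneg (α := ℝ) (Fintype.card (Lat t s)))
  calc _ ≤ (Fintype.card (Lat t s) : ℝ) *
        ∑ ψ : AddChar (Lat t s) ℂ, K.gradBound * (‖K.D0Symbol ψ * a ψ‖ * ‖a ψ‖) := by
        gcongr with ψ; exact h1 ψ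
    _ ≤ (Fintype.card (Lat t s) : ℝ) * (K.gradBound *
        (Real.sqrt (∑ ψ, ‖K.D0Symbol ψ * a ψ‖ ^ 2) * Real.sqrt (∑ ψ, ‖a ψ‖ ^ 2))) := by
        rw [← Finset.mul_sum]; gcongr
    _ = _ := by
      linear_combination (-(K.gradBound * √(∑ ψ, ‖K.D0Symbol ψ * a ψ‖ ^ 2) *
        √(∑ ψ, ‖a ψ‖ ^ 2))) * h4

lemma energy_zero : K.energy 0 = 0 := by
  simp [energy, symbol]

lemma D0_mulVec_one : K.D0 s t *ᵥ (1 : Lat t s → ℂ) = 0 := by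
  have h := K.D0_mulVec (0 : AddChar (Lat t s) ℂ)
  have h2 : momentum (spatialChar (0 : AddChar (Lat t s) ℂ)) = 0 := by
    funext i; simp [momentum, spatialChar_apply]
  rwa [D0Symbol, h2, energy_zero, AddChar.coe_zero, Pi.one_apply, neg_zero, Real.exp_zero,
    Complex.ofReal_one, one_mul, sub_self, zero_smul] at h

end KineticOperator

variable (L T S : ℕ) [NeZero L] [NeZero T] [NeZero S] (j : ℕ)

/-- The gradient of a field on the fine lattice, in units of the unit lattice. -/
def gradNorm {L T S : ℕ} [NeZero L] [NeZero T] [NeZero S] {j : ℕ}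
    (f : FineLat L T S j → ℂ) : ℝ :=
  (L : ℝ) ^ (2 * j) * l2 (shift eT f - f) + (L : ℝ) ^ j * ∑ i, l2 (shift (eS i) f - f)

lemma gradNorm_nonneg (f : FineLat L T S j → ℂ) : 0 ≤ gradNorm f :=
  add_nonneg (mul_nonneg (by positivity) (l2_nonneg _))
    (mul_nonneg (by positivity) (Finset.sum_nonneg fun _ _ => l2_nonneg _))

namespace KineticOperator
variable (K : KineticOperator)

lemma l2_D_mulVec (f : FineLat L T S j → ℂ) : l2 (K.D L T S j *ᵥ f) =
    (L : ℝ) ^ (2 * j) * l2 (K.D0 (sSize L S j) (tSize L T j) *ᵥ f) := by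
  rw [D, smul_mulVec, l2_smul]; simp

/-- `D_j` is of first order in time and of second order in space, so that the space differences are
bounded by interpolation between `D_j f` and `f`. The scaling of `D_j` makes the bound independent
of `j`. -/
lemma gradNorm_le (f : FineLat L T S j → ℂ) : gradNorm f ≤
    K.gradBound * (l2 (K.D L T S j *ᵥ f) + 3 * Real.sqrt (l2 (K.D L T S j *ᵥ f) * l2 f)) := by
  have hC := K.one_le_gradBound
  have h1 := K.l2_timeDiff_le f
  have h2 := K.sum_l2_spaceDiff_sq_le f
  have hL : (0 : ℝ) < L := by exact_mod_cast Nat.pos_of_ne_zero (NeZero.ne L)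
  have h3 : ∀ i, (L : ℝ) ^ j * l2 (shift (eS i) f - f) ≤
      K.gradBound * Real.sqrt (l2 (K.D L T S j *ᵥ f) * l2 f) := fun i => by
    have h4 : ((L : ℝ) ^ j * l2 (shift (eS i) f - f)) ^ 2 ≤
        K.gradBound * (l2 (K.D L T S j *ᵥ f) * l2 f) := by
      have h5 := (Finset.single_le_sum (f := fun i => l2 (shift (eS i) f - f) ^ 2)
        (fun _ _ => sq_nonneg _) (Finset.mem_univ i)).trans h2
      rw [l2_D_mulVec, mul_pow, ← pow_mul, mul_comm j 2]
      have := mul_le_mul_of_nonneg_left h5 (by positivity : (0 : ℝ) ≤ (L : ℝ) ^ (2 * j))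
      linarith
    have hx : 0 ≤ l2 (K.D L T S j *ᵥ f) * l2 f := mul_nonneg (l2_nonneg _) (l2_nonneg _)
    refine (pow_le_pow_iff_left₀ (mul_nonneg (by positivity) (l2_nonneg _))
      (by positivity) two_ne_zero).1 (h4.trans ?_)
    rw [mul_pow, Real.sq_sqrt hx]
    gcongr
    nlinarith
  unfold gradNorm
  rw [mul_add]
  refine add_le_add ?_ ?_
  · rw [l2_D_mulVec, mul_left_comm]; gcongr
  · rw [Finset.mul_sum]
    refine (Finset.sum_le_sum fun i _ => h3 i).trans ?_
    simp; linarith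

lemma re_star_dotProduct_D_nonneg (f : FineLat L T S j → ℂ) :
    0 ≤ (star f ⬝ᵥ (K.D L T S j *ᵥ f)).re := by
  have h : (L : ℂ) ^ (2 * j) = (((L : ℝ) ^ (2 * j) : ℝ) : ℂ) := by push_cast; rfl
  rw [D, smul_mulVec, dotProduct_smul, smul_eq_mul, h, Complex.re_ofReal_mul]
  exact mul_nonneg (by positivity) (K.re_star_dotProduct_D0_nonneg f)

lemma D_mulVec_one : K.D L T S j *ᵥ (1 : FineLat L T S j → ℂ) = 0 := by
  rw [D, smul_mulVec, D0_mulVec_one, smul_zero]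

end KineticOperator

end Differences

/-! ### Tiling by boxes -/

section Tiling

lemma natCast_mul_val_natCast (M s n : ℕ) [NeZero s] :
    ((M * ((n : ZMod s)).val : ℕ) : ZMod (M * s)) = ((M * n : ℕ) : ZMod (M * s)) := by
  rw [ZMod.natCast_eq_natCast_iff, ZMod.val_natCast]
  exact Nat.ModEq.mul_left' M (Nat.mod_modEq n s)

lemma natCast_mul_val_add_one (M s : ℕ) [NeZero s] (y : ZMod s) :
    ((M * (y + 1).val : ℕ) : ZMod (M * s)) = ((M * y.val : ℕ) : ZMod (M * s)) + M := by
  have h := natCast_mul_val_natCast M s (y.val + 1)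
  push_cast [ZMod.natCast_zmod_val] at h ⊢
  rw [h]; ring

/-- Every point of `ℤ/(M s)` is a point of `M ℤ/(M s)` plus a centred remainder. -/
lemma exists_coarse_add_remainder {M s : ℕ} [NeZero s] (hM : Odd M) [NeZero (M * s)]
    (u : ZMod (M * s)) :
    ∃ (y : ZMod s) (z : ℤ), z ∈ Finset.Icc (-(((M : ℤ) - 1) / 2)) (((M : ℤ) - 1) / 2) ∧
      ((M * y.val : ℕ) : ZMod (M * s)) + (z : ZMod (M * s)) = u := by
  obtain ⟨k, hk⟩ := hM
  have hk2 : ((M : ℤ) - 1) / 2 = k := by omega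
  refine ⟨((u.val + k) / M : ℕ), (((u.val + k) % M : ℕ) : ℤ) - k, ?_, ?_⟩
  · have := Nat.mod_lt (u.val + k) (by omega : 0 < M)
    rw [hk2, Finset.mem_Icc]; omega
  · rw [natCast_mul_val_natCast]
    have h := Nat.div_add_mod (u.val + k) M
    have h2 : (((M * ((u.val + k) / M) : ℕ) : ZMod (M * s))) +
        (((u.val + k) % M : ℕ) : ZMod (M * s)) = u + k := by
      rw [← Nat.cast_add, h, Nat.cast_add, ZMod.natCast_zmod_val]
    push_cast at h2
    rw [Int.cast_sub, Int.cast_natCast, Int.cast_natCast, Nat.cast_mul]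
    linear_combination h2

variable (L : ℕ) {t s : ℕ}

/-- The point of the lattice with integer coordinates `z`. -/
def latPt (z : ℤ × (Fin 3 → ℤ)) : Lat t s := ((z.1 : ZMod t), fun i => (z.2 i : ZMod s))

/-- The inclusion of the coarse lattice as the sublattice `L² ℤ × L ℤ³`. -/
def coarse (y : Lat t s) : Lat (L ^ 2 * t) (L * s) :=
  (((L ^ 2 * y.1.val : ℕ) : ZMod (L ^ 2 * t)), fun i => ((L * (y.2 i).val : ℕ) : ZMod (L * s)))

lemma card_box (hL : Odd L) : (box L).card = L ^ 5 := by
  have h : ∀ M : ℕ, Odd M →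
      (Finset.Icc (-(((M : ℤ) - 1) / 2)) (((M : ℤ) - 1) / 2)).card = M := fun M hM => by
    obtain ⟨k, hk⟩ := hM
    rw [Int.card_Icc]; omega
  have h2 := h (L ^ 2) hL.pow
  push_cast at h2
  rw [box, Finset.card_product, Fintype.card_piFinset, h2, Finset.prod_const, h L hL]
  simp; ring

variable [NeZero t] [NeZero s] [NeZero (L ^ 2 * t)] [NeZero (L * s)]

lemma coarse_add_box_bijective (hL : Odd L) :
    Function.Bijective fun p : Lat t s × {z // z ∈ box L} => coarse L p.1 + latPt p.2.1 := by
  rw [Fintype.bijective_iff_surjective_and_card]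
  constructor
  · rintro ⟨u, v⟩
    obtain ⟨y, z, hz, hu⟩ := exists_coarse_add_remainder (hL.pow (n := 2)) u
    choose ys zs hzs hv using fun i => exists_coarse_add_remainder hL (v i)
    refine ⟨((y, ys), ⟨(z, zs), ?_⟩), ?_⟩
    · rw [box, Finset.mem_product]
      push_cast at hz
      exact ⟨hz, Fintype.mem_piFinset.2 hzs⟩
    · exact Prod.ext hu (funext hv)
  · simp only [Fintype.card_prod, Fintype.card_coe, card_box L hL, ZMod.card, Fintype.card_pi,
      Finset.prod_const, Finset.card_univ, Fintype.card_fin]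
    ring

/-- The translates of the box by the sublattice tile the lattice. -/
lemma sum_coarse_add_box (hL : Odd L) {M : Type*} [AddCommMonoid M]
    (g : Lat (L ^ 2 * t) (L * s) → M) :
    ∑ z ∈ box L, ∑ y : Lat t s, g (coarse L y + latPt z) = ∑ u, g u := by
  rw [← (coarse_add_box_bijective L hL).sum_comp g, Fintype.sum_prod_type, Finset.sum_comm]
  exact Finset.sum_congr rfl fun y _ => (Finset.sum_coe_sort (box L) _).symm

omit [NeZero (L ^ 2 * t)] [NeZero (L * s)] in
lemma coarse_add_eT (y : Lat t s) :
    coarse L (y + eT) = coarse L y + ((L ^ 2 : ℕ) : ℤ) • eT := by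
  refine Prod.ext ?_ ?_
  · have h := natCast_mul_val_add_one (L ^ 2) t y.1
    rw [Nat.cast_pow L 2] at h
    simpa [coarse, eT] using h
  · funext i; simp [coarse, eT]

omit [NeZero (L ^ 2 * t)] [NeZero (L * s)] in
lemma coarse_add_eS (i : Fin 3) (y : Lat t s) :
    coarse L (y + eS i) = coarse L y + (L : ℤ) • eS i := by
  refine Prod.ext ?_ ?_
  · simp [coarse, eS]
  · funext l
    by_cases h : l = i
    · subst h
      simpa [coarse, eS] using natCast_mul_val_add_one L s (y.2 l)
    · simp [coarse, eS, Pi.single_apply, h]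

end Tiling

/-! ### Translation estimates -/

section Translation
variable {t s : ℕ} [NeZero t] [NeZero s]

lemma l2_shift_add_sub_le (a b : Lat t s) (f : Lat t s → ℂ) :
    l2 (shift (a + b) f - f) ≤ l2 (shift a f - f) + l2 (shift b f - f) := by
  have h : shift (a + b) f - f = shift b (shift a f - f) + (shift b f - f) := by
    funext x; simp [shift, add_assoc, add_comm b a]
  rw [h]
  exact (l2_add_le _ _).trans (by rw [l2_shift])

lemma l2_shift_nsmul_sub_le (n : ℕ) (e : Lat t s) (f : Lat t s → ℂ) :
    l2 (shift (n • e) f - f) ≤ n * l2 (shift e f - f) := by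
  induction n with
  | zero =>
    have : shift ((0 : ℕ) • e) f - f = 0 := by funext x; simp [shift]
    rw [this, l2_eq_zero.2 rfl]; simp
  | succ n ih =>
    rw [succ_nsmul]
    refine (l2_shift_add_sub_le _ _ _).trans ?_
    push_cast; linarith

lemma l2_shift_neg_sub (e : Lat t s) (f : Lat t s → ℂ) :
    l2 (shift (-e) f - f) = l2 (shift e f - f) := by
  have h : shift (-e) f - f = shift (-e) ((-1 : ℂ) • (shift e f - f)) := by
    funext x; simp [shift]
  rw [h, l2_shift, l2_smul]; simp

lemma l2_shift_zsmul_sub_le (n : ℤ) (e : Lat t s) (f : Lat t s → ℂ) :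
    l2 (shift (n • e) f - f) ≤ |(n : ℝ)| * l2 (shift e f - f) := by
  obtain ⟨k, rfl | rfl⟩ := n.eq_nat_or_neg
  · simpa using l2_shift_nsmul_sub_le k e f
  · rw [neg_smul, l2_shift_neg_sub]
    simpa using l2_shift_nsmul_sub_le k e f

omit [NeZero t] [NeZero s] in
lemma latPt_eq (z : ℤ × (Fin 3 → ℤ)) :
    (latPt z : Lat t s) = z.1 • eT + (z.2 0 • eS 0 + (z.2 1 • eS 1 + z.2 2 • eS 2)) := by
  refine Prod.ext ?_ ?_
  · simp [latPt, eT, eS]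
  · funext l
    fin_cases l <;> simp [latPt, eT, eS]

/-- The change of a field under translation by a point of the box. -/
lemma l2_shift_box_sub_le {L : ℕ} {z : ℤ × (Fin 3 → ℤ)} (hz : z ∈ box L) (f : Lat t s → ℂ) :
    l2 (shift (latPt z) f - f) ≤
      (L : ℝ) ^ 2 * l2 (shift eT f - f) + L * ∑ i, l2 (shift (eS i) f - f) := by
  rw [box, Finset.mem_product, Fintype.mem_piFinset] at hz
  obtain ⟨h0, h1⟩ := hz
  have hT : |(z.1 : ℝ)| ≤ (L : ℝ) ^ 2 := by
    have : |z.1| ≤ (L : ℤ) ^ 2 := by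
      have := sq_nonneg (L : ℤ)
      rw [Finset.mem_Icc] at h0
      rw [abs_le]; constructor <;> omega
    exact_mod_cast this
  have hS : ∀ i, |(z.2 i : ℝ)| ≤ (L : ℝ) := fun i => by
    have : |z.2 i| ≤ (L : ℤ) := by
      have := h1 i
      rw [Finset.mem_Icc] at this
      rw [abs_le]; constructor <;> omega
    exact_mod_cast this
  have bd : ∀ (n : ℤ) (e : Lat t s) (C : ℝ), |(n : ℝ)| ≤ C →
      l2 (shift (n • e) f - f) ≤ C * l2 (shift e f - f) := fun n e C h =>
    (l2_shift_zsmul_sub_le n e f).trans (mul_le_mul_of_nonneg_right h (l2_nonneg _))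
  rw [latPt_eq]
  refine (l2_shift_add_sub_le _ _ _).trans (add_le_add (bd _ _ _ hT) ?_)
  refine (l2_shift_add_sub_le _ _ _).trans ?_
  rw [Fin.sum_univ_three]
  have := l2_shift_add_sub_le (z.2 1 • eS 1) (z.2 2 • eS 2) f
  have := bd _ (eS 0) _ (hS 0)
  have := bd _ (eS 1) _ (hS 1)
  have := bd _ (eS 2) _ (hS 2)
  linarith

end Translation

/-! ### Block spin averages -/

section Steps
variable (L : ℕ) {t s : ℕ} [NeZero t] [NeZero s]

lemma boxMatrix_mulVec (f : Lat t s → ℂ) :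
    boxMatrix L t s *ᵥ f = (1 / (L : ℂ) ^ 5) • ∑ z ∈ box L, shift (latPt z) f := by
  funext x
  simp only [mulVec, dotProduct, boxMatrix, Matrix.of_apply, mul_assoc, ← Finset.mul_sum,
    Finset.sum_mul, ite_mul, one_mul, zero_mul, Pi.smul_apply, smul_eq_mul, Finset.sum_apply]
  rw [Finset.sum_comm]
  simp [shift, latPt]

lemma boxMatrix_mulVec_shift (e : Lat t s) (f : Lat t s → ℂ) :
    boxMatrix L t s *ᵥ shift e f = shift e (boxMatrix L t s *ᵥ f) := by
  simp only [boxMatrix_mulVec]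
  funext x
  simp [shift, add_right_comm]

lemma boxMatrix_pow_mulVec_shift (n : ℕ) (e : Lat t s) (f : Lat t s → ℂ) :
    (boxMatrix L t s ^ n) *ᵥ shift e f = shift e ((boxMatrix L t s ^ n) *ᵥ f) := by
  induction n with
  | zero => simp
  | succ n ih => rw [pow_succ', ← mulVec_mulVec, ih, boxMatrix_mulVec_shift, mulVec_mulVec]

variable {L}

lemma pow_five_ne_zero (hL : Odd L) : ((L : ℝ) ^ 5) ≠ 0 :=
  pow_ne_zero _ (by exact_mod_cast hL.pos.ne')

lemma l2_boxMatrix_sub_le (hL : Odd L) {R : ℝ} (f g : Lat t s → ℂ)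
    (h : ∀ z ∈ box L, l2 (shift (latPt z) f - g) ≤ R) :
    l2 (boxMatrix L t s *ᵥ f - g) ≤ R := by
  have h5 := pow_five_ne_zero hL
  have h5c : ((L : ℂ) ^ 5) ≠ 0 := by exact_mod_cast h5
  have hb : boxMatrix L t s *ᵥ f - g =
      (1 / (L : ℂ) ^ 5) • ∑ z ∈ box L, (shift (latPt z) f - g) := by
    rw [boxMatrix_mulVec, Finset.sum_sub_distrib, Finset.sum_const, card_box L hL, smul_sub]
    congr 1
    funext x
    simp [h5c]
  have hs : ∀ I : Finset (ℤ × (Fin 3 → ℤ)), I ⊆ box L →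
      l2 (∑ z ∈ I, (shift (latPt z) f - g)) ≤ I.card * R := fun I => by
    classical
    induction I using Finset.induction_on with
    | empty => intro _; simp [l2_eq_zero.2]
    | insert a I ha ih =>
      intro hI
      rw [Finset.sum_insert ha, Finset.card_insert_of_notMem ha]
      have h1 := ih ((Finset.subset_insert a I).trans hI)
      have h2 := h a (hI (Finset.mem_insert_self a I))
      refine (l2_add_le _ _).trans ?_
      push_cast; linarith
  have h6 := hs _ subset_rfl
  rw [card_box L hL] at h6
  rw [hb, l2_smul]
  have h7 : ‖(1 / (L : ℂ) ^ 5)‖ = ((L : ℝ) ^ 5)⁻¹ := by simp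
  rw [h7, inv_mul_le_iff₀ (by positivity)]
  exact_mod_cast h6

lemma l2_boxMatrix_le (hL : Odd L) (f : Lat t s → ℂ) : l2 (boxMatrix L t s *ᵥ f) ≤ l2 f := by
  have := l2_boxMatrix_sub_le hL f 0 (R := l2 f) fun z _ => by rw [sub_zero, l2_shift]
  simpa using this

lemma l2_boxMatrix_pow_le (hL : Odd L) (n : ℕ) (f : Lat t s → ℂ) :
    l2 ((boxMatrix L t s ^ n) *ᵥ f) ≤ l2 f := by
  induction n with
  | zero => simp
  | succ n ih =>
    rw [pow_succ', ← mulVec_mulVec]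
    exact (l2_boxMatrix_le hL _).trans ih

lemma l2_boxMatrix_pow_sub_le (hL : Odd L) (n : ℕ) (f : Lat t s → ℂ) :
    l2 ((boxMatrix L t s ^ n) *ᵥ f - f) ≤
      n * ((L : ℝ) ^ 2 * l2 (shift eT f - f) + L * ∑ i, l2 (shift (eS i) f - f)) := by
  induction n with
  | zero => simp [l2_eq_zero.2]
  | succ n ih =>
    have h1 : (boxMatrix L t s ^ (n + 1)) *ᵥ f - f =
        boxMatrix L t s *ᵥ ((boxMatrix L t s ^ n) *ᵥ f - f) + (boxMatrix L t s *ᵥ f - f) := by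
      rw [mulVec_sub, mulVec_mulVec, ← pow_succ']; simp
    rw [h1]
    have h2 := l2_boxMatrix_sub_le hL f f fun z hz => l2_shift_box_sub_le hz f
    have h3 := l2_boxMatrix_le hL ((boxMatrix L t s ^ n) *ᵥ f - f)
    refine (l2_add_le _ _).trans ?_
    push_cast; linarith

lemma boxMatrix_mulVec_one (hL : Odd L) : boxMatrix L t s *ᵥ (1 : Lat t s → ℂ) = 1 := by
  have h5c : ((L : ℂ) ^ 5) ≠ 0 := by exact_mod_cast pow_five_ne_zero hL
  rw [boxMatrix_mulVec]
  funext x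
  simp [shift, card_box L hL, h5c]

lemma sum_boxMatrix_mulVec (hL : Odd L) (f : Lat t s → ℂ) :
    ∑ x, (boxMatrix L t s *ᵥ f) x = ∑ x, f x := by
  have h5c : ((L : ℂ) ^ 5) ≠ 0 := by exact_mod_cast pow_five_ne_zero hL
  rw [boxMatrix_mulVec]
  simp only [Pi.smul_apply, Finset.sum_apply, smul_eq_mul, ← Finset.mul_sum]
  rw [Finset.sum_comm]
  have h : ∀ z ∈ box L, ∑ x, shift (latPt z) f x = ∑ x, f x := fun z _ =>
    Fintype.sum_equiv (Equiv.addRight (latPt z : Lat t s)) _ _ fun _ => rfl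
  rw [Finset.sum_congr rfl h, Finset.sum_const, card_box L hL]
  simp [h5c]

lemma boxMatrix_pow_succ_mulVec (n : ℕ) (f : Lat t s → ℂ) :
    (boxMatrix L t s ^ (n + 1)) *ᵥ f = boxMatrix L t s *ᵥ ((boxMatrix L t s ^ n) *ᵥ f) := by
  rw [pow_succ', mulVec_mulVec]

lemma sum_boxMatrix_pow_mulVec (hL : Odd L) (n : ℕ) (f : Lat t s → ℂ) :
    ∑ x, ((boxMatrix L t s ^ n) *ᵥ f) x = ∑ x, f x := by
  induction n with
  | zero => simp
  | succ n ih => rw [boxMatrix_pow_succ_mulVec, sum_boxMatrix_mulVec hL, ih]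

lemma boxMatrix_pow_mulVec_one (hL : Odd L) (n : ℕ) :
    (boxMatrix L t s ^ n) *ᵥ (1 : Lat t s → ℂ) = 1 := by
  induction n with
  | zero => simp
  | succ n ih => rw [boxMatrix_pow_succ_mulVec, ih, boxMatrix_mulVec_one hL]

variable [NeZero L] [NeZero (L ^ 2 * t)] [NeZero (L * s)] (𝔮 : ℕ)

lemma stepQ_mulVec (f : Lat (L ^ 2 * t) (L * s) → ℂ) (y : Lat t s) :
    (stepQ L t s 𝔮 *ᵥ f) y = ((boxMatrix L (L ^ 2 * t) (L * s) ^ 𝔮) *ᵥ f) (coarse L y) := by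
  rw [stepQ, ← mulVec_mulVec]
  conv_lhs => rw [mulVec, dotProduct]
  simp only [sampleMatrix, Matrix.of_apply, ite_mul, one_mul, zero_mul, Finset.sum_ite_eq',
    Finset.mem_univ, if_true]
  rfl

lemma stepQ_mulVec_shift (e : Lat (L ^ 2 * t) (L * s)) (f : Lat (L ^ 2 * t) (L * s) → ℂ)
    (y : Lat t s) : (stepQ L t s 𝔮 *ᵥ shift e f) y =
      ((boxMatrix L (L ^ 2 * t) (L * s) ^ 𝔮) *ᵥ f) (coarse L y + e) := by
  rw [stepQ_mulVec, boxMatrix_pow_mulVec_shift]; rfl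

lemma shift_eT_stepQ (f : Lat (L ^ 2 * t) (L * s) → ℂ) :
    shift eT (stepQ L t s 𝔮 *ᵥ f) = stepQ L t s 𝔮 *ᵥ shift (((L ^ 2 : ℕ) : ℤ) • eT) f := by
  funext y
  rw [stepQ_mulVec_shift, ← coarse_add_eT, ← stepQ_mulVec]; rfl

lemma shift_eS_stepQ (i : Fin 3) (f : Lat (L ^ 2 * t) (L * s) → ℂ) :
    shift (eS i) (stepQ L t s 𝔮 *ᵥ f) = stepQ L t s 𝔮 *ᵥ shift ((L : ℤ) • eS i) f := by
  funext y
  rw [stepQ_mulVec_shift, ← coarse_add_eS, ← stepQ_mulVec]; rfl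

lemma sum_stepQ_mulVec (hL : Odd L) (h𝔮 : 1 ≤ 𝔮) (f : Lat (L ^ 2 * t) (L * s) → ℂ) :
    ∑ y, (stepQ L t s 𝔮 *ᵥ f) y = ((L : ℂ) ^ 5)⁻¹ * ∑ x, f x := by
  obtain ⟨n, rfl⟩ := Nat.exists_eq_add_of_le' h𝔮
  have h : ∀ g : Lat (L ^ 2 * t) (L * s) → ℂ,
      ∑ y, (boxMatrix L (L ^ 2 * t) (L * s) *ᵥ g) (coarse L y : Lat (L ^ 2 * t) (L * s)) =
        ((L : ℂ) ^ 5)⁻¹ * ∑ x, g x := fun g => by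
    rw [← sum_coarse_add_box L hL g, Finset.sum_comm, boxMatrix_mulVec]
    simp [shift, Finset.mul_sum]
  simp only [stepQ_mulVec, boxMatrix_pow_succ_mulVec, h, sum_boxMatrix_pow_mulVec hL]

lemma stepQ_mulVec_one (hL : Odd L) : stepQ L t s 𝔮 *ᵥ (1 : Lat (L ^ 2 * t) (L * s) → ℂ) = 1 := by
  funext y
  rw [stepQ_mulVec, boxMatrix_pow_mulVec_one hL]; rfl

/-- The square root of the volume `L⁵` of a block. -/
def blockWeight (L : ℕ) : ℝ := Real.sqrt ((L : ℝ) ^ 5)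

omit [NeZero L] in
lemma blockWeight_sq : blockWeight L ^ 2 = (L : ℝ) ^ 5 := Real.sq_sqrt (by positivity)

omit [NeZero L] in
lemma blockWeight_nonneg : 0 ≤ blockWeight L := Real.sqrt_nonneg _

lemma blockWeight_pos : 0 < blockWeight L := Real.sqrt_pos.2 (by
  have := Nat.pos_of_ne_zero (NeZero.ne L); positivity)

omit [NeZero L] in
lemma sum_box_l2_coarse_sq (hL : Odd L) (g : Lat (L ^ 2 * t) (L * s) → ℂ) :
    ∑ z ∈ box L, l2 (fun y : Lat t s => g (coarse L y + latPt z)) ^ 2 = l2 g ^ 2 := by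
  simp only [l2_sq]
  exact sum_coarse_add_box L hL fun u => ‖g u‖ ^ 2

/-- By Jensen's inequality and the tiling, averaging over disjoint blocks followed by restriction to
the sublattice contracts by `L^{-5/2}`. -/
lemma blockWeight_mul_l2_stepQ_le (hL : Odd L) (h𝔮 : 1 ≤ 𝔮) (f : Lat (L ^ 2 * t) (L * s) → ℂ) :
    blockWeight L * l2 (stepQ L t s 𝔮 *ᵥ f) ≤ l2 f := by
  obtain ⟨n, rfl⟩ := Nat.exists_eq_add_of_le' h𝔮
  refine le_trans ?_ (l2_boxMatrix_pow_le hL n f)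
  set g := (boxMatrix L (L ^ 2 * t) (L * s) ^ n) *ᵥ f with hg
  refine (pow_le_pow_iff_left₀ (mul_nonneg blockWeight_nonneg (l2_nonneg _)) (l2_nonneg _)
    two_ne_zero).1 ?_
  rw [mul_pow, blockWeight_sq, ← sum_box_l2_coarse_sq hL g]
  simp only [l2_sq]
  rw [Finset.sum_comm, Finset.mul_sum]
  refine Finset.sum_le_sum fun y _ => ?_
  have h1 : (stepQ L t s (n + 1) *ᵥ f) y =
      (1 / (L : ℂ) ^ 5) * ∑ z ∈ box L, g (coarse L y + latPt z) := by
    rw [stepQ_mulVec, boxMatrix_pow_succ_mulVec, boxMatrix_mulVec]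
    simp [shift, hg]
  have h2 : ‖∑ z ∈ box L, g (coarse L y + latPt z)‖ ^ 2 ≤
      (L : ℝ) ^ 5 * ∑ z ∈ box L, ‖g (coarse L y + latPt z)‖ ^ 2 := by
    have h3 := sq_sum_le_card_mul_sum_sq (s := box L) (f := fun z => ‖g (coarse L y + latPt z)‖)
    rw [card_box L hL] at h3
    push_cast at h3
    exact (pow_le_pow_left₀ (norm_nonneg _) (norm_sum_le _ _) 2).trans h3
  have h5 : 0 < (L : ℝ) ^ 5 := lt_of_le_of_ne (by positivity) (pow_five_ne_zero hL).symm
  rw [h1, norm_mul, mul_pow]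
  have h7 : ‖(1 / (L : ℂ) ^ 5)‖ = ((L : ℝ) ^ 5)⁻¹ := by simp
  rw [h7]
  calc (L : ℝ) ^ 5 * (((L : ℝ) ^ 5)⁻¹ ^ 2 * ‖∑ z ∈ box L, g (coarse L y + latPt z)‖ ^ 2)
      ≤ (L : ℝ) ^ 5 * (((L : ℝ) ^ 5)⁻¹ ^ 2 *
        ((L : ℝ) ^ 5 * ∑ z ∈ box L, ‖g (coarse L y + latPt z)‖ ^ 2)) := by gcongr
    _ = _ := by rw [sq, mul_assoc, mul_inv_cancel_left₀ h5.ne', inv_mul_cancel_left₀ h5.ne']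

lemma blockWeight_mul_l2_timeDiff_stepQ_le (hL : Odd L) (h𝔮 : 1 ≤ 𝔮)
    (f : Lat (L ^ 2 * t) (L * s) → ℂ) :
    blockWeight L * l2 (shift eT (stepQ L t s 𝔮 *ᵥ f) - stepQ L t s 𝔮 *ᵥ f) ≤
      (L : ℝ) ^ 2 * l2 (shift eT f - f) := by
  rw [shift_eT_stepQ, ← mulVec_sub]
  refine (blockWeight_mul_l2_stepQ_le 𝔮 hL h𝔮 _).trans
    ((l2_shift_zsmul_sub_le ((L ^ 2 : ℕ) : ℤ) eT f).trans_eq ?_)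
  rw [Int.cast_natCast, Nat.abs_cast, Nat.cast_pow]

lemma blockWeight_mul_l2_spaceDiff_stepQ_le (hL : Odd L) (h𝔮 : 1 ≤ 𝔮) (i : Fin 3)
    (f : Lat (L ^ 2 * t) (L * s) → ℂ) :
    blockWeight L * l2 (shift (eS i) (stepQ L t s 𝔮 *ᵥ f) - stepQ L t s 𝔮 *ᵥ f) ≤
      L * l2 (shift (eS i) f - f) := by
  rw [shift_eS_stepQ, ← mulVec_sub]
  refine (blockWeight_mul_l2_stepQ_le 𝔮 hL h𝔮 _).trans ?_
  have h := l2_shift_zsmul_sub_le (L : ℤ) (eS i) f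
  rwa [Int.cast_natCast, Nat.abs_cast] at h

/-- A Poincaré inequality for one block spin average: since the translates of the sublattice
exhaust the lattice, a smoothed field has, up to its variation over a block, the norm of its
restriction to the sublattice. -/
lemma l2_le_stepQ_add (hL : Odd L) (f : Lat (L ^ 2 * t) (L * s) → ℂ) (h𝔮 : 1 ≤ 𝔮) :
    l2 f ≤ blockWeight L * l2 (stepQ L t s 𝔮 *ᵥ f) + (𝔮 + 1) *
      ((L : ℝ) ^ 2 * l2 (shift eT f - f) + L * ∑ i, l2 (shift (eS i) f - f)) := by
  set R := (L : ℝ) ^ 2 * l2 (shift eT f - f) + L * ∑ i, l2 (shift (eS i) f - f) with hR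
  have hR0 : 0 ≤ R := add_nonneg (mul_nonneg (by positivity) (l2_nonneg _))
    (mul_nonneg (by positivity) (Finset.sum_nonneg fun _ _ => l2_nonneg _))
  set g := (boxMatrix L (L ^ 2 * t) (L * s) ^ 𝔮) *ᵥ f with hg
  have h1 : l2 g ≤ blockWeight L * l2 (stepQ L t s 𝔮 *ᵥ f) + R := by
    refine (pow_le_pow_iff_left₀ (l2_nonneg _) (add_nonneg (mul_nonneg blockWeight_nonneg
      (l2_nonneg _)) hR0) two_ne_zero).1 ?_
    rw [← sum_box_l2_coarse_sq hL g]
    -- The restriction of `g` to a translate of the sublattice is the block spin average of a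
    -- translate of `f`.
    have h2 : ∀ z ∈ box L, l2 (fun y : Lat t s => g (coarse L y + latPt z)) ^ 2 ≤
        ((L : ℝ) ^ 5)⁻¹ * (blockWeight L * l2 (stepQ L t s 𝔮 *ᵥ f) + R) ^ 2 := fun z hz => by
      have h3 : (fun y : Lat t s => g (coarse L y + latPt z)) =
          stepQ L t s 𝔮 *ᵥ shift (latPt z) f := by
        funext y; rw [stepQ_mulVec_shift]
      have h4 := l2_le_add_sub (stepQ L t s 𝔮 *ᵥ shift (latPt z) f) (stepQ L t s 𝔮 *ᵥ f)
      rw [← mulVec_sub] at h4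
      have h5 := (blockWeight_mul_l2_stepQ_le 𝔮 hL h𝔮 (shift (latPt z) f - f)).trans
        (l2_shift_box_sub_le hz f)
      have h6 := mul_le_mul_of_nonneg_left h4 (blockWeight_nonneg (L := L))
      rw [h3, le_inv_mul_iff₀ (lt_of_le_of_ne (by positivity) (pow_five_ne_zero hL).symm),
        ← blockWeight_sq, ← mul_pow]
      refine pow_le_pow_left₀ (mul_nonneg blockWeight_nonneg (l2_nonneg _)) ?_ 2
      linarith
    refine (Finset.sum_le_sum h2).trans ?_
    rw [Finset.sum_const, card_box L hL, nsmul_eq_mul]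
    push_cast
    rw [mul_inv_cancel_left₀ (pow_five_ne_zero hL)]
  have h2 := l2_boxMatrix_pow_sub_le hL 𝔮 f
  have h3 := l2_sub_le g (g - f)
  rw [sub_sub_cancel] at h3
  linarith

end Steps

/-! ### The composed averages `Q_j` -/

section Compositions
variable {𝔮 L T S : ℕ} [NeZero L] [NeZero T] [NeZero S]

variable (𝔮) in
/-- One block spin average, from the fine lattice of generation `j + 1` to that of generation
`j`. -/
def blockAverage (j : ℕ) (f : FineLat L T S (j + 1) → ℂ) : FineLat L T S j → ℂ :=
  letI : NeZero (L ^ 2 * tSize L T j) := tSize_neZero L T (j + 1)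
  letI : NeZero (L * sSize L S j) := sSize_neZero L S (j + 1)
  mulVec (stepQ L (tSize L T j) (sSize L S j) 𝔮) f

lemma Q_succ_mulVec (j : ℕ) (f : FineLat L T S (j + 1) → ℂ) :
    Q 𝔮 L T S (j + 1) *ᵥ f = Q 𝔮 L T S j *ᵥ blockAverage 𝔮 j f := by
  have : NeZero (L ^ 2 * tSize L T j) := tSize_neZero L T (j + 1)
  have : NeZero (L * sSize L S j) := sSize_neZero L S (j + 1)
  have h (g : Lat (L ^ 2 * tSize L T j) (L * sSize L S j) → ℂ) := mulVec_mulVec g (Q 𝔮 L T S j)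
    (stepQ L (tSize L T j) (sSize L S j) 𝔮)
  exact (h f).symm

lemma Q_zero_mulVec (f : FineLat L T S 0 → ℂ) : Q 𝔮 L T S 0 *ᵥ f = f := one_mulVec _

lemma blockWeight_pow_mul_l2_Q_le (hL : Odd L) (h𝔮 : 1 ≤ 𝔮) (j : ℕ) (f : FineLat L T S j → ℂ) :
    blockWeight L ^ j * l2 (Q 𝔮 L T S j *ᵥ f) ≤ l2 f := by
  induction j with
  | zero => rw [Q_zero_mulVec, pow_zero, one_mul]; exact le_refl (l2 f)
  | succ j ih =>
    have : NeZero (L ^ 2 * tSize L T j) := tSize_neZero L T (j + 1)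
    have : NeZero (L * sSize L S j) := sSize_neZero L S (j + 1)
    rw [Q_succ_mulVec, pow_succ', mul_assoc]
    exact (mul_le_mul_of_nonneg_left (ih _) blockWeight_nonneg).trans
      (blockWeight_mul_l2_stepQ_le 𝔮 hL h𝔮 f)

/-- Block averages commute with coarse translations, each of which is made of `L²` or `L` fine ones;
this factor is absorbed in the definition of `gradNorm`. -/
lemma blockWeight_mul_gradNorm_blockAverage_le (hL : Odd L) (h𝔮 : 1 ≤ 𝔮) (j : ℕ)
    (f : FineLat L T S (j + 1) → ℂ) :
    blockWeight L * gradNorm (blockAverage 𝔮 j f) ≤ gradNorm f := by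
  have : NeZero (L ^ 2 * tSize L T j) := tSize_neZero L T (j + 1)
  have : NeZero (L * sSize L S j) := sSize_neZero L S (j + 1)
  set g := blockAverage 𝔮 j f with hg
  have hT : blockWeight L * l2 (shift eT g - g) ≤ (L : ℝ) ^ 2 * l2 (shift eT f - f) :=
    blockWeight_mul_l2_timeDiff_stepQ_le 𝔮 hL h𝔮 f
  have hS : ∀ i, blockWeight L * l2 (shift (eS i) g - g) ≤ L * l2 (shift (eS i) f - f) := fun i =>
    blockWeight_mul_l2_spaceDiff_stepQ_le 𝔮 hL h𝔮 i f
  unfold gradNorm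
  rw [mul_add]
  refine add_le_add ?_ ?_
  · rw [mul_left_comm, mul_add 2 j 1, mul_one, pow_add, mul_assoc]
    exact mul_le_mul_of_nonneg_left hT (by positivity)
  · rw [mul_left_comm, pow_succ, mul_assoc, Finset.mul_sum (a := blockWeight L),
      Finset.mul_sum (a := (L : ℝ))]
    exact mul_le_mul_of_nonneg_left (Finset.sum_le_sum fun i _ => hS i) (by positivity)

/-- The Poincaré inequality for `Q_j`, with a constant that does not depend on `j`, `L` or the
volume: the variations of the field over the blocks of the different scales add up to a geometric
series. -/
lemma l2_le_Q_add_gradNorm (hL : Odd L) (h𝔮 : 1 ≤ 𝔮) (j : ℕ) (f : FineLat L T S j → ℂ) :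
    l2 f ≤ blockWeight L ^ j * l2 (Q 𝔮 L T S j *ᵥ f) +
      (𝔮 + 1) * (∑ i ∈ Finset.range j, ((L : ℝ) ^ i)⁻¹) * gradNorm f := by
  induction j with
  | zero =>
    rw [Q_zero_mulVec, pow_zero, one_mul]
    simp only [Finset.range_zero, Finset.sum_empty, mul_zero, zero_mul, add_zero]
    exact le_refl (l2 f)
  | succ j ih =>
    have : NeZero (L ^ 2 * tSize L T j) := tSize_neZero L T (j + 1)
    have : NeZero (L * sSize L S j) := sSize_neZero L S (j + 1)
    have hLpos : (0 : ℝ) < L := by exact_mod_cast hL.pos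
    set g := blockAverage 𝔮 j f with hg
    have h1 : l2 f ≤ blockWeight L * l2 g + (𝔮 + 1) *
        ((L : ℝ) ^ 2 * l2 (shift eT f - f) + L * ∑ i, l2 (shift (eS i) f - f)) :=
      l2_le_stepQ_add 𝔮 hL f h𝔮
    have h2 := mul_le_mul_of_nonneg_left (ih g) (blockWeight_nonneg (L := L))
    have h3 : blockWeight L * gradNorm g ≤ gradNorm f :=
      blockWeight_mul_gradNorm_blockAverage_le hL h𝔮 j f
    have h4 : (L : ℝ) ^ 2 * l2 (shift eT f - f) + L * ∑ i, l2 (shift (eS i) f - f) ≤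
        ((L : ℝ) ^ j)⁻¹ * gradNorm f := by
      have h1L : (1 : ℝ) ≤ (L : ℝ) ^ j := one_le_pow₀ (by exact_mod_cast hL.pos)
      have ha : 0 ≤ (L : ℝ) ^ 2 * l2 (shift eT f - f) := mul_nonneg (by positivity) (l2_nonneg _)
      rw [le_inv_mul_iff₀ (by positivity)]
      unfold gradNorm
      have h5 : (L : ℝ) ^ (2 * (j + 1)) * l2 (shift eT f - f) =
          (L : ℝ) ^ j * ((L : ℝ) ^ j * ((L : ℝ) ^ 2 * l2 (shift eT f - f))) := by ring
      have h6 := le_mul_of_one_le_left ha h1L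
      have h7 := mul_le_mul_of_nonneg_left h6 (by positivity : 0 ≤ (L : ℝ) ^ j)
      rw [h5, pow_succ (L : ℝ) j]
      linarith
    have h8 : (0 : ℝ) ≤ (𝔮 + 1) * ∑ i ∈ Finset.range j, ((L : ℝ) ^ i)⁻¹ :=
      mul_nonneg (by positivity) (Finset.sum_nonneg fun _ _ => by positivity)
    have h9 := mul_le_mul_of_nonneg_left h3 h8
    have h10 := mul_le_mul_of_nonneg_left h4 (by positivity : (0 : ℝ) ≤ 𝔮 + 1)
    rw [Q_succ_mulVec, ← hg, Finset.sum_range_succ, pow_succ']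
    linarith

omit [NeZero L] in
lemma sum_inv_pow_le (hL : 3 ≤ L) (j : ℕ) : ∑ i ∈ Finset.range j, ((L : ℝ) ^ i)⁻¹ ≤ 2 := by
  have h3 : (3 : ℝ) ≤ L := by exact_mod_cast hL
  have h1 : ∀ j : ℕ, ∑ i ∈ Finset.range j, ((L : ℝ) ^ i)⁻¹ ≤ 2 - ((3 : ℝ) ^ j)⁻¹ := fun j => by
    induction j with
    | zero => norm_num
    | succ j ih =>
      have h4 : ((L : ℝ) ^ j)⁻¹ ≤ ((3 : ℝ) ^ j)⁻¹ := by gcongr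
      have h5 : (0 : ℝ) < ((3 : ℝ) ^ j)⁻¹ := by positivity
      have h6 : ∑ i ∈ Finset.range j, ((L : ℝ) ^ i)⁻¹ ≤ 3 / 2 - 3 / 2 * ((3 : ℝ) ^ j)⁻¹ := by
        clear ih h4 h5
        induction j with
        | zero => norm_num
        | succ j ih =>
          have h4 : ((L : ℝ) ^ j)⁻¹ ≤ ((3 : ℝ) ^ j)⁻¹ := by gcongr
          rw [Finset.sum_range_succ, pow_succ, mul_inv]
          linarith
      rw [Finset.sum_range_succ, pow_succ, mul_inv]
      linarith
  exact (h1 j).trans (by have : (0 : ℝ) < ((3 : ℝ) ^ j)⁻¹ := by positivity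
                         linarith)

lemma Q_mulVec_one (hL : Odd L) (j : ℕ) : Q 𝔮 L T S j *ᵥ (1 : FineLat L T S j → ℂ) = 1 := by
  induction j with
  | zero => exact Q_zero_mulVec _
  | succ j ih =>
    have : NeZero (L ^ 2 * tSize L T j) := tSize_neZero L T (j + 1)
    have : NeZero (L * sSize L S j) := sSize_neZero L S (j + 1)
    rw [Q_succ_mulVec]
    exact (congrArg _ (stepQ_mulVec_one 𝔮 hL)).trans ih

lemma sum_Q_mulVec (hL : Odd L) (h𝔮 : 1 ≤ 𝔮) (j : ℕ) (f : FineLat L T S j → ℂ) :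
    ∑ y, (Q 𝔮 L T S j *ᵥ f) y = ((L : ℂ) ^ (5 * j))⁻¹ * ∑ x, f x := by
  induction j with
  | zero =>
    rw [Q_zero_mulVec]
    simp only [mul_zero, pow_zero, inv_one, one_mul]
    rfl
  | succ j ih =>
    have : NeZero (L ^ 2 * tSize L T j) := tSize_neZero L T (j + 1)
    have : NeZero (L * sSize L S j) := sSize_neZero L S (j + 1)
    rw [Q_succ_mulVec, ih, mul_add, mul_one, pow_add, mul_inv, mul_assoc]
    exact congrArg _ (sum_stepQ_mulVec 𝔮 hL h𝔮 f)

/-- Averages preserve the integral of a field; dually, `Q_j*` maps constants to constants. -/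
lemma Q_transpose_mulVec_one (hL : Odd L) (h𝔮 : 1 ≤ 𝔮) (j : ℕ) :
    (Q 𝔮 L T S j)ᵀ *ᵥ 1 = ((L : ℂ) ^ (5 * j))⁻¹ • (1 : FineLat L T S j → ℂ) := by
  funext x
  have h := sum_Q_mulVec hL h𝔮 j (Pi.single x 1)
  simpa [mulVec, dotProduct, Matrix.transpose_apply, Pi.single_apply] using h

lemma Q_map_conj (j : ℕ) : (Q 𝔮 L T S j).map (starRingEnd ℂ) = Q 𝔮 L T S j := by
  have hbox : ∀ t s : ℕ, (boxMatrix L t s).map (starRingEnd ℂ) = boxMatrix L t s := fun t s => by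
    ext x y
    simp [boxMatrix]
  have hsam : ∀ t s : ℕ, (sampleMatrix L t s).map (starRingEnd ℂ) = sampleMatrix L t s :=
    fun t s => by
      ext x y
      simp [sampleMatrix, apply_ite (starRingEnd ℂ)]
  induction j with
  | zero => exact Matrix.map_one _ (map_zero _) (map_one _)
  | succ j ih =>
    have : NeZero (L ^ 2 * tSize L T j) := tSize_neZero L T (j + 1)
    have : NeZero (L * sSize L S j) := sSize_neZero L S (j + 1)
    change (Q 𝔮 L T S j * (sampleMatrix L (tSize L T j) (sSize L S j) *
      boxMatrix L (L ^ 2 * tSize L T j) (L * sSize L S j) ^ 𝔮)).map (starRingEnd ℂ) =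
      Q 𝔮 L T S j * (sampleMatrix L (tSize L T j) (sSize L S j) *
      boxMatrix L (L ^ 2 * tSize L T j) (L * sSize L S j) ^ 𝔮)
    rw [Matrix.map_mul, Matrix.map_mul, ih, hsam, Matrix.map_pow, hbox]

lemma Q_conjTranspose (j : ℕ) : (Q 𝔮 L T S j)ᴴ = (Q 𝔮 L T S j)ᵀ := by
  conv_rhs => rw [← Q_map_conj]
  rfl

lemma l2_Q_conjTranspose_le (hL : Odd L) (h𝔮 : 1 ≤ 𝔮) (j : ℕ) (w : Lat T S → ℂ) :
    blockWeight L ^ j * l2 ((Q 𝔮 L T S j)ᴴ *ᵥ w) ≤ l2 w := by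
  set v := (Q 𝔮 L T S j)ᴴ *ᵥ w with hv
  have h1 : star v ⬝ᵥ v = star w ⬝ᵥ (Q 𝔮 L T S j *ᵥ v) := by
    rw [hv, star_mulVec, conjTranspose_conjTranspose, ← dotProduct_mulVec]
  have h2 : l2 v ^ 2 ≤ l2 w * l2 (Q 𝔮 L T S j *ᵥ v) := by
    have := norm_star_dotProduct_le w (Q 𝔮 L T S j *ᵥ v)
    rw [← h1, star_dotProduct_self, Complex.norm_real, Real.norm_of_nonneg (sq_nonneg _)] at this
    exact this
  have h3 := blockWeight_pow_mul_l2_Q_le hL h𝔮 j v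
  rcases (l2_nonneg v).eq_or_lt with h0 | h0
  · rw [← h0, mul_zero]; exact l2_nonneg _
  · have hB : 0 ≤ blockWeight L ^ j := pow_nonneg blockWeight_nonneg _
    have h4 := mul_le_mul_of_nonneg_left h2 hB
    have h5 := mul_le_mul_of_nonneg_left h3 (l2_nonneg w)
    refine le_of_mul_le_mul_right ?_ h0
    nlinarith

end Compositions

/-! ### The operator `𝔔_N` -/

section FrakQ
variable (𝔮 L T S : ℕ) [NeZero L] [NeZero T] [NeZero S]

/-- The inverse of `𝔔_N`. -/
def frakQInv (N : ℕ) : Matrix (Lat T S) (Lat T S) ℂ :=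
  1 + ∑ j ∈ Finset.Ico 1 N, ((L : ℂ) ^ (2 * j))⁻¹ • (Q 𝔮 L T S j * Qstar 𝔮 L T S j)

/-- The eigenvalue of `𝔔_N⁻¹` on constant fields. -/
def frakQInvConst (N : ℕ) : ℝ := 1 + ∑ j ∈ Finset.Ico 1 N, ((L : ℝ) ^ (2 * j))⁻¹

omit [NeZero L] in
lemma one_le_frakQInvConst (N : ℕ) : 1 ≤ frakQInvConst L N :=
  le_add_of_nonneg_right (Finset.sum_nonneg fun _ _ => by positivity)

omit [NeZero L] in
lemma frakQInvConst_le (hL : 3 ≤ L) (N : ℕ) : frakQInvConst L N ≤ 9 / 8 := by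
  have h : ∀ N : ℕ, ∑ j ∈ Finset.Ico 1 (N + 1), ((L : ℝ) ^ (2 * j))⁻¹ ≤
      1 / 8 - 1 / 8 * ((9 : ℝ) ^ N)⁻¹ := fun N => by
    have h9 : (9 : ℝ) ≤ (L : ℝ) ^ 2 := by
      have : (3 : ℝ) ≤ L := by exact_mod_cast hL
      nlinarith
    induction N with
    | zero => norm_num
    | succ N ih =>
      have h4 : ((L : ℝ) ^ (2 * (N + 1)))⁻¹ ≤ ((9 : ℝ) ^ (N + 1))⁻¹ := by
        rw [pow_mul]; gcongr
      rw [Finset.sum_Ico_succ_top (by omega)]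
      rw [pow_succ, mul_inv] at h4 ⊢
      linarith
  unfold frakQInvConst
  cases N with
  | zero => norm_num
  | succ N =>
    have := h N
    have : (0 : ℝ) < ((9 : ℝ) ^ N)⁻¹ := by positivity
    linarith

variable {𝔮 L T S}

lemma frakQInv_mulVec (N : ℕ) (w : Lat T S → ℂ) : frakQInv 𝔮 L T S N *ᵥ w =
    w + ∑ j ∈ Finset.Ico 1 N, (((L : ℂ) ^ (2 * j))⁻¹ * (L : ℂ) ^ (5 * j)) •
      (Q 𝔮 L T S j *ᵥ ((Q 𝔮 L T S j)ᴴ *ᵥ w)) := by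
  rw [frakQInv, add_mulVec, one_mulVec, sum_mulVec]
  congr 1
  refine Finset.sum_congr rfl fun j _ => ?_
  rw [smul_mulVec, ← mulVec_mulVec, Qstar, smul_mulVec, mulVec_smul, smul_smul, Q_conjTranspose]

lemma frakQInv_mulVec_one (hL : Odd L) (h𝔮 : 1 ≤ 𝔮) (N : ℕ) :
    frakQInv 𝔮 L T S N *ᵥ 1 = (frakQInvConst L N : ℂ) • (1 : Lat T S → ℂ) := by
  have hL0 : (L : ℂ) ≠ 0 := by exact_mod_cast hL.pos.ne'
  rw [frakQInv_mulVec, frakQInvConst]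
  push_cast
  rw [add_smul, one_smul, Finset.sum_smul]
  congr 1
  refine Finset.sum_congr rfl fun j _ => ?_
  rw [Q_conjTranspose, Q_transpose_mulVec_one hL h𝔮, mulVec_smul, Q_mulVec_one hL, smul_smul,
    mul_assoc, mul_inv_cancel₀ (pow_ne_zero _ hL0), mul_one]

/-- `𝔔_N⁻¹` is at least one, as each `Q_j Q_j*` is nonnegative. -/
lemma le_re_star_dotProduct_frakQInv (N : ℕ) (w : Lat T S → ℂ) :
    l2 w ^ 2 ≤ (star w ⬝ᵥ (frakQInv 𝔮 L T S N *ᵥ w)).re := by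
  rw [frakQInv_mulVec, dotProduct_add, star_dotProduct_self, dotProduct_sum, Complex.add_re,
    Complex.ofReal_re, Complex.re_sum]
  refine le_add_of_nonneg_right (Finset.sum_nonneg fun j _ => ?_)
  rw [dotProduct_smul, dotProduct_mulVec, ← conjTranspose_conjTranspose (Q 𝔮 L T S j),
    ← star_mulVec, conjTranspose_conjTranspose, star_dotProduct_self, smul_eq_mul]
  have h : ((L : ℂ) ^ (2 * j))⁻¹ * (L : ℂ) ^ (5 * j) *
      ((l2 ((Q 𝔮 L T S j)ᴴ *ᵥ w) ^ 2 : ℝ) : ℂ) =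
      ((((L : ℝ) ^ (2 * j))⁻¹ * (L : ℝ) ^ (5 * j) * l2 ((Q 𝔮 L T S j)ᴴ *ᵥ w) ^ 2 : ℝ) : ℂ) := by
    push_cast; rfl
  rw [h, Complex.ofReal_re]
  positivity

lemma l2_frakQInv_le (hL : Odd L) (h𝔮 : 1 ≤ 𝔮) (N : ℕ) (w : Lat T S → ℂ) :
    l2 (frakQInv 𝔮 L T S N *ᵥ w) ≤ frakQInvConst L N * l2 w := by
  rw [frakQInv_mulVec, frakQInvConst, add_mul, one_mul, Finset.sum_mul]
  refine (l2_add_le _ _).trans (add_le_add le_rfl ?_)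
  have hsum : ∀ (I : Finset ℕ) (F : ℕ → Lat T S → ℂ), l2 (∑ j ∈ I, F j) ≤ ∑ j ∈ I, l2 (F j) :=
    fun I F => by
      classical
      induction I using Finset.induction_on with
      | empty => simp [l2_eq_zero.2]
      | insert a I ha ih =>
        rw [Finset.sum_insert ha, Finset.sum_insert ha]
        exact (l2_add_le _ _).trans (by linarith)
  refine (hsum _ _).trans (Finset.sum_le_sum fun j _ => ?_)
  rw [l2_smul]
  have h1 := l2_Q_conjTranspose_le (𝔮 := 𝔮) (T := T) (S := S) hL h𝔮 j w
  have h2 := blockWeight_pow_mul_l2_Q_le hL h𝔮 j ((Q 𝔮 L T S j)ᴴ *ᵥ w)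
  have hB : 0 ≤ blockWeight L ^ j := pow_nonneg blockWeight_nonneg _
  have h3 := (mul_le_mul_of_nonneg_left h2 hB).trans h1
  rw [← mul_assoc, ← mul_pow, ← sq, blockWeight_sq, ← pow_mul] at h3
  have h4 : ‖((L : ℂ) ^ (2 * j))⁻¹ * (L : ℂ) ^ (5 * j)‖ =
      ((L : ℝ) ^ (2 * j))⁻¹ * (L : ℝ) ^ (5 * j) := by simp
  rw [h4, mul_assoc]
  gcongr

lemma isUnit_frakQInv (N : ℕ) : IsUnit (frakQInv 𝔮 L T S N) := by
  rw [← mulVec_injective_iff_isUnit]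
  intro v w h
  have h1 : frakQInv 𝔮 L T S N *ᵥ (v - w) = 0 := by rw [mulVec_sub, sub_eq_zero]; exact h
  have h2 := le_re_star_dotProduct_frakQInv (𝔮 := 𝔮) (L := L) N (v - w)
  rw [h1, dotProduct_zero, Complex.zero_re] at h2
  have h3 : l2 (v - w) = 0 := by nlinarith [l2_nonneg (v - w)]
  exact sub_eq_zero.1 (l2_eq_zero.1 h3)

lemma frakQInv_mulVec_frakQ (N : ℕ) (v : Lat T S → ℂ) :
    frakQInv 𝔮 L T S N *ᵥ (frakQ 𝔮 L T S N *ᵥ v) = v := by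
  rw [mulVec_mulVec]
  change (frakQInv 𝔮 L T S N * (frakQInv 𝔮 L T S N)⁻¹) *ᵥ v = v
  rw [Matrix.mul_nonsing_inv _ ((Matrix.isUnit_iff_isUnit_det _).1 (isUnit_frakQInv N)), one_mulVec]

lemma frakQ_mulVec_one (hL : Odd L) (h𝔮 : 1 ≤ 𝔮) (N : ℕ) :
    frakQ 𝔮 L T S N *ᵥ 1 = ((frakQInvConst L N)⁻¹ : ℂ) • (1 : Lat T S → ℂ) := by
  have h0 : (frakQInvConst L N : ℂ) ≠ 0 := by
    have := one_le_frakQInvConst L N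
    exact_mod_cast (by linarith : frakQInvConst L N ≠ 0)
  have hinj := mulVec_injective_iff_isUnit.2
    (isUnit_frakQInv (𝔮 := 𝔮) (L := L) (T := T) (S := S) N)
  apply hinj
  change frakQInv 𝔮 L T S N *ᵥ _ = frakQInv 𝔮 L T S N *ᵥ _
  rw [frakQInv_mulVec_frakQ, mulVec_smul, frakQInv_mulVec_one hL h𝔮, smul_smul,
    inv_mul_cancel₀ h0, one_smul]

end FrakQ

/-! ### The linearized background field equation -/

section Linearized
variable {𝔮 L T S : ℕ} [NeZero L] [NeZero T] [NeZero S]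

/-- The operator of the linearized background field equation,
`L^{-5N} (Q_N* 𝔔_N Q_N + D_N - μ)`. -/
def linOp (K : KineticOperator) (𝔮 L T S : ℕ) [NeZero L] [NeZero T] [NeZero S] (N : ℕ) (μ : ℝ) :
    Matrix (FineLat L T S N) (FineLat L T S N) ℂ :=
  (Q 𝔮 L T S N)ᵀ * (frakQ 𝔮 L T S N * Q 𝔮 L T S N) +
    ((L : ℂ) ^ (5 * N))⁻¹ • (K.D L T S N - (μ : ℂ) • 1)

/-- A radius, uniform in `L`, `N` and the volume, for the chemical potentials for which the
linearized background field equation is shown to be uniquely solvable. The fourth power appears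
because `D_N` is bounded in terms of `|μ|^{1/2}`, and then the space differences in terms of
`|μ|^{1/4}`. -/
def massRadius (K : KineticOperator) (𝔮 : ℕ) : ℝ :=
  (1 / (3 + 16 * (𝔮 + 1) * K.gradBound)) ^ 4

lemma massRadius_pos (K : KineticOperator) (𝔮 : ℕ) : 0 < massRadius K 𝔮 := by
  have := K.one_le_gradBound
  unfold massRadius; positivity

/-- For small `μ` the linearized equation has only the trivial solution. The real part of its
pairing with `φ` bounds `Q_N φ` by `√|μ| φ`, so that the equation bounds `D_N φ`, hence the gradient
of `φ`, by a small multiple of `φ`; then the Poincaré inequality applies. -/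
lemma eq_zero_of_linOp_mulVec_eq_zero (K : KineticOperator) (hL : Odd L) (hL3 : 3 ≤ L)
    (h𝔮 : 1 ≤ 𝔮) (N : ℕ) {μ : ℝ} (hμ : |μ| ≤ massRadius K 𝔮) {φ : FineLat L T S N → ℂ}
    (h : linOp K 𝔮 L T S N μ *ᵥ φ = 0) : φ = 0 := by
  have hL0 : (L : ℂ) ≠ 0 := by exact_mod_cast hL.pos.ne'
  have hc0 : (L : ℂ) ^ (5 * N) ≠ 0 := pow_ne_zero _ hL0
  set C := K.gradBound with hC
  have hC1 : 1 ≤ C := K.one_le_gradBound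
  set w := frakQ 𝔮 L T S N *ᵥ (Q 𝔮 L T S N *ᵥ φ) with hw
  set B := blockWeight L ^ N with hB
  have hB0 : 0 < B := pow_pos blockWeight_pos _
  have hBsq : B ^ 2 = (L : ℝ) ^ (5 * N) := by
    rw [hB, ← pow_mul, mul_comm N 2, pow_mul, blockWeight_sq, pow_mul]
  have hBsqC : (L : ℂ) ^ (5 * N) = ((B ^ 2 : ℝ) : ℂ) := by rw [hBsq]; push_cast; rfl
  have heq : (L : ℂ) ^ (5 * N) • ((Q 𝔮 L T S N)ᴴ *ᵥ w) + K.D L T S N *ᵥ φ = (μ : ℂ) • φ := by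
    have h1 : (Q 𝔮 L T S N)ᴴ *ᵥ w +
        ((L : ℂ) ^ (5 * N))⁻¹ • (K.D L T S N *ᵥ φ - (μ : ℂ) • φ) = 0 := by
      rw [← h, linOp, add_mulVec, smul_mulVec, sub_mulVec, smul_mulVec, one_mulVec,
        ← mulVec_mulVec, ← mulVec_mulVec, Q_conjTranspose]
    have h2 := congrArg (fun v => (L : ℂ) ^ (5 * N) • v) h1
    simp only [smul_add, smul_zero, smul_smul, mul_inv_cancel₀ hc0, one_smul] at h2
    rw [← sub_eq_zero, ← h2]; abel
  have hQ : Q 𝔮 L T S N *ᵥ φ = frakQInv 𝔮 L T S N *ᵥ w := (frakQInv_mulVec_frakQ _ _).symm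
  -- Take the real part of the pairing of the equation with `φ`, and drop the contribution of `D_N`,
  -- which is nonnegative.
  have hpair : B ^ 2 * l2 w ^ 2 ≤ |μ| * l2 φ ^ 2 := by
    have h1 := congrArg (fun v => (star φ ⬝ᵥ v).re) heq
    simp only [dotProduct_add, dotProduct_smul, star_dotProduct_self, smul_eq_mul, hBsqC,
      Complex.add_re, Complex.re_ofReal_mul, Complex.ofReal_re] at h1
    have h2 : star φ ⬝ᵥ ((Q 𝔮 L T S N)ᴴ *ᵥ w) = star (frakQInv 𝔮 L T S N *ᵥ w) ⬝ᵥ w := by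
      rw [dotProduct_mulVec, ← star_mulVec, hQ]
    have h3 : (star (frakQInv 𝔮 L T S N *ᵥ w) ⬝ᵥ w).re =
        (star w ⬝ᵥ (frakQInv 𝔮 L T S N *ᵥ w)).re := by
      have : star (frakQInv 𝔮 L T S N *ᵥ w) ⬝ᵥ w =
          star (star w ⬝ᵥ (frakQInv 𝔮 L T S N *ᵥ w)) := by
        rw [star_dotProduct]
      rw [this]; simp
    rw [h2, h3] at h1
    have h4 := le_re_star_dotProduct_frakQInv (𝔮 := 𝔮) (L := L) N w
    have h5 := K.re_star_dotProduct_D_nonneg L T S N φ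
    have h6 := mul_le_mul_of_nonneg_left h4 (sq_nonneg B)
    have h7 := mul_le_mul_of_nonneg_right (le_abs_self μ) (sq_nonneg (l2 φ))
    linarith
  set x := Real.sqrt |μ| with hx
  have hx2 : x ^ 2 = |μ| := Real.sq_sqrt (abs_nonneg _)
  have hx0 : 0 ≤ x := Real.sqrt_nonneg _
  set y := Real.sqrt x with hy
  have hy2 : y ^ 2 = x := Real.sq_sqrt hx0
  have hy0 : 0 ≤ y := Real.sqrt_nonneg _
  have hBw : B * l2 w ≤ x * l2 φ := by
    refine (pow_le_pow_iff_left₀ (mul_nonneg hB0.le (l2_nonneg _)) (mul_nonneg hx0 (l2_nonneg _))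
      two_ne_zero).1 ?_
    rw [mul_pow, mul_pow, hx2]; exact hpair
  have hyb : y ≤ 1 / (3 + 16 * (𝔮 + 1) * C) := by
    refine (pow_le_pow_iff_left₀ hy0 (by positivity) (by norm_num : 4 ≠ 0)).1 ?_
    have : y ^ 4 = |μ| := by rw [← hx2, ← hy2]; ring
    rw [this]; exact hμ
  have hden : (0 : ℝ) < 3 + 16 * (𝔮 + 1) * C := by positivity
  have hy3 : y * (3 + 16 * (𝔮 + 1) * C) ≤ 1 := by rwa [le_div_iff₀ hden] at hyb
  have hqC : (0 : ℝ) ≤ (𝔮 + 1) * C := by positivity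
  have hy1 : y ≤ 1 := by nlinarith [mul_nonneg hy0 hqC]
  have hxy : x ≤ y := by rw [← hy2]; nlinarith
  have hDφ : l2 (K.D L T S N *ᵥ φ) ≤ 2 * x * l2 φ := by
    have h1 : K.D L T S N *ᵥ φ = (μ : ℂ) • φ - (L : ℂ) ^ (5 * N) • ((Q 𝔮 L T S N)ᴴ *ᵥ w) := by
      rw [← heq]; abel
    have h2 := l2_Q_conjTranspose_le (T := T) (S := S) hL h𝔮 N w
    have h3 : l2 ((L : ℂ) ^ (5 * N) • ((Q 𝔮 L T S N)ᴴ *ᵥ w)) ≤ B * l2 w := by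
      rw [l2_smul, hBsqC, Complex.norm_real, Real.norm_of_nonneg (sq_nonneg _), sq, mul_assoc]
      exact mul_le_mul_of_nonneg_left h2 hB0.le
    have h4 : l2 ((μ : ℂ) • φ) ≤ x * l2 φ := by
      rw [l2_smul, Complex.norm_real, Real.norm_eq_abs]
      refine mul_le_mul_of_nonneg_right ?_ (l2_nonneg _)
      rw [← hx2]; nlinarith
    have h5 := l2_sub_le ((μ : ℂ) • φ) ((L : ℂ) ^ (5 * N) • ((Q 𝔮 L T S N)ᴴ *ᵥ w))
    rw [h1]; linarith
  have hsqrt : Real.sqrt (l2 (K.D L T S N *ᵥ φ) * l2 φ) ≤ 2 * y * l2 φ := by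
    apply Real.sqrt_le_iff.2 ⟨mul_nonneg (by positivity) (l2_nonneg _), ?_⟩
    have := mul_le_mul_of_nonneg_right hDφ (l2_nonneg φ)
    have h2 : (2 * y * l2 φ) ^ 2 = 4 * x * (l2 φ * l2 φ) := by rw [← hy2]; ring
    have h3 := mul_nonneg hx0 (mul_nonneg (l2_nonneg φ) (l2_nonneg φ))
    rw [h2]; linarith
  have hgrad : gradNorm φ ≤ C * (8 * y * l2 φ) := by
    refine (K.gradNorm_le L T S N φ).trans (mul_le_mul_of_nonneg_left ?_ (by linarith))
    have := mul_le_mul_of_nonneg_right hxy (l2_nonneg φ)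
    linarith
  have hQφ : B * l2 (Q 𝔮 L T S N *ᵥ φ) ≤ 2 * y * l2 φ := by
    have h1 := l2_frakQInv_le (T := T) (S := S) hL h𝔮 N w
    have h2 := frakQInvConst_le L hL3 N
    have h3 : l2 (frakQInv 𝔮 L T S N *ᵥ w) ≤ 2 * l2 w :=
      h1.trans (mul_le_mul_of_nonneg_right (by linarith) (l2_nonneg _))
    have h4 := mul_le_mul_of_nonneg_left h3 hB0.le
    have := mul_le_mul_of_nonneg_right hxy (l2_nonneg φ)
    rw [hQ]; linarith
  have hP := l2_le_Q_add_gradNorm hL h𝔮 N φ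
  have hg0 := gradNorm_nonneg L T S N φ
  have hs : (𝔮 + 1) * (∑ i ∈ Finset.range N, ((L : ℝ) ^ i)⁻¹) * gradNorm φ ≤
      (𝔮 + 1) * 2 * (C * (8 * y * l2 φ)) := by
    have := sum_inv_pow_le hL3 N
    gcongr
  have hfin : l2 φ ≤ (y * (2 + 16 * (𝔮 + 1) * C)) * l2 φ := by linarith
  have hlt : y * (2 + 16 * (𝔮 + 1) * C) < 1 := by
    rcases hy0.eq_or_lt with h0 | h0
    · rw [← h0]; norm_num
    · linarith
  have : l2 φ = 0 := by nlinarith [l2_nonneg φ]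
  exact l2_eq_zero.1 this

end Linearized

/-! ### Second derivatives at a common zero -/

section Hessian
variable {E : Type*} [NormedAddCommGroup E] [NormedSpace ℂ E]

/-- The second derivative at the origin, as a bilinear form. -/
def hessian (f : E → ℂ) (h k : E) : ℂ := iteratedFDeriv ℂ 2 f 0 ![h, k]

lemma hessian_eq_fderiv (f : E → ℂ) (h k : E) :
    hessian f h k = fderiv ℂ (fderiv ℂ f) 0 h k := by
  rw [hessian, iteratedFDeriv_two_apply]; rfl

lemma hessian_add {f g : E → ℂ} (hf : AnalyticAt ℂ f 0) (hg : AnalyticAt ℂ g 0) (h k : E) :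
    hessian (fun x => f x + g x) h k = hessian f h k + hessian g h k := by
  have := iteratedFDeriv_add_apply (i := 2) hf.contDiffAt hg.contDiffAt
  rw [hessian, hessian, hessian, ← _root_.add_apply, ← this]
  rfl

lemma hessian_sum {ι : Type*} (I : Finset ι) {f : ι → E → ℂ} (hf : ∀ i, AnalyticAt ℂ (f i) 0)
    (h k : E) : hessian (fun x => ∑ i ∈ I, f i x) h k = ∑ i ∈ I, hessian (f i) h k := by
  classical
  induction I using Finset.induction_on with
  | empty =>
    simp [hessian_eq_fderiv]
  | insert a I ha ih =>
    simp only [Finset.sum_insert ha]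
    rw [hessian_add (hf a) (Finset.analyticAt_fun_sum I fun i _ => hf i), ih]

lemma hessian_mul {f g : E → ℂ} (hf : AnalyticAt ℂ f 0) (hg : AnalyticAt ℂ g 0)
    (hf0 : f 0 = 0) (hg0 : g 0 = 0) (h k : E) :
    hessian (fun x => f x * g x) h k =
      fderiv ℂ f 0 h * fderiv ℂ g 0 k + fderiv ℂ f 0 k * fderiv ℂ g 0 h := by
  have h1 : fderiv ℂ (fun x => f x * g x) =ᶠ[𝓝 0]
      fun x => f x • fderiv ℂ g x + g x • fderiv ℂ f x := by
    filter_upwards [hf.eventually_analyticAt, hg.eventually_analyticAt] with x hx hy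
    exact fderiv_fun_mul hx.differentiableAt hy.differentiableAt
  have h2 : HasFDerivAt (fun x => f x • fderiv ℂ g x + g x • fderiv ℂ f x) _ 0 :=
    (hf.differentiableAt.hasFDerivAt.smul hg.fderiv.differentiableAt.hasFDerivAt).add
      (hg.differentiableAt.hasFDerivAt.smul hf.fderiv.differentiableAt.hasFDerivAt)
  rw [hessian_eq_fderiv, h1.fderiv_eq, h2.fderiv]
  simp [hf0, hg0]
  ring

lemma fderiv_mul_eq_zero {f g : E → ℂ} (hf : AnalyticAt ℂ f 0) (hg : AnalyticAt ℂ g 0)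
    (hf0 : f 0 = 0) (hg0 : g 0 = 0) : fderiv ℂ (fun x => f x * g x) 0 = 0 := by
  ext v
  rw [fderiv_fun_mul hf.differentiableAt hg.differentiableAt]
  simp [hf0, hg0]

variable {ι ι' : Type*} [Fintype ι] [Fintype ι']

lemma hessian_dotProduct {f g : E → ι → ℂ} (hf : AnalyticAt ℂ f 0) (hg : AnalyticAt ℂ g 0)
    (hf0 : f 0 = 0) (hg0 : g 0 = 0) (h k : E) :
    hessian (fun x => f x ⬝ᵥ g x) h k =
      fderiv ℂ f 0 h ⬝ᵥ fderiv ℂ g 0 k + fderiv ℂ f 0 k ⬝ᵥ fderiv ℂ g 0 h := by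
  have hf' := analyticAt_pi_iff.1 hf
  have hg' := analyticAt_pi_iff.1 hg
  have e1 : ∀ (F : E → ι → ℂ) (_ : AnalyticAt ℂ F 0) (i : ι) (v : E),
      fderiv ℂ (fun x => F x i) 0 v = fderiv ℂ F 0 v i := fun F hF i v => by
    rw [fderiv_apply hF.differentiableAt]; rfl
  simp only [dotProduct]
  rw [hessian_sum _ fun i => (hf' i).fun_mul (hg' i), ← Finset.sum_add_distrib]
  refine Finset.sum_congr rfl fun i _ => ?_
  have := hessian_mul (hf' i) (hg' i) (congrFun hf0 i) (congrFun hg0 i) h k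
  rw [← e1 f hf, ← e1 g hg, ← e1 f hf, ← e1 g hg, ← this]

lemma analyticAt_dotProduct {f g : E → ι → ℂ} {x : E} (hf : AnalyticAt ℂ f x)
    (hg : AnalyticAt ℂ g x) : AnalyticAt ℂ (fun x => f x ⬝ᵥ g x) x :=
  Finset.analyticAt_fun_sum _ fun i _ => (analyticAt_pi_iff.1 hf i).mul (analyticAt_pi_iff.1 hg i)

lemma hasFDerivAt_mulVec {f : E → ι → ℂ} {f' : E →L[ℂ] ι → ℂ} {x : E} (A : Matrix ι' ι ℂ)
    (hf : HasFDerivAt f f' x) :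
    HasFDerivAt (fun x => A *ᵥ f x) ((LinearMap.toContinuousLinearMap A.mulVecLin).comp f') x :=
  (LinearMap.toContinuousLinearMap A.mulVecLin).hasFDerivAt.comp x hf

lemma analyticAt_mulVec {f : E → ι → ℂ} {x : E} (A : Matrix ι' ι ℂ) (hf : AnalyticAt ℂ f x) :
    AnalyticAt ℂ (fun x => A *ᵥ f x) x :=
  ((LinearMap.toContinuousLinearMap A.mulVecLin).analyticAt _).comp hf

end Hessian

/-! ### Quartic monomials -/

section Quartic
variable {t s : ℕ} [NeZero t] [NeZero s]

/-- Functionals given by a quartic kernel; of the properties of a quartic interaction, only this one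
matters for the quadratic part of the action. -/
def HasQuarticKernel (V : Functional t s) : Prop :=
  ∃ k : (Fin 4 → Lat t s) → ℂ, ∀ φs φ,
    V φs φ = ∑ u : Fin 4 → Lat t s, k u * φs (u 0) * φ (u 1) * φs (u 2) * φ (u 3)

lemma HasQuarticKernel.add {V W : Functional t s} (hV : HasQuarticKernel V)
    (hW : HasQuarticKernel W) : HasQuarticKernel (V + W) := by
  obtain ⟨k, hk⟩ := hV
  obtain ⟨l, hl⟩ := hW
  refine ⟨k + l, fun φs φ => ?_⟩
  simp only [Pi.add_apply, hk, hl, add_mul, Finset.sum_add_distrib]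

lemma HasQuarticKernel.scaled {L : ℕ} {V : Functional t s} (hV : HasQuarticKernel V) :
    HasQuarticKernel (scaled L V) := by
  obtain ⟨k, hk⟩ := hV
  refine ⟨fun u => (((L : ℝ) ^ (-(3 / 2) : ℝ) : ℝ) : ℂ) ^ 4 * k u, fun φs φ => ?_⟩
  simp only [BoseFlow.scaled, hk]
  exact Finset.sum_congr rfl fun u _ => by ring

variable {E : Type*} [NormedAddCommGroup E] [NormedSpace ℂ E]

lemma HasQuarticKernel.analyticAt {V : Functional t s} (hV : HasQuarticKernel V)
    {fs f : E → Lat t s → ℂ} {x : E} (hfs : AnalyticAt ℂ fs x) (hf : AnalyticAt ℂ f x) :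
    AnalyticAt ℂ (fun x => V (fs x) (f x)) x := by
  obtain ⟨k, hk⟩ := hV
  simp only [hk]
  have h1 := analyticAt_pi_iff.1 hfs
  have h2 := analyticAt_pi_iff.1 hf
  exact Finset.analyticAt_fun_sum _ fun u _ =>
    (((analyticAt_const.mul (h1 _)).mul (h2 _)).mul (h1 _)).mul (h2 _)

/-- A quartic monomial has no second derivative along fields that vanish at the origin. -/
lemma HasQuarticKernel.hessian_eq_zero {V : Functional t s} (hV : HasQuarticKernel V)
    {fs f : E → Lat t s → ℂ} (hfs : AnalyticAt ℂ fs 0) (hf : AnalyticAt ℂ f 0)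
    (hfs0 : fs 0 = 0) (hf0 : f 0 = 0) (h k : E) :
    hessian (fun x => V (fs x) (f x)) h k = 0 := by
  obtain ⟨l, hl⟩ := hV
  have h1 := analyticAt_pi_iff.1 hfs
  have h2 := analyticAt_pi_iff.1 hf
  simp only [hl, mul_assoc]
  rw [hessian_sum]
  · refine Finset.sum_eq_zero fun u _ => ?_
    have e : (fun x => l u * (fs x (u 0) * (f x (u 1) * (fs x (u 2) * f x (u 3))))) =
        fun x => (l u * (fs x (u 0) * f x (u 1))) * (fs x (u 2) * f x (u 3)) := by
      funext x; ring
    have h3 : fderiv ℂ (fun x => fs x (u 2) * f x (u 3)) 0 = 0 :=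
      fderiv_mul_eq_zero (h1 _) (h2 _) (congrFun hfs0 _) (congrFun hf0 _)
    rw [e, hessian_mul (analyticAt_const.fun_mul ((h1 _).fun_mul (h2 _))) ((h1 _).fun_mul (h2 _))
      (by simp [hfs0]) (by simp [hfs0]), h3]
    simp
  · exact fun u => analyticAt_const.mul ((h1 _).mul ((h2 _).mul ((h1 _).mul (h2 _))))

end Quartic

/-! ### Critical points depending analytically on parameters -/

section Critical
variable {P X : Type*} [NormedAddCommGroup P] [NormedSpace ℂ P] [NormedAddCommGroup X]
  [NormedSpace ℂ X] {J : P × X → ℂ}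

lemma fderiv_comp_prodMk_right {p : P} {x : X} (hJ : AnalyticAt ℂ J (p, x)) (η : X) :
    fderiv ℂ (fun y => J (p, y)) x η = fderiv ℂ J (p, x) (0, η) := by
  have h := hJ.differentiableAt.hasFDerivAt.comp x (hasFDerivAt_prodMk_right (𝕜 := ℂ) p x)
  have h2 : (J ∘ fun y => (p, y)) = fun y => J (p, y) := rfl
  rw [h2] at h
  rw [h.fderiv]
  simp

/-- The derivative of a family of critical points solves the linearized equation. -/
lemma hessian_of_critical (hJ : AnalyticAt ℂ J 0) {Φ : P → X} (hΦ : AnalyticAt ℂ Φ 0)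
    (hΦ0 : Φ 0 = 0) (hc : ∀ᶠ p in 𝓝 (0 : P), fderiv ℂ (fun y => J (p, y)) (Φ p) = 0)
    (p : P) (η : X) : hessian J (p, fderiv ℂ Φ 0 p) (0, η) = 0 := by
  have hg : HasFDerivAt (fun p => (p, Φ p)) ((ContinuousLinearMap.id ℂ P).prod (fderiv ℂ Φ 0)) 0 :=
    (hasFDerivAt_id 0).prodMk hΦ.differentiableAt.hasFDerivAt
  have hg0 : (fun p => (p, Φ p)) (0 : P) = 0 := by simp [hΦ0]
  have h1 : (fun p => fderiv ℂ J (p, Φ p) (0, η)) =ᶠ[𝓝 0] fun _ => 0 := by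
    have hev : ∀ᶠ z in 𝓝 ((fun p => (p, Φ p)) (0 : P)), AnalyticAt ℂ J z := by
      rw [hg0]; exact hJ.eventually_analyticAt
    filter_upwards [hc, hg.continuousAt.eventually hev] with q hq hq2
    rw [← fderiv_comp_prodMk_right hq2, hq]; rfl
  have hd : HasFDerivAt (fderiv ℂ J) (fderiv ℂ (fderiv ℂ J) 0) ((fun p => (p, Φ p)) (0 : P)) := by
    rw [hg0]; exact hJ.fderiv.differentiableAt.hasFDerivAt
  have h2 := (hd.comp 0 hg).clm_apply (hasFDerivAt_const ((0, η) : P × X) (0 : P))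
  have h3 := h2.fderiv
  have h4 : (fun p => ((fderiv ℂ J) ∘ fun p => (p, Φ p)) p ((0, η) : P × X)) =
      fun p => fderiv ℂ J (p, Φ p) (0, η) := rfl
  rw [h4, h1.fderiv_eq] at h3
  have h5 := congrArg (fun l => l p) h3
  rw [hessian_eq_fderiv]
  simpa using h5.symm

variable [FiniteDimensional ℂ P] [FiniteDimensional ℂ X]

/-- At a nondegenerate critical point, critical points exist nearby and depend analytically on
parameters: the map from `(p, x)` to `p` and the partial derivative of `J` in `x` is a local
analytic isomorphism, and the critical points form the preimage of the zero section. -/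
lemma exists_analytic_critical (hJ : AnalyticAt ℂ J 0) (h0 : fderiv ℂ J 0 = 0)
    (hinj : ∀ x : X, (∀ η : X, hessian J (0, x) (0, η) = 0) → x = 0) :
    ∃ Φ : P → X, AnalyticAt ℂ Φ 0 ∧ Φ 0 = 0 ∧
      ∀ᶠ p in 𝓝 (0 : P), fderiv ℂ (fun y => J (p, y)) (Φ p) = 0 := by
  let R : ((P × X) →L[ℂ] ℂ) →L[ℂ] (X →L[ℂ] ℂ) :=
    (ContinuousLinearMap.compL ℂ X (P × X) ℂ).flip (ContinuousLinearMap.inr ℂ P X)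
  have hR : ∀ l η, R l η = l (0, η) := fun l η => by simp [R]
  let F : P × X → P × (X →L[ℂ] ℂ) := fun z => (z.1, R (fderiv ℂ J z))
  have hF : AnalyticAt ℂ F 0 :=
    (ContinuousLinearMap.fst ℂ P X).analyticAt _ |>.prod ((R.analyticAt _).comp hJ.fderiv)
  have hF0 : F 0 = 0 := by simp [F, h0]
  have hFd : HasFDerivAt F ((ContinuousLinearMap.fst ℂ P X).prod
      (R.comp (fderiv ℂ (fderiv ℂ J) 0))) 0 :=
    (ContinuousLinearMap.fst ℂ P X).hasFDerivAt.prodMk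
      (R.hasFDerivAt.comp 0 hJ.fderiv.differentiableAt.hasFDerivAt)
  set A := (ContinuousLinearMap.fst ℂ P X).prod (R.comp (fderiv ℂ (fderiv ℂ J) 0)) with hA
  have hAinj : Function.Injective A := by
    rw [injective_iff_map_eq_zero]
    rintro ⟨p, x⟩ hz
    have hz1 : p = 0 := congrArg Prod.fst hz
    subst hz1
    have hz2 : R (fderiv ℂ (fderiv ℂ J) 0 (0, x)) = 0 := congrArg Prod.snd hz
    have : x = 0 := hinj x fun η => by
      rw [hessian_eq_fderiv, ← hR, hz2]; rfl
    rw [this]; rfl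
  have hdim : Module.finrank ℂ (P × X) = Module.finrank ℂ (P × (X →L[ℂ] ℂ)) := by
    have h1 : Module.finrank ℂ (X →L[ℂ] ℂ) = Module.finrank ℂ X := by
      rw [← (LinearMap.toContinuousLinearMap (𝕜 := ℂ) (E := X) (F' := ℂ)).finrank_eq]
      exact Subspace.dual_finrank_eq
    rw [Module.finrank_prod, Module.finrank_prod, h1]
  let e : (P × X) ≃L[ℂ] (P × (X →L[ℂ] ℂ)) :=
    (LinearEquiv.ofInjectiveOfFinrankEq (A : (P × X) →ₗ[ℂ] (P × (X →L[ℂ] ℂ))) hAinj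
      hdim).toContinuousLinearEquiv
  have he : (e : (P × X) →L[ℂ] (P × (X →L[ℂ] ℂ))) = A := by
    ext z <;> rfl
  have hs : HasStrictFDerivAt F (e : (P × X) →L[ℂ] (P × (X →L[ℂ] ℂ))) 0 := by
    rw [he, ← hFd.fderiv]; exact hF.hasStrictFDerivAt
  have hinv : AnalyticAt ℂ (hs.localInverse F e 0) 0 := by
    have := OpenPartialHomeomorph.analyticAt_symm' (hs.toOpenPartialHomeomorph F)
      (a := 0) hs.mem_toOpenPartialHomeomorph_source (i := e) hF
      (by rw [← hs.hasFDerivAt.fderiv]; rfl)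
    rw [← hF0]
    exact this
  have hinv0 : hs.localInverse F e 0 0 = 0 := by
    have := hs.localInverse_apply_image
    rwa [hF0] at this
  let ι : P →L[ℂ] P × (X →L[ℂ] ℂ) := ContinuousLinearMap.inl ℂ P (X →L[ℂ] ℂ)
  have hright : ∀ᶠ p in 𝓝 (0 : P), F (hs.localInverse F e 0 (ι p)) = ι p := by
    have h1 := hs.eventually_right_inverse
    rw [hF0] at h1
    have h2 : Tendsto ι (𝓝 0) (𝓝 0) := by simpa using ι.continuous.tendsto 0
    exact h2.eventually h1
  have han : AnalyticAt ℂ (fun p => hs.localInverse F e 0 (ι p)) 0 :=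
    AnalyticAt.fun_comp (by simpa using hinv) (ι.analyticAt 0)
  have h00 : hs.localInverse F e 0 (ι 0) = 0 := by rw [map_zero, hinv0]
  refine ⟨fun p => (hs.localInverse F e 0 (ι p)).2, ?_, ?_, ?_⟩
  · exact ((ContinuousLinearMap.snd ℂ P X).analyticAt _).comp han
  · exact congrArg Prod.snd h00
  · have hev : ∀ᶠ z in 𝓝 (hs.localInverse F e 0 (ι 0)), AnalyticAt ℂ J z := by
      rw [h00]; exact hJ.eventually_analyticAt
    filter_upwards [hright, han.continuousAt.eventually hev] with p hp hp2
    have hp1 : (hs.localInverse F e 0 (ι p)).1 = p := congrArg Prod.fst hp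
    have hp3 : R (fderiv ℂ J (hs.localInverse F e 0 (ι p))) = 0 := congrArg Prod.snd hp
    have hp4 : hs.localInverse F e 0 (ι p) = (p, (hs.localInverse F e 0 (ι p)).2) :=
      Prod.ext hp1 rfl
    rw [hp4] at hp2 hp3
    ext η
    rw [fderiv_comp_prodMk_right hp2, ← hR, hp3]

end Critical

/-! ### The quadratic part of the action -/

section ActionForm
variable (K : KineticOperator) (𝔮 L T S : ℕ) [NeZero L] [NeZero T] [NeZero S] (N : ℕ) (μ : ℝ)

/-- The bilinear form of the quadratic part of the action, in starred fields `(ψ_*, φ_*)` and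
unstarred fields `(ψ, φ)`. -/
def actionForm (ψs : Lat T S → ℂ) (φs : FineLat L T S N → ℂ) (ψ : Lat T S → ℂ)
    (φ : FineLat L T S N → ℂ) : ℂ :=
  (ψs - Q 𝔮 L T S N *ᵥ φs) ⬝ᵥ (frakQ 𝔮 L T S N *ᵥ (ψ - Q 𝔮 L T S N *ᵥ φ)) +
    (((L : ℂ) ^ (5 * N))⁻¹ • φs) ⬝ᵥ (K.D L T S N *ᵥ φ - (μ : ℂ) • φ)

variable {K 𝔮 L T S N μ}

lemma action_eq (V : Functional (tSize L T N) (sSize L S N)) (ψs ψ : Lat T S → ℂ)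
    (φs φ : FineLat L T S N → ℂ) :
    action K 𝔮 L T S N μ V ψs ψ φs φ = actionForm K 𝔮 L T S N μ ψs φs ψ φ + V φs φ := by
  rw [action, actionForm, dotProduct_sub, smul_dotProduct, smul_dotProduct, dotProduct_smul]
  simp only [smul_eq_mul]
  ring

/-- The variation of the quadratic part of the action in the starred background field. -/
lemma actionForm_zero_left (φs : FineLat L T S N → ℂ) (ψ : Lat T S → ℂ)
    (φ : FineLat L T S N → ℂ) : actionForm K 𝔮 L T S N μ 0 φs ψ φ =
      φs ⬝ᵥ (linOp K 𝔮 L T S N μ *ᵥ φ - (Q 𝔮 L T S N)ᵀ *ᵥ (frakQ 𝔮 L T S N *ᵥ ψ)) := by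
  have h : ∀ v : Lat T S → ℂ, (Q 𝔮 L T S N *ᵥ φs) ⬝ᵥ v = φs ⬝ᵥ ((Q 𝔮 L T S N)ᵀ *ᵥ v) := fun v => by
    rw [dotProduct_mulVec, vecMul_transpose]
  rw [actionForm, linOp, zero_sub, neg_dotProduct, h, add_mulVec, smul_mulVec, sub_mulVec,
    smul_mulVec, one_mulVec, ← mulVec_mulVec, ← mulVec_mulVec, mulVec_sub, mulVec_sub,
    smul_dotProduct, ← dotProduct_smul, ← dotProduct_neg, ← dotProduct_add]
  congr 1
  abel

variable {E : Type*} [NormedAddCommGroup E] [NormedSpace ℂ E]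
  {ps p : E → Lat T S → ℂ} {fs f : E → FineLat L T S N → ℂ}
  {V : Functional (tSize L T N) (sSize L S N)}

lemma analyticAt_action {x : E} (hV : HasQuarticKernel V) (hps : AnalyticAt ℂ ps x)
    (hp : AnalyticAt ℂ p x) (hfs : AnalyticAt ℂ fs x) (hf : AnalyticAt ℂ f x) :
    AnalyticAt ℂ (fun x => action K 𝔮 L T S N μ V (ps x) (p x) (fs x) (f x)) x := by
  simp only [action_eq, actionForm]
  exact ((analyticAt_dotProduct (hps.fun_sub (analyticAt_mulVec _ hfs))
    (analyticAt_mulVec _ (hp.fun_sub (analyticAt_mulVec _ hf)))).fun_add (analyticAt_dotProduct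
    (hfs.fun_const_smul) ((analyticAt_mulVec _ hf).fun_sub hf.fun_const_smul))).fun_add
    (hV.analyticAt hfs hf)

/-- The second derivative of the action at the origin, along fields that depend analytically on
parameters and vanish at the origin. -/
lemma hessian_action (hV : HasQuarticKernel V) (hps : AnalyticAt ℂ ps 0)
    (hp : AnalyticAt ℂ p 0) (hfs : AnalyticAt ℂ fs 0) (hf : AnalyticAt ℂ f 0)
    (hps0 : ps 0 = 0) (hp0 : p 0 = 0) (hfs0 : fs 0 = 0) (hf0 : f 0 = 0) (h k : E) :
    hessian (fun x => action K 𝔮 L T S N μ V (ps x) (p x) (fs x) (f x)) h k =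
      actionForm K 𝔮 L T S N μ (fderiv ℂ ps 0 h) (fderiv ℂ fs 0 h) (fderiv ℂ p 0 k)
        (fderiv ℂ f 0 k) +
      actionForm K 𝔮 L T S N μ (fderiv ℂ ps 0 k) (fderiv ℂ fs 0 k) (fderiv ℂ p 0 h)
        (fderiv ℂ f 0 h) := by
  have a1 := hps.fun_sub (analyticAt_mulVec (Q 𝔮 L T S N) hfs)
  have a2 := analyticAt_mulVec (frakQ 𝔮 L T S N) (hp.fun_sub (analyticAt_mulVec (Q 𝔮 L T S N) hf))
  have a3 : AnalyticAt ℂ (fun x => ((L : ℂ) ^ (5 * N))⁻¹ • fs x) 0 := hfs.fun_const_smul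
  have a4 : AnalyticAt ℂ (fun x => K.D L T S N *ᵥ f x - (μ : ℂ) • f x) 0 :=
    (analyticAt_mulVec _ hf).fun_sub hf.fun_const_smul
  have d1 := hps.differentiableAt.hasFDerivAt
  have d2 := hp.differentiableAt.hasFDerivAt
  have d3 := hfs.differentiableAt.hasFDerivAt
  have d4 := hf.differentiableAt.hasFDerivAt
  have e1 := (d1.fun_sub (hasFDerivAt_mulVec (Q 𝔮 L T S N) d3)).fderiv
  have e2 := (hasFDerivAt_mulVec (frakQ 𝔮 L T S N)
    (d2.fun_sub (hasFDerivAt_mulVec (Q 𝔮 L T S N) d4))).fderiv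
  have e3 := (d3.fun_const_smul ((L : ℂ) ^ (5 * N))⁻¹).fderiv
  have e4 := ((hasFDerivAt_mulVec (K.D L T S N) d4).fun_sub (d4.fun_const_smul (μ : ℂ))).fderiv
  simp only [action_eq, actionForm]
  rw [hessian_add ((analyticAt_dotProduct a1 a2).fun_add (analyticAt_dotProduct a3 a4))
      (hV.analyticAt hfs hf), hV.hessian_eq_zero hfs hf hfs0 hf0,
    hessian_add (analyticAt_dotProduct a1 a2) (analyticAt_dotProduct a3 a4),
    hessian_dotProduct a1 a2 (by simp [hps0, hfs0]) (by simp [hp0, hf0]),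
    hessian_dotProduct a3 a4 (by simp [hfs0]) (by simp [hf0]), e1, e2, e3, e4]
  simp only [FunLike.coe_sub, FunLike.coe_smul, ContinuousLinearMap.coe_comp,
    Function.comp_apply, Pi.sub_apply, Pi.smul_apply, LinearMap.coe_toContinuousLinearMap',
    mulVecLin_apply, add_zero]
  ring

lemma fderiv_zero_of_even {g : E → ℂ} (hg : DifferentiableAt ℂ g 0) (h : ∀ x, g (-x) = g x) :
    fderiv ℂ g 0 = 0 := by
  have h1 : HasFDerivAt g (fderiv ℂ g 0) (-(0 : E)) := by rw [neg_zero]; exact hg.hasFDerivAt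
  have h2 := h1.comp (0 : E) (hasFDerivAt_id (𝕜 := ℂ) (0 : E)).neg
  have h3 : (g ∘ Neg.neg) = g := funext h
  rw [h3] at h2
  have h4 := h2.unique hg.hasFDerivAt
  ext v
  have h5 := congrArg (fun l => l v) h4
  simp only [ContinuousLinearMap.coe_comp, Function.comp_apply, FunLike.coe_neg, Pi.neg_apply,
    ContinuousLinearMap.coe_id', id, map_neg] at h5
  exact self_eq_neg.1 h5.symm

end ActionForm

/-! ### Background fields -/

section Background
variable (K : KineticOperator) (𝔮 L T S : ℕ) [NeZero L] [NeZero T] [NeZero S] (N : ℕ) (μ : ℝ)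
  (V : Functional (tSize L T N) (sSize L S N))

/-- The action as a function of all fields, `((ψ_*, ψ), (φ_*, φ))`. -/
def jointAction (z : ((Lat T S → ℂ) × (Lat T S → ℂ)) ×
    ((FineLat L T S N → ℂ) × (FineLat L T S N → ℂ))) : ℂ :=
  action K 𝔮 L T S N μ V z.1.1 z.1.2 z.2.1 z.2.2

variable {K 𝔮 L T S N μ V}

lemma analyticAt_jointAction (hV : HasQuarticKernel V) (z) :
    AnalyticAt ℂ (jointAction K 𝔮 L T S N μ V) z :=
  analyticAt_action hV (analyticAt_fst.comp analyticAt_fst) (analyticAt_snd.comp analyticAt_fst)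
    (analyticAt_fst.comp analyticAt_snd) (analyticAt_snd.comp analyticAt_snd)

lemma hessian_jointAction (hV : HasQuarticKernel V)
    (a b : ((Lat T S → ℂ) × (Lat T S → ℂ)) × ((FineLat L T S N → ℂ) × (FineLat L T S N → ℂ))) :
    hessian (jointAction K 𝔮 L T S N μ V) a b =
      actionForm K 𝔮 L T S N μ a.1.1 a.2.1 b.1.2 b.2.2 +
      actionForm K 𝔮 L T S N μ b.1.1 b.2.1 a.1.2 a.2.2 := by
  have h := hessian_action (K := K) (𝔮 := 𝔮) (μ := μ) hV
    (analyticAt_fst.comp analyticAt_fst) (analyticAt_snd.comp analyticAt_fst)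
    (analyticAt_fst.comp analyticAt_snd) (analyticAt_snd.comp analyticAt_snd) rfl rfl rfl rfl a b
  have d1 := (hasFDerivAt_fst (𝕜 := ℂ) (p := (0 : ((Lat T S → ℂ) × (Lat T S → ℂ)) ×
    ((FineLat L T S N → ℂ) × (FineLat L T S N → ℂ)))))
  have d2 := (hasFDerivAt_snd (𝕜 := ℂ) (p := (0 : ((Lat T S → ℂ) × (Lat T S → ℂ)) ×
    ((FineLat L T S N → ℂ) × (FineLat L T S N → ℂ)))))
  rw [(hasFDerivAt_fst.comp _ d1).fderiv, (hasFDerivAt_snd.comp _ d1).fderiv,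
    (hasFDerivAt_fst.comp _ d2).fderiv, (hasFDerivAt_snd.comp _ d2).fderiv] at h
  exact h

lemma jointAction_neg (hV : HasQuarticKernel V) (z) :
    jointAction K 𝔮 L T S N μ V (-z) = jointAction K 𝔮 L T S N μ V z := by
  obtain ⟨l, hl⟩ := hV
  simp only [jointAction, action_eq, actionForm, hl, Prod.fst_neg, Prod.snd_neg, mulVec_neg,
    Pi.neg_apply]
  congr 1
  · congr 1
    · rw [← neg_sub', ← neg_sub', mulVec_neg, neg_dotProduct_neg]
    · rw [smul_neg, smul_neg, ← neg_sub', neg_dotProduct_neg]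
  · exact Finset.sum_congr rfl fun u _ => by ring

lemma linOp_mulVec_injective (hL : Odd L) (hL3 : 3 ≤ L) (h𝔮 : 1 ≤ 𝔮)
    (hμ : |μ| ≤ massRadius K 𝔮) : Function.Injective (linOp K 𝔮 L T S N μ).mulVec := fun v w h => by
  rw [← sub_eq_zero]
  refine eq_zero_of_linOp_mulVec_eq_zero K hL hL3 h𝔮 N hμ ?_
  rw [mulVec_sub, sub_eq_zero]; exact h

/-- The quadratic form of the action in the background fields is nondegenerate. -/
lemma eq_zero_of_linOp_pairing (hL : Odd L) (hL3 : 3 ≤ L) (h𝔮 : 1 ≤ 𝔮)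
    (hμ : |μ| ≤ massRadius K 𝔮) {φs v : FineLat L T S N → ℂ}
    (h : ∀ ηs η : FineLat L T S N → ℂ,
      φs ⬝ᵥ (linOp K 𝔮 L T S N μ *ᵥ η) + ηs ⬝ᵥ v = 0) : φs = 0 ∧ v = 0 := by
  have hu := mulVec_injective_iff_isUnit.1 (linOp_mulVec_injective hL hL3 h𝔮 hμ
    (T := T) (S := S) (N := N))
  constructor
  · refine dotProduct_eq_zero _ fun w => ?_
    obtain ⟨η, rfl⟩ := (mulVec_surjective_iff_isUnit.2 hu) w
    simpa using h 0 η
  · refine dotProduct_eq_zero _ fun w => ?_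
    rw [dotProduct_comm]
    simpa using h w 0

/-- Background fields exist: the action is even in all fields together, so that the origin is a
critical point, and `linOp` makes it nondegenerate. -/
lemma exists_isBackgroundField (hL : Odd L) (hL3 : 3 ≤ L) (h𝔮 : 1 ≤ 𝔮)
    (hμ : |μ| ≤ massRadius K 𝔮) (hV : HasQuarticKernel V) :
    ∃ Φ, IsBackgroundField K 𝔮 L T S N μ V Φ := by
  have hJ := analyticAt_jointAction (K := K) (𝔮 := 𝔮) (μ := μ) hV 0
  refine exists_analytic_critical hJ
    (fderiv_zero_of_even hJ.differentiableAt (jointAction_neg hV)) ?_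
  rintro ⟨φs, φ⟩ h
  have h1 : ∀ ηs η : FineLat L T S N → ℂ, φs ⬝ᵥ (linOp K 𝔮 L T S N μ *ᵥ η) +
      ηs ⬝ᵥ (linOp K 𝔮 L T S N μ *ᵥ φ) = 0 := fun ηs η => by
    have h2 := h (ηs, η)
    rw [hessian_jointAction hV] at h2
    simpa only [Prod.fst_zero, Prod.snd_zero, actionForm_zero_left, mulVec_zero, sub_zero] using h2
  obtain ⟨h3, h4⟩ := eq_zero_of_linOp_pairing hL hL3 h𝔮 hμ h1
  rw [h3, eq_zero_of_linOp_mulVec_eq_zero K hL hL3 h𝔮 N hμ h4]; rfl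

lemma isBackgroundField_backgroundField (hL : Odd L) (hL3 : 3 ≤ L) (h𝔮 : 1 ≤ 𝔮)
    (hμ : |μ| ≤ massRadius K 𝔮) (hV : HasQuarticKernel V) :
    IsBackgroundField K 𝔮 L T S N μ V (backgroundField K 𝔮 L T S N μ V) :=
  Classical.epsilon_spec (exists_isBackgroundField hL hL3 h𝔮 hμ hV)

lemma linOp_mulVec_one (hL : Odd L) (h𝔮 : 1 ≤ 𝔮) :
    linOp K 𝔮 L T S N μ *ᵥ 1 = (((L : ℂ) ^ (5 * N))⁻¹ * ((frakQInvConst L N : ℂ)⁻¹ - μ)) •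
      (1 : FineLat L T S N → ℂ) := by
  rw [linOp, add_mulVec, smul_mulVec, sub_mulVec, smul_mulVec, one_mulVec, K.D_mulVec_one L T S N,
    ← mulVec_mulVec, ← mulVec_mulVec, Q_mulVec_one hL, frakQ_mulVec_one hL h𝔮, mulVec_smul,
    Q_transpose_mulVec_one hL h𝔮]
  funext x
  simp only [Pi.add_apply, Pi.smul_apply, Pi.sub_apply, Pi.zero_apply, Pi.one_apply, smul_eq_mul]
  ring

/-- The linear response of the background fields to a constant field `ψ`. All background fields have
the same one, so that the choice made in `backgroundField` is immaterial. -/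
lemma fderiv_background_one (hL : Odd L) (hL3 : 3 ≤ L) (h𝔮 : 1 ≤ 𝔮)
    (hμ : |μ| ≤ massRadius K 𝔮) (hV : HasQuarticKernel V) {Φ}
    (hΦ : IsBackgroundField K 𝔮 L T S N μ V Φ) (hμa : (frakQInvConst L N : ℂ)⁻¹ - μ ≠ 0) :
    fderiv ℂ Φ 0 (0, 1) =
      (0, ((frakQInvConst L N : ℂ)⁻¹ / ((frakQInvConst L N : ℂ)⁻¹ - μ)) • 1) := by
  have hL0 : (L : ℂ) ≠ 0 := by exact_mod_cast hL.pos.ne'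
  have hJ := analyticAt_jointAction (K := K) (𝔮 := 𝔮) (μ := μ) hV 0
  set χ := fderiv ℂ Φ 0 (0, 1) with hχ
  have h1 : ∀ ηs η : FineLat L T S N → ℂ, χ.1 ⬝ᵥ (linOp K 𝔮 L T S N μ *ᵥ η) +
      ηs ⬝ᵥ (linOp K 𝔮 L T S N μ *ᵥ χ.2 -
        (Q 𝔮 L T S N)ᵀ *ᵥ (frakQ 𝔮 L T S N *ᵥ 1)) = 0 := fun ηs η => by
    have h2 := hessian_of_critical hJ hΦ.1 hΦ.2.1 hΦ.2.2 (0, 1) (ηs, η)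
    rw [hessian_jointAction hV] at h2
    simpa only [Prod.fst_zero, Prod.snd_zero, actionForm_zero_left, mulVec_zero, sub_zero] using h2
  obtain ⟨h3, h4⟩ := eq_zero_of_linOp_pairing hL hL3 h𝔮 hμ h1
  refine Prod.ext h3 (linOp_mulVec_injective hL hL3 h𝔮 hμ ?_)
  rw [sub_eq_zero.1 h4, mulVec_smul, linOp_mulVec_one hL h𝔮, frakQ_mulVec_one hL h𝔮, mulVec_smul,
    Q_transpose_mulVec_one hL h𝔮, smul_smul, smul_smul]
  congr 1
  generalize (frakQInvConst L N : ℂ)⁻¹ = α at hμa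
  field_simp

/-- The quadratic part of the action at the background fields, on a constant field `ψ`. On constants
`Q_N` and `Q_N*` are trivial, `D_N` vanishes, and `𝔔_N` is multiplication by `frakQInvConst⁻¹`. -/
lemma actionForm_background_one (hL : Odd L) (h𝔮 : 1 ≤ 𝔮) (ψs : Lat T S → ℂ)
    (φs : FineLat L T S N → ℂ) (hμa : (frakQInvConst L N : ℂ)⁻¹ - μ ≠ 0) :
    actionForm K 𝔮 L T S N μ ψs φs 1
      (((frakQInvConst L N : ℂ)⁻¹ / ((frakQInvConst L N : ℂ)⁻¹ - μ)) • 1) =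
    ((frakQInvConst L N : ℂ)⁻¹ - (frakQInvConst L N : ℂ)⁻¹ ^ 2 /
      ((frakQInvConst L N : ℂ)⁻¹ - μ)) * ∑ x, ψs x := by
  set α := (frakQInvConst L N : ℂ)⁻¹ with hα
  have h1 : (1 : Lat T S → ℂ) - (α / (α - μ)) • 1 = (1 - α / (α - μ)) • 1 := by
    rw [sub_smul, one_smul]
  rw [actionForm, mulVec_smul, mulVec_smul, Q_mulVec_one hL, h1, mulVec_smul,
    frakQ_mulVec_one hL h𝔮, K.D_mulVec_one L T S N, smul_zero, zero_sub, dotProduct_neg,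
    dotProduct_smul, dotProduct_smul, dotProduct_smul, dotProduct_smul, sub_dotProduct, smul_dotProduct,
    dotProduct_one, dotProduct_one, dotProduct_one, sum_Q_mulVec hL h𝔮, ← hα]
  simp only [smul_eq_mul]
  field_simp
  ring

end Background

/-! ### Mass extraction -/

section MassExtraction
variable {T S : ℕ} [NeZero T] [NeZero S]

/-- The extended field that is constant for the species `σ`, and zero for the other species. -/
def constField (σ : Species) : TildeField T S := Pi.single σ 1

lemma sum_deltaField (σ : Species) : ∑ x : Lat T S, deltaField σ x = constField σ := by
  funext τ x
  by_cases h : τ = σ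
  · subst h
    simp [deltaField, constField, Finset.sum_apply, Pi.single_apply]
  · simp [deltaField, constField, Finset.sum_apply, h]

/-- The mass is the second derivative in the direction of a constant unstarred field. -/
lemma massExtraction_eq_hessian (F : TildeField T S → ℂ) :
    massExtraction F = hessian F (deltaField (true, none) 0) (constField (false, none)) := by
  simp only [massExtraction, hessian_eq_fderiv, ← sum_deltaField, map_sum]
  exact Finset.sum_congr rfl fun x _ => by rw [iteratedFDeriv_two_apply]; rfl

variable {K : KineticOperator} {𝔮 L : ℕ} [NeZero L] {N : ℕ} {μ : ℝ}
  {V W : Functional (tSize L T N) (sSize L S N)}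

/-- The quadratic part, on constant fields, of the action at the background fields. It is
independent of the quartic interactions, both in the action and in the background fields. -/
lemma hessian_action_background (hL : Odd L) (hL3 : 3 ≤ L) (h𝔮 : 1 ≤ 𝔮)
    (hμ : |μ| ≤ massRadius K 𝔮) (hV : HasQuarticKernel V) (hW : HasQuarticKernel W) {Φ}
    (hΦ : IsBackgroundField K 𝔮 L T S N μ V Φ) (hμa : (frakQInvConst L N : ℂ)⁻¹ - μ ≠ 0) :
    AnalyticAt ℂ (fun α : TildeField T S => action K 𝔮 L T S N μ W (α (true, none))
      (α (false, none)) (Φ (α (true, none), α (false, none))).1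
      (Φ (α (true, none), α (false, none))).2) 0 ∧
    hessian (fun α : TildeField T S => action K 𝔮 L T S N μ W (α (true, none))
      (α (false, none)) (Φ (α (true, none), α (false, none))).1
      (Φ (α (true, none), α (false, none))).2) (deltaField (true, none) 0)
      (constField (false, none)) =
    (frakQInvConst L N : ℂ)⁻¹ - (frakQInvConst L N : ℂ)⁻¹ ^ 2 /
      ((frakQInvConst L N : ℂ)⁻¹ - μ) := by
  let g : TildeField T S →L[ℂ] (Lat T S → ℂ) × (Lat T S → ℂ) :=
    (ContinuousLinearMap.proj (true, none)).prod (ContinuousLinearMap.proj (false, none))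
  obtain ⟨hΦa, hΦ0, hΦc⟩ := hΦ
  have hΦg : AnalyticAt ℂ (fun α => Φ (g α)) 0 :=
    AnalyticAt.fun_comp (by simpa using hΦa) (g.analyticAt 0)
  have hg1 : AnalyticAt ℂ (fun α => (g α).1) 0 := analyticAt_fst.comp (g.analyticAt 0)
  have hg2 : AnalyticAt ℂ (fun α => (g α).2) 0 := analyticAt_snd.comp (g.analyticAt 0)
  have hf1 : AnalyticAt ℂ (fun α => (Φ (g α)).1) 0 := analyticAt_fst.comp hΦg
  have hf2 : AnalyticAt ℂ (fun α => (Φ (g α)).2) 0 := analyticAt_snd.comp hΦg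
  have hΦg0 : Φ (g 0) = 0 := by rw [map_zero]; exact hΦ0
  refine ⟨analyticAt_action hW hg1 hg2 hf1 hf2, ?_⟩
  have h := hessian_action (K := K) (𝔮 := 𝔮) (μ := μ) hW hg1 hg2 hf1 hf2 (by simp) (by simp)
    (by rw [hΦg0]; rfl) (by rw [hΦg0]; rfl) (deltaField (true, none) 0) (constField (false, none))
  have dg : HasFDerivAt (fun α => g α) g 0 := g.hasFDerivAt
  have dΦ : HasFDerivAt (fun α => Φ (g α)) ((fderiv ℂ Φ 0).comp g) 0 := by
    have h1 : HasFDerivAt Φ (fderiv ℂ Φ 0) (g 0) := by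
      rw [map_zero]; exact hΦa.differentiableAt.hasFDerivAt
    exact h1.comp 0 dg
  have e1 := dg.fst.fderiv
  have e2 := dg.snd.fderiv
  have e3 := dΦ.fst.fderiv
  have e4 := dΦ.snd.fderiv
  have gk : g (constField (false, none)) = (0, 1) := by simp [g, constField]
  have gh : g (deltaField (true, none) 0) = (Pi.single 0 1, 0) := by simp [g, deltaField]
  rw [e1, e2, e3, e4] at h
  simp only [ContinuousLinearMap.coe_comp, Function.comp_apply, gk, gh,
    ContinuousLinearMap.coe_fst', ContinuousLinearMap.coe_snd',
    fderiv_background_one hL hL3 h𝔮 hμ hV ⟨hΦa, hΦ0, hΦc⟩ hμa,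
    actionForm_background_one hL h𝔮 _ _ hμa] at h
  refine Eq.trans h ?_
  simp [actionForm]

/-- The quadratic part of `A^var` on constant fields. -/
lemma massExtraction_actionVar (hL : Odd L) (hL3 : 3 ≤ L) (h𝔮 : 1 ≤ 𝔮) {δμ : ℝ}
    (hμ : |μ| ≤ massRadius K 𝔮) (hδμ : |μ + δμ| ≤ massRadius K 𝔮)
    (hV : HasQuarticKernel V) (hW : HasQuarticKernel W)
    (hμa : (frakQInvConst L N)⁻¹ - μ ≠ 0) (hδμa : (frakQInvConst L N)⁻¹ - (μ + δμ) ≠ 0) :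
    massExtraction (ofFields (actionVar K 𝔮 L T S N μ W δμ V)) =
      (((frakQInvConst L N)⁻¹ ^ 2 / ((frakQInvConst L N)⁻¹ - μ) -
        (frakQInvConst L N)⁻¹ ^ 2 / ((frakQInvConst L N)⁻¹ - (μ + δμ)) : ℝ) : ℂ) := by
  have h0 := isBackgroundField_backgroundField (T := T) (S := S) hL hL3 h𝔮 hμ hW
  have h1 := isBackgroundField_backgroundField (T := T) (S := S) hL hL3 h𝔮 hδμ (hW.add hV)
  obtain ⟨a0, b0⟩ := hessian_action_background hL hL3 h𝔮 hμ hW hW h0 (by exact_mod_cast hμa)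
  obtain ⟨a1, b1⟩ := hessian_action_background hL hL3 h𝔮 hδμ (hW.add hV) hW h1
    (by exact_mod_cast hδμa)
  have a2 := a1.fun_sub a0
  have h2 := hessian_add a2 a0 (deltaField (true, none) 0) (constField (false, none))
  simp only [sub_add_cancel] at h2
  rw [b0, b1] at h2
  rw [massExtraction_eq_hessian]
  refine (eq_sub_of_add_eq h2.symm).trans ?_
  push_cast
  ring

end MassExtraction

/-! ### Symmetry and size of the mass of an invariant function -/

section InvariantMass
variable {E : Type*} [NormedAddCommGroup E] [NormedSpace ℂ E]

lemma hessian_symm {F : E → ℂ} (hF : AnalyticAt ℂ F 0) (h k : E) :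
    hessian F h k = hessian F k h := by
  rw [hessian_eq_fderiv, hessian_eq_fderiv]
  exact (hF.contDiffAt (n := 2)).isSymmSndFDerivAt (by simp) h k

/-- Time reversal is only real-linear, so that it is used on real second derivatives. -/
lemma hessian_eq_fderiv_real {F : E → ℂ} (hF : AnalyticAt ℂ F 0) (h k : E) :
    hessian F h k = fderiv ℝ (fderiv ℝ F) 0 h k := by
  have h1 := ContDiffAt.restrictScalars_iteratedFDeriv (𝕜 := ℝ) (n := 2) hF.contDiffAt
  have h2 := congrArg (fun l => l ![h, k]) h1
  rw [hessian]
  refine Eq.trans h2 ?_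
  rw [iteratedFDeriv_two_apply]; rfl

/-- The second derivative of a function that intertwines two real-linear maps. -/
lemma hessian_of_symmetry {F : E → ℂ} (hF : AnalyticAt ℂ F 0) (A : E →L[ℝ] E) (c : ℂ →L[ℝ] ℂ)
    (hsym : ∀ᶠ x in 𝓝 (0 : E), F (A x) = c (F x)) (h k : E) :
    hessian F (A h) (A k) = c (hessian F h k) := by
  have hFr : ContDiffAt ℝ 2 F 0 := (hF.contDiffAt (n := 2)).restrict_scalars ℝ
  have hFd : ContDiffAt ℝ 1 (fderiv ℝ F) 0 := hFr.fderiv_right (by norm_num)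
  have hdiff : ∀ᶠ x in 𝓝 (0 : E), DifferentiableAt ℝ F x :=
    hF.eventually_analyticAt.mono fun x hx => hx.differentiableAt.restrictScalars ℝ
  have hA0 : Tendsto A (𝓝 0) (𝓝 0) := by simpa using A.continuous.tendsto 0
  have h1 : (fun x => fderiv ℝ F (A x) (A k)) =ᶠ[𝓝 0] fun x => c (fderiv ℝ F x k) := by
    filter_upwards [hsym.eventually_nhds, hdiff, hA0.eventually hdiff] with x hx hx1 hx2
    have e1 : HasFDerivAt (F ∘ A) ((fderiv ℝ F (A x)).comp A) x :=
      hx2.hasFDerivAt.comp x A.hasFDerivAt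
    have e2 : HasFDerivAt (fun y => c (F y)) (c.comp (fderiv ℝ F x)) x :=
      c.hasFDerivAt.comp x hx1.hasFDerivAt
    have e3 := e1.unique (e2.congr_of_eventuallyEq hx)
    exact congrArg (fun l => l k) e3
  have hd : HasFDerivAt (fderiv ℝ F) (fderiv ℝ (fderiv ℝ F) 0) 0 :=
    (hFd.differentiableAt (by norm_num)).hasFDerivAt
  have hdA : HasFDerivAt (fderiv ℝ F) (fderiv ℝ (fderiv ℝ F) 0) (A 0) := by
    rw [map_zero]; exact hd
  have e4 := (hdA.comp 0 A.hasFDerivAt).clm_apply (hasFDerivAt_const (A k) (0 : E))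
  have e5 := c.hasFDerivAt.comp (0 : E) (hd.clm_apply (hasFDerivAt_const k (0 : E)))
  have e6 := e4.unique (e5.congr_of_eventuallyEq h1)
  have e7 := congrArg (fun l => l h) e6
  rw [hessian_eq_fderiv_real hF, hessian_eq_fderiv_real hF]
  simpa using e7

variable {T S : ℕ} [NeZero T] [NeZero S]

/-- Translation of the extended fields, as a real-linear map. -/
def translateCLM (y : Lat T S) : TildeField T S →L[ℝ] TildeField T S :=
  LinearMap.toContinuousLinearMap
    { toFun := translateField y
      map_add' := fun _ _ => rfl
      map_smul' := fun _ _ => rfl }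

/-- Time reversal of the extended fields, as a real-linear map. -/
def reverseCLM : TildeField T S →L[ℝ] TildeField T S :=
  LinearMap.toContinuousLinearMap
    { toFun := reverseField
      map_add' := fun α β => by
        funext σ x
        simp only [reverseField, Pi.add_apply, map_add]
        split_ifs <;> ring
      map_smul' := fun r α => by
        funext σ x
        simp only [reverseField, Pi.smul_apply, Complex.real_smul, map_mul, Complex.conj_ofReal,
          RingHom.id_apply]
        split_ifs <;> ring }

omit [NeZero T] [NeZero S] in
lemma translateField_deltaField (y : Lat T S) (σ : Species) (x : Lat T S) :
    translateField y (deltaField σ x) = deltaField σ (x - y) := by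
  funext τ z
  by_cases h : τ = σ
  · subst h
    simp [translateField, deltaField, Pi.single_apply, eq_sub_iff_add_eq]
  · simp [translateField, deltaField, h]

omit [NeZero T] [NeZero S] in
lemma reverseField_deltaField (b : Bool) (x : Lat T S) :
    reverseField (deltaField (b, none) x) = deltaField (!b, none) (reflT x) := by
  have hr : ∀ z : Lat T S, reflT z = x ↔ z = reflT x := fun z => by
    constructor
    · rintro rfl; simp [reflT]
    · rintro rfl; simp [reflT]
  funext ⟨d, ν⟩ z
  cases ν with
  | none =>
    cases b <;> cases d <;> simp [reverseField, deltaField, Pi.single_apply, hr]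
  | some i => simp [reverseField, deltaField]

omit [NeZero T] [NeZero S] in
lemma reverseField_constField (b : Bool) :
    reverseField (constField (b, none) : TildeField T S) = constField (!b, none) := by
  funext ⟨d, ν⟩ z
  cases ν with
  | none => cases b <;> cases d <;> simp [reverseField, constField]
  | some i => simp [reverseField, constField]

/-- The mass of an invariant function is real. Time reversal conjugates it and exchanges the two
fields; translation invariance moves the base point back to the starred field. -/
lemma conj_massExtraction {F : TildeField T S → ℂ} (hF : IsInvariantAnalytic F) :
    conj (massExtraction F) = massExtraction F := by
  have htr : ∀ (y : Lat T S) (h k : TildeField T S),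
      hessian F (translateField y h) (translateField y k) = hessian F h k := fun y h k =>
    hessian_of_symmetry hF.analytic (translateCLM y) (ContinuousLinearMap.id ℝ ℂ)
      (hF.translation y) h k
  have hrev : ∀ h k : TildeField T S,
      hessian F (reverseField h) (reverseField k) = conj (hessian F h k) := fun h k =>
    hessian_of_symmetry hF.analytic reverseCLM (Complex.conjCLE : ℂ →L[ℝ] ℂ) hF.reversal h k
  rw [massExtraction_eq_hessian, ← hrev, reverseField_deltaField, reverseField_constField,
    hessian_symm hF.analytic, ← sum_deltaField, ← sum_deltaField]
  simp only [hessian_eq_fderiv, map_sum, FunLike.coe_sum, Finset.sum_apply]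
  simp only [← hessian_eq_fderiv]
  refine Fintype.sum_equiv (Equiv.neg (Lat T S)) _ _ fun x => ?_
  have h0 : reflT (0 : Lat T S) = 0 := Prod.ext neg_zero rfl
  rw [← htr x, translateField_deltaField, translateField_deltaField, sub_self, h0, zero_sub]
  rfl

end InvariantMass

/-! ### Kernel norms -/

section KernelNorms
variable {t s : ℕ}

lemma treeLength_nonneg {p : ℕ} (v : Fin p → Lat t s) : 0 ≤ treeLength v := by
  refine Real.sInf_nonneg ?_
  rintro _ ⟨H, -, -, -, rfl⟩
  refine mul_nonneg (by norm_num) (finsum_nonneg fun e => ?_)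
  split_ifs
  · exact Real.sqrt_nonneg _
  · exact le_rfl

/-- The kernel norm dominates the unweighted sum over any family of arguments with one of them
fixed. -/
lemma tsum_le_kernelNorm {𝔪 : ℝ} (h𝔪 : 0 ≤ 𝔪) {p : ℕ} (f : (Fin p → Lat t s) → ℂ) (i : Fin p)
    (x : Lat t s) {ι : Type*} (e : ι → (Fin p → Lat t s)) (he : Function.Injective e)
    (hx : ∀ a, e a i = x) : ∑' a, ENNReal.ofReal ‖f (e a)‖ ≤ kernelNorm 𝔪 f := by
  have hp : p ≠ 0 := fun h => by subst h; exact i.elim0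
  rw [kernelNorm, if_neg hp]
  refine le_trans ?_ (le_iSup₂_of_le i x le_rfl)
  have hinj : Function.Injective fun a => (⟨e a, hx a⟩ : {v : Fin p → Lat t s // v i = x}) :=
    fun a b hab => he (congrArg Subtype.val hab)
  refine le_trans ?_ (ENNReal.tsum_comp_le_tsum_of_injective hinj _)
  refine ENNReal.tsum_le_tsum fun a => ENNReal.ofReal_le_ofReal ?_
  exact le_mul_of_one_le_right (norm_nonneg _)
    (Real.one_le_exp (mul_nonneg h𝔪 (treeLength_nonneg _)))

end KernelNorms

section FieldNorm
variable {T S : ℕ} [NeZero T] [NeZero S]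

lemma seriesKernel_two (F : TildeField T S → ℂ) (σ : Fin 2 → Species) (v : Fin 2 → Lat T S) :
    seriesKernel F 2 σ v =
      (1 / 2) * hessian F (deltaField (σ 0) (v 0)) (deltaField (σ 1) (v 1)) := by
  rw [seriesKernel, hessian]
  congr 1
  · norm_num
  · congr 1
    funext i; fin_cases i <;> rfl

/-- Both orders of the two fields contribute to the norm, which makes up for the factor `1/2!` in
the kernels of the power series. -/
lemma sq_mul_norm_massExtraction_le {F : TildeField T S → ℂ} (hF : AnalyticAt ℂ F 0)
    {𝔪 κ κ' e : ℝ} (h𝔪 : 0 ≤ 𝔪) (hκ : 0 ≤ κ) (he : 0 ≤ e)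
    (h : fieldNorm 𝔪 κ κ' F ≤ ENNReal.ofReal e) : κ ^ 2 * ‖massExtraction F‖ ≤ e := by
  set k : Lat T S → ℂ := fun x => hessian F (deltaField (true, none) 0) (deltaField (false, none) x)
    with hk
  set σ₁ : Fin 2 → Species := ![(true, none), (false, none)] with hσ₁
  set σ₂ : Fin 2 → Species := ![(false, none), (true, none)] with hσ₂
  have hM : massExtraction F = ∑ x, k x := rfl
  have hsum : ENNReal.ofReal (‖massExtraction F‖ / 2) ≤ ∑' x, ENNReal.ofReal ‖(1 / 2) * k x‖ := by
    rw [tsum_fintype, ← ENNReal.ofReal_sum_of_nonneg fun _ _ => norm_nonneg _]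
    refine ENNReal.ofReal_le_ofReal ?_
    rw [hM]
    refine le_trans (le_of_eq ?_) (norm_sum_le _ _)
    rw [← Finset.mul_sum, norm_mul]; norm_num; ring
  have h1 : ENNReal.ofReal (‖massExtraction F‖ / 2) ≤ kernelNorm 𝔪 (seriesKernel F 2 σ₁) := by
    refine hsum.trans (le_trans (le_of_eq ?_) (tsum_le_kernelNorm h𝔪 (seriesKernel F 2 σ₁) 0 0
      (fun x : Lat T S => ![0, x]) (fun a b hab => by simpa using congrFun hab 1) fun _ => rfl))
    exact tsum_congr fun x => by rw [seriesKernel_two]; rfl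
  have h2 : ENNReal.ofReal (‖massExtraction F‖ / 2) ≤ kernelNorm 𝔪 (seriesKernel F 2 σ₂) := by
    refine hsum.trans (le_trans (le_of_eq ?_) (tsum_le_kernelNorm h𝔪 (seriesKernel F 2 σ₂) 1 0
      (fun x : Lat T S => ![x, 0]) (fun a b hab => by simpa using congrFun hab 0) fun _ => rfl))
    exact tsum_congr fun x => by rw [seriesKernel_two, hk, hessian_symm hF]; rfl
  have hne : σ₁ ≠ σ₂ := fun h => by simpa [hσ₁, hσ₂] using congrFun h 0
  have h3 : ∑ σ ∈ {σ₁, σ₂}, (∏ i, ENNReal.ofReal (if (σ i).2 = none then κ else κ')) *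
      kernelNorm 𝔪 (seriesKernel F 2 σ) ≤ fieldNorm 𝔪 κ κ' F := by
    refine le_trans ?_ (ENNReal.le_tsum 2)
    exact Finset.sum_le_sum_of_subset (Finset.subset_univ _)
  rw [Finset.sum_pair hne] at h3
  have h4 : ∀ σ ∈ ({σ₁, σ₂} : Finset (Fin 2 → Species)),
      ∏ i, ENNReal.ofReal (if (σ i).2 = none then κ else κ') = ENNReal.ofReal (κ ^ 2) := by
    intro σ hσ
    rw [Fin.prod_univ_two, ENNReal.ofReal_pow hκ, sq]
    rcases Finset.mem_insert.1 hσ with rfl | hσ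
    · simp [hσ₁]
    · rw [Finset.mem_singleton.1 hσ]; simp [hσ₂]
  rw [h4 _ (by simp), h4 _ (by simp), ← mul_add] at h3
  have h5 : ENNReal.ofReal (κ ^ 2 * ‖massExtraction F‖) ≤ ENNReal.ofReal e := by
    refine le_trans ?_ (h3.trans h)
    rw [ENNReal.ofReal_mul (by positivity)]
    refine mul_le_mul_right (le_trans (le_of_eq ?_) (add_le_add h1 h2)) _
    rw [← ENNReal.ofReal_add (by positivity) (by positivity)]
    congr 1; ring
  exact (ENNReal.ofReal_le_ofReal_iff he).1 h5

end FieldNorm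

/-! ### The critical chemical potential -/

section Propagator
open MeasureTheory

/-- An integrable majorant of `|k|⁻²` on the Brillouin zone, chosen as a product so that it can be
integrated in each coordinate separately. -/
def propagatorMajorant (k : Fin 3 → ℝ) : ℝ := ∏ i, |k i| ^ (-(2 / 3) : ℝ)

lemma integrableOn_propagatorMajorant :
    IntegrableOn propagatorMajorant (Set.Icc (fun _ : Fin 3 => -Real.pi) fun _ => Real.pi) := by
  have h1 : IntervalIntegrable (fun x : ℝ => |x| ^ (-(2 / 3) : ℝ)) volume (-Real.pi) Real.pi := by
    refine intervalIntegrable_of_even (fun x => by rw [abs_neg]) fun x hx => ?_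
    refine (intervalIntegral.intervalIntegrable_rpow' (r := -(2 / 3)) (by norm_num)).congr ?_
    intro y hy
    rw [Set.uIoc_of_le hx.le] at hy
    simp only [abs_of_pos hy.1]
  have h2 : IntegrableOn (fun x : ℝ => |x| ^ (-(2 / 3) : ℝ)) (Set.Icc (-Real.pi) Real.pi) := by
    rw [integrableOn_Icc_iff_integrableOn_Ioc]
    exact (intervalIntegrable_iff_integrableOn_Ioc_of_le (by linarith [Real.pi_pos])).1 h1
  rw [IntegrableOn, ← Set.pi_univ_Icc, volume_pi, Measure.restrict_pi_pi]
  exact Integrable.fintype_prod fun _ => h2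

lemma inv_sum_sq_le_propagatorMajorant {k : Fin 3 → ℝ} (hk : ∀ i, k i ≠ 0) :
    (∑ i, k i ^ 2)⁻¹ ≤ propagatorMajorant k := by
  set s := ∑ i, k i ^ 2 with hs
  have h0 : 0 < s := lt_of_lt_of_le (by have := hk 0; positivity : 0 < k 0 ^ 2)
    (Finset.single_le_sum (f := fun i => k i ^ 2) (fun _ _ => sq_nonneg _) (Finset.mem_univ 0))
  have h1 : ∀ i, s ^ (-(1 / 3) : ℝ) ≤ |k i| ^ (-(2 / 3) : ℝ) := fun i => by
    have h2 : |k i| ^ 2 ≤ s := by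
      rw [sq_abs]
      exact Finset.single_le_sum (f := fun i => k i ^ 2) (fun _ _ => sq_nonneg _)
        (Finset.mem_univ i)
    have h3 : 0 < |k i| := abs_pos.2 (hk i)
    have h4 : |k i| ^ (-(2 / 3) : ℝ) = (|k i| ^ 2) ^ (-(1 / 3) : ℝ) := by
      rw [← Real.rpow_natCast, ← Real.rpow_mul h3.le]; norm_num
    rw [h4]
    exact Real.rpow_le_rpow_of_nonpos (by positivity) h2 (by norm_num)
  have h5 : s⁻¹ = ∏ _i : Fin 3, s ^ (-(1 / 3) : ℝ) := by
    rw [Finset.prod_const, Finset.card_univ, Fintype.card_fin, ← Real.rpow_natCast,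
      ← Real.rpow_mul h0.le, ← Real.rpow_neg_one]
    norm_num
  rw [h5, propagatorMajorant]
  exact Finset.prod_le_prod (fun _ _ => by positivity) fun i _ => h1 i

namespace KineticOperator
variable (K : KineticOperator)

lemma sum_sq_le_energy {k : Fin 3 → ℝ}
    (hk : k ∈ Set.Icc (fun _ : Fin 3 => -Real.pi) fun _ => Real.pi) :
    K.ellipticity * (4 / Real.pi ^ 2) * ∑ i, k i ^ 2 ≤ K.energy k := by
  refine le_trans ?_ (K.le_symbol_re k)
  rw [mul_assoc, Finset.mul_sum]
  refine mul_le_mul_of_nonneg_left (Finset.sum_le_sum fun i _ => ?_) K.ellipticity_pos.le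
  have hpi := Real.pi_pos
  have h1 : |k i / 2| ≤ Real.pi / 2 := by
    rw [abs_le]
    have := hk.1 i
    have := hk.2 i
    simp only at *
    constructor <;> linarith
  have h2 := Real.mul_abs_le_abs_sin h1
  rw [Complex.norm_exp_I_mul_ofReal_sub_one, norm_mul, Real.norm_eq_abs, Real.norm_eq_abs]
  have h3 : 2 / Real.pi * |k i| ≤ |2| * |Real.sin (k i / 2)| := by
    rw [abs_div, abs_two] at h2
    rw [abs_two]; linarith
  have h4 := pow_le_pow_left₀ (by positivity) h3 2
  refine le_trans (le_of_eq ?_) h4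
  rw [mul_pow, sq_abs]; ring

/-- A bound for the propagator `D₀⁻¹(x, 0)` that is uniform in `x` and in the time period. -/
def propagatorBound : ℝ :=
  (1 / (2 * Real.pi) ^ 3) * ∫ k in Set.Icc (fun _ : Fin 3 => -Real.pi) (fun _ => Real.pi),
    Real.exp K.symbolBound / (K.ellipticity * (4 / Real.pi ^ 2)) * propagatorMajorant k

lemma norm_D0Inv_le {t : ℕ} [NeZero t] (x : Lat t 0) : ‖K.D0Inv t x‖ ≤ K.propagatorBound := by
  have hpi := Real.pi_pos
  have hc := K.ellipticity_pos
  have hint : ∀ l : ZMod t, ‖∫ k in Set.Icc (fun _ : Fin 3 => -Real.pi) (fun _ => Real.pi),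
      Complex.exp (Complex.I * ((2 * Real.pi * (l.val : ℝ) / (t : ℝ) * (x.1.val : ℝ) +
          ∑ i, k i * ((x.2 i).valMinAbs : ℝ) : ℝ) : ℂ)) /
        (1 - Complex.exp (-K.symbol k) *
          Complex.exp (Complex.I * ((2 * Real.pi * (l.val : ℝ) / (t : ℝ) : ℝ) : ℂ)))‖ ≤
      ∫ k in Set.Icc (fun _ : Fin 3 => -Real.pi) (fun _ => Real.pi),
        Real.exp K.symbolBound / (K.ellipticity * (4 / Real.pi ^ 2)) * propagatorMajorant k := by
    intro l
    refine norm_integral_le_of_norm_le (integrableOn_propagatorMajorant.const_mul _) ?_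
    have hne : ∀ᵐ k : Fin 3 → ℝ, ∀ i, k i ≠ 0 := ae_all_iff.2 fun i => by
      rw [volume_pi]; exact Measure.ae_eval_ne (fun _ : Fin 3 => volume) i 0
    refine (ae_restrict_iff' measurableSet_Icc).2 (hne.mono fun k hk0 hk => ?_)
    have hE := K.sum_sq_le_energy hk
    have hs : 0 < ∑ i, k i ^ 2 := lt_of_lt_of_le (by have := hk0 0; positivity : 0 < k 0 ^ 2)
      (Finset.single_le_sum (f := fun i => k i ^ 2) (fun _ _ => sq_nonneg _) (Finset.mem_univ 0))
    have hz : ‖Complex.exp (Complex.I * ((2 * Real.pi * (l.val : ℝ) / (t : ℝ) : ℝ) : ℂ))‖ = 1 := by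
      rw [mul_comm, Complex.norm_exp_ofReal_mul_I]
    have h3 := (norm_one_sub_exp_mul (K.energy_nonneg k) (K.energy_le k) hz).2.2
    have he : Complex.exp (-K.symbol k) = (Real.exp (-K.energy k) : ℂ) := by
      rw [symbol_eq_energy]; push_cast; rfl
    rw [norm_div, mul_comm Complex.I, Complex.norm_exp_ofReal_mul_I, he]
    set d := ‖1 - (Real.exp (-K.energy k) : ℂ) *
      Complex.exp (Complex.I * ((2 * Real.pi * (l.val : ℝ) / (t : ℝ) : ℝ) : ℂ))‖ with hd
    have hA : 0 < K.ellipticity * (4 / Real.pi ^ 2) := by positivity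
    have h4 : K.ellipticity * (4 / Real.pi ^ 2) * ∑ i, k i ^ 2 ≤ Real.exp K.symbolBound * d :=
      hE.trans h3
    have hd0 : 0 < d := by
      have := lt_of_lt_of_le (mul_pos hA hs) h4
      exact pos_of_mul_pos_right this (Real.exp_pos _).le
    have h5 := inv_sum_sq_le_propagatorMajorant hk0
    refine le_trans ?_ (mul_le_mul_of_nonneg_left h5 (by positivity))
    rw [div_mul_eq_mul_div, ← div_eq_mul_inv, div_div, div_le_div_iff₀ hd0 (by positivity),
      one_mul, mul_comm (∑ i, k i ^ 2)]
    exact h4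
  rw [D0Inv, norm_mul]
  refine (mul_le_mul_of_nonneg_left (norm_sum_le _ _) (norm_nonneg _)).trans ?_
  have hsum : ∀ l : ZMod t, _ := fun l => mul_le_mul_of_nonneg_left (hint l)
    (by positivity : (0 : ℝ) ≤ 1 / (2 * Real.pi) ^ 3)
  refine (mul_le_mul_of_nonneg_left (Finset.sum_le_sum (g := fun _ => K.propagatorBound)
    fun l _ => ?_) (norm_nonneg _)).trans (le_of_eq ?_)
  · rw [norm_mul]
    refine le_trans (le_of_eq ?_) (hsum l)
    congr 1
    rw [norm_div, norm_pow, norm_mul, Complex.norm_real, Real.norm_of_nonneg hpi.le]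
    simp
  · have ht : (t : ℝ) ≠ 0 := by exact_mod_cast NeZero.ne t
    rw [Finset.sum_const, Finset.card_univ, ZMod.card, nsmul_eq_mul, norm_div, norm_one,
      Complex.norm_natCast, ← mul_assoc, one_div_mul_cancel ht, one_mul]

lemma propagatorBound_nonneg : 0 ≤ K.propagatorBound :=
  (norm_nonneg _).trans (K.norm_D0Inv_le (t := 1) 0)

end KineticOperator

namespace InitialInteraction
variable {t : ℕ} [NeZero t] (V₀ : InitialInteraction t)

/-- The critical chemical potential is of first order in the coupling, uniformly in the time period:
the propagator is bounded because `|k|⁻²` is integrable in three dimensions. -/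
lemma abs_muStar_le (K : KineticOperator) {m : ℝ} (hm : 0 ≤ m)
    (hV : kernelNorm (2 * m) V₀.V ≠ ⊤) : |V₀.muStar K| ≤ K.propagatorBound * V₀.coupling m := by
  set e : (Fin 3 → Lat t 0) → (Fin 4 → Lat t 0) := fun x => ![0, x 0, x 1, x 2] with he
  have hinj : Function.Injective e := fun x y h => by
    have h1 := congrFun h 1
    have h2 := congrFun h 2
    have h3 := congrFun h 3
    funext i
    fin_cases i
    exacts [h1, h2, h3]
  have h1 := tsum_le_kernelNorm (by linarith : 0 ≤ 2 * m) V₀.V 0 0 e hinj fun _ => rfl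
  have h2 : ∑' x, ENNReal.ofReal ‖V₀.V (e x)‖ ≠ ⊤ := ne_top_of_le_ne_top hV h1
  have hs : Summable fun x => ‖V₀.V (e x)‖ := by
    have := ENNReal.summable_toReal h2
    simpa only [ENNReal.toReal_ofReal (norm_nonneg _)] using this
  have h3 : ∑' x, ‖V₀.V (e x)‖ ≤ (kernelNorm (2 * m) V₀.V).toReal := by
    have := ENNReal.toReal_mono hV h1
    rwa [ENNReal.tsum_toReal_eq fun x => ENNReal.ofReal_ne_top,
      tsum_congr fun x => ENNReal.toReal_ofReal (norm_nonneg _)] at this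
  have h4 : ‖∑' x : Fin 3 → Lat t 0, V₀.V (e x) * K.D0Inv t (x 2)‖ ≤
      (∑' x, ‖V₀.V (e x)‖) * K.propagatorBound := by
    refine tsum_of_norm_bounded (hs.hasSum.mul_right _) fun x => ?_
    rw [norm_mul]
    exact mul_le_mul_of_nonneg_left (K.norm_D0Inv_le _) (norm_nonneg _)
  have h5 := mul_le_mul_of_nonneg_right h3 K.propagatorBound_nonneg
  rw [muStar, coupling]
  refine (Complex.abs_re_le_norm _).trans ?_
  rw [norm_mul, Complex.norm_ofNat]
  linarith

end InitialInteraction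

end Propagator

/-! ### The renormalized chemical potential -/

/-- The fluctuation bound, measured in units of two field weights, does not grow with the scale:
the exponent of `L` in `𝔢_fl(n) / κ(n+1)²` is nonpositive because `log v / log Δ` is positive. -/
lemma eFl_le {L : ℕ} (hL : 1 ≤ L) {ε v Δ : ℝ} (hε : 0 < ε) (hv : 0 < v) (hv1 : v < 1)
    (hΔ : 0 < Δ) (hΔ1 : Δ < 1) (n : ℕ) :
    eFl L ε v Δ n ≤ v ^ (1 - 4 * ε) * kappa L ε v Δ (n + 1) ^ 2 := by
  have hr : 0 < Real.log v / Real.log Δ :=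
    div_pos_of_neg_of_neg (Real.log_neg hv hv1) (Real.log_neg hΔ hΔ1)
  have hL1 : (1 : ℝ) ≤ L := by exact_mod_cast hL
  rw [eFl, kappa]
  set r := Real.log v / Real.log Δ
  rw [div_pow, ← Real.rpow_natCast, ← Real.rpow_natCast, ← Real.rpow_mul (by positivity),
    ← Real.rpow_mul hv.le]
  have h1 : v ^ (1 / 3 - 2 * ε) = v ^ (1 - 4 * ε) / v ^ ((1 / 3 - ε) * ((2 : ℕ) : ℝ)) := by
    rw [← Real.rpow_sub hv]
    congr 1
    push_cast
    ring
  rw [h1]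
  refine (mul_le_mul_of_nonneg_right (Real.rpow_le_rpow_of_exponent_le hL1 ?_)
    (by positivity)).trans (le_of_eq (mul_div_left_comm _ _ _))
  push_cast
  have hn : (0 : ℝ) ≤ n := n.cast_nonneg
  nlinarith [mul_nonneg hr.le hn, mul_nonneg hε.le (mul_nonneg hr.le hn)]

/-- The smallness conditions on the coupling constant. -/
lemma exists_coupling_bound {ε : ℝ} (hε : 0 < ε) (hε1 : ε < 1 / 12) (C A : ℝ) {ρ b : ℝ}
    (hρ : 0 < ρ) (hb : 0 < b) :
    ∃ w : ℝ, 0 < w ∧ ∀ v : ℝ, 0 < v → v ≤ w →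
      v < 1 ∧ v ^ (8 / 9 + ε) + C * v < 1 ∧ A * v ^ (5 * ε) ≤ b ∧ 3 * v ^ (1 - 4 * ε) ≤ ρ := by
  have hpow : ∀ p : ℝ, 0 < p → Tendsto (fun v : ℝ => v ^ p) (𝓝 0) (𝓝 0) := fun p hp => by
    simpa [Real.zero_rpow hp.ne'] using
      (Real.continuous_rpow_const hp.le).tendsto (0 : ℝ)
  have h1 : ∀ᶠ v : ℝ in 𝓝 0, v < 1 := eventually_lt_nhds one_pos
  have h2 : ∀ᶠ v : ℝ in 𝓝 0, v ^ (8 / 9 + ε) + C * v < 1 := by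
    have := (hpow (8 / 9 + ε) (by positivity)).add ((tendsto_id (α := ℝ) (x := 𝓝 0)).const_mul C)
    exact this.eventually_lt_const (by norm_num)
  have h3 : ∀ᶠ v : ℝ in 𝓝 0, A * v ^ (5 * ε) ≤ b :=
    ((hpow (5 * ε) (by positivity)).const_mul A).eventually_le_const (by simpa using hb)
  have h4 : ∀ᶠ v : ℝ in 𝓝 0, 3 * v ^ (1 - 4 * ε) ≤ ρ :=
    ((hpow (1 - 4 * ε) (by linarith)).const_mul 3).eventually_le_const (by simpa using hρ)
  obtain ⟨w, hw, h⟩ := Metric.eventually_nhds_iff.1 (h1.and (h2.and (h3.and h4)))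
  refine ⟨w / 2, by positivity, fun v hv hvw => h ?_⟩
  rw [Real.dist_eq, sub_zero, abs_of_pos hv]
  linarith

/-- The scalar equation that determines the change of the chemical potential has an explicit
solution, whose ratio to the right hand side `e` is close to one. -/
lemma exists_renormalization {a μ e : ℝ} (ha : 8 / 9 ≤ a) (ha1 : a ≤ 1) (hμ : |μ| ≤ 1 / 100)
    (he : |e| ≤ 1 / 24) :
    ∃ δ : ℝ, a ^ 2 / (a - μ) - a ^ 2 / (a - (μ + δ)) + e = 0 ∧ SignType.sign δ = SignType.sign e ∧
      1 / 4 * |e| ≤ |δ| ∧ |δ| ≤ 9 / 4 * |e| := by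
  obtain ⟨hμ1, hμ2⟩ := abs_le.1 hμ
  obtain ⟨he1, he2⟩ := abs_le.1 he
  set b := a - μ with hb
  have hb1 : 7 / 8 ≤ b := by linarith
  have hb2 : b ≤ 101 / 100 := by linarith
  have hb0 : 0 < b := by linarith
  have hd1 : (2 / 3 : ℝ) ≤ a ^ 2 + e * b := by nlinarith
  have hd2 : a ^ 2 + e * b ≤ 5 / 4 := by nlinarith
  have hd : 0 < a ^ 2 + e * b := by linarith
  have hq1 : 1 / 4 ≤ b ^ 2 / (a ^ 2 + e * b) := by
    rw [le_div_iff₀ hd]; nlinarith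
  have hq2 : b ^ 2 / (a ^ 2 + e * b) ≤ 9 / 4 := by
    rw [div_le_iff₀ hd]; nlinarith
  have hq : 0 < b ^ 2 / (a ^ 2 + e * b) := by positivity
  refine ⟨b ^ 2 / (a ^ 2 + e * b) * e, ?_, ?_, ?_, ?_⟩
  · have h1 : a - (μ + b ^ 2 / (a ^ 2 + e * b) * e) = b * a ^ 2 / (a ^ 2 + e * b) := by
      rw [← sub_sub, ← hb, eq_div_iff hd.ne']
      linear_combination -e * div_mul_cancel₀ (b ^ 2) hd.ne'
    have ha0 : a ≠ 0 := by linarith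
    rw [h1]
    field_simp
    ring
  · rw [sign_mul, sign_pos hq, one_mul]
  · rw [abs_mul, abs_of_pos hq]
    exact mul_le_mul_of_nonneg_right hq1 (abs_nonneg e)
  · rw [abs_mul, abs_of_pos hq]
    exact mul_le_mul_of_nonneg_right hq2 (abs_nonneg e)

lemma IsQuartic.hasQuarticKernel {L j t s : ℕ} [NeZero t] [NeZero s] {V : Functional t s}
    (h : IsQuartic L j V) : HasQuarticKernel V := h.1

lemma isQuartic_zero (L j : ℕ) {t s : ℕ} [NeZero t] [NeZero s] :
    IsQuartic L j (0 : Functional t s) :=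
  ⟨⟨0, by simp⟩, by simp, by simp, by simp⟩

end BoseFlow

end

open BoseFlow in
theorem mainTheorem3 (K : KineticOperator) (𝔮 : ℕ) (h𝔮 : 1 ≤ 𝔮) :
    ∃ ρmax : ℝ, 0 < ρmax ∧ ρmax ≤ 1 / 8 ∧
    ∀ ρ : ℝ, 0 < ρ → ρ ≤ ρmax →
    ∀ (L : ℕ) [NeZero L], Odd L → 3 ≤ L →
    ∀ ε : ℝ, 0 < ε → ε < 1 / 12 →
    ∀ m : ℝ, 0 < m →
    ∃ vmax : ℝ, 0 < vmax ∧
    ∀ (n T S : ℕ) [NeZero T] [NeZero S]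
      (V₀ : InitialInteraction (tSize L T (n + 1))),
      kernelNorm (2 * m) V₀.V ≠ ⊤ → 0 < V₀.coupling m → V₀.coupling m ≤ vmax →
    ∀ μ₀ : ℝ, V₀.muStar K + V₀.coupling m ^ (4 / 3 - 16 * ε) ≤ μ₀ →
      μ₀ ≤ V₀.coupling m ^ (8 / 9 + ε) →
    ∀ μn : ℝ, |μn| ≤ 4 * V₀.coupling m ^ (5 * ε) →
    ∀ Vn : Functional (tSize L T (n + 1)) (sSize L S (n + 1)), IsQuartic L n Vn →
    ∀ Efl : TildeField T S → ℂ, IsInvariantAnalytic Efl →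
      fieldNorm (2 * m) (kappa L ε (V₀.coupling m) (μ₀ - V₀.muStar K) (n + 1))
          (kappa' L ε (V₀.coupling m) (μ₀ - V₀.muStar K) (n + 1)) Efl
        ≤ ENNReal.ofReal (eFl L ε (V₀.coupling m) (μ₀ - V₀.muStar K) n) →
    (massExtraction Efl).im = 0 ∧
    ∃ δμ : ℝ,
      (δμ ∈ Set.Icc (-ρ) ρ ∧
        ∀ δV : Functional (tSize L T (n + 1)) (sSize L S (n + 1)), IsQuartic L (n + 1) δV →
          massExtraction (ofFields (actionVar K 𝔮 L T S (n + 1) ((L : ℝ) ^ 2 * μn)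
            (scaled L Vn) δμ δV)) + massExtraction Efl = 0) ∧
      (∀ δμ' ∈ Set.Icc (-ρ) ρ,
        (∀ δV : Functional (tSize L T (n + 1)) (sSize L S (n + 1)), IsQuartic L (n + 1) δV →
          massExtraction (ofFields (actionVar K 𝔮 L T S (n + 1) ((L : ℝ) ^ 2 * μn)
            (scaled L Vn) δμ' δV)) + massExtraction Efl = 0) → δμ' = δμ) ∧
      SignType.sign δμ = SignType.sign (massExtraction Efl).re ∧
      (1 / 4) * ‖massExtraction Efl‖ ≤ |δμ| ∧
      |δμ| ≤ (9 / 4) * ‖massExtraction Efl‖ ∧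
      (9 / 4) * ‖massExtraction Efl‖ ≤
        3 * eFl L ε (V₀.coupling m) (μ₀ - V₀.muStar K) n /
          kappa L ε (V₀.coupling m) (μ₀ - V₀.muStar K) (n + 1) ^ 2 := by
  have hR := massRadius_pos K 𝔮
  refine ⟨min (1 / 8) (massRadius K 𝔮 / 2), by positivity, min_le_left _ _, ?_⟩
  intro ρ hρ hρmax L _ hL hL3 ε hε hε1 m hm
  have hρ8 : ρ ≤ 1 / 8 := hρmax.trans (min_le_left _ _)
  have hρR : ρ ≤ massRadius K 𝔮 / 2 := hρmax.trans (min_le_right _ _)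
  obtain ⟨w, hw, hsmall⟩ := exists_coupling_bound hε hε1 K.propagatorBound ((L : ℝ) ^ 2 * 4) hρ
    (b := min (1 / 100) (massRadius K 𝔮 / 2)) (by positivity)
  refine ⟨w, hw, ?_⟩
  intro n T S _ _ V₀ hVtop hv hvw μ₀ hμ₀ hμ₀' μn hμn Vn hVn Efl hE hnorm
  have hstar := abs_le.1 (V₀.abs_muStar_le K hm.le hVtop)
  set v := V₀.coupling m with hvdef
  obtain ⟨hv1, hv2, hv3, hv4⟩ := hsmall v hv hvw
  have hΔ : 0 < μ₀ - V₀.muStar K := by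
    have : 0 < v ^ (4 / 3 - 16 * ε) := Real.rpow_pos_of_pos hv _
    linarith
  -- Hence both `log v` and `log Δ` are negative, and the exponent `r` is positive.
  have hΔ1 : μ₀ - V₀.muStar K < 1 := by linarith [hstar.1]
  set Δ := μ₀ - V₀.muStar K with hΔdef
  have hLpos : (0 : ℝ) < L := by exact_mod_cast (by omega : 0 < L)
  have hκ : 0 < kappa L ε v Δ (n + 1) := by
    rw [kappa]; positivity
  have he0 : 0 ≤ eFl L ε v Δ n := by
    rw [eFl]; positivity
  have hℓκ := sq_mul_norm_massExtraction_le hE.analytic (by linarith : 0 ≤ 2 * m) hκ.le he0 hnorm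
  have hℓ : ‖massExtraction Efl‖ ≤ v ^ (1 - 4 * ε) := by
    have h1 := hℓκ.trans (eFl_le (by omega : 1 ≤ L) hε hv hv1 hΔ hΔ1 n)
    rw [mul_comm] at h1
    exact le_of_mul_le_mul_right h1 (by positivity)
  have him : (massExtraction Efl).im = 0 := Complex.conj_eq_iff_im.1 (conj_massExtraction hE)
  have hreal : massExtraction Efl = ((massExtraction Efl).re : ℂ) :=
    Complex.ext rfl (by simpa using him)
  have hnorm_re : ‖massExtraction Efl‖ = |(massExtraction Efl).re| := by
    rw [hreal, Complex.norm_real, Real.norm_eq_abs, Complex.ofReal_re]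
  set e := (massExtraction Efl).re with hedef
  rw [hnorm_re] at hℓ hℓκ ⊢
  set a := (frakQInvConst L (n + 1))⁻¹ with hadef
  have ha : 8 / 9 ≤ a := by
    rw [hadef, le_inv_comm₀ (by norm_num) (by linarith [one_le_frakQInvConst L (n + 1)])]
    linarith [frakQInvConst_le L hL3 (n + 1)]
  have ha1 : a ≤ 1 := inv_le_one_of_one_le₀ (one_le_frakQInvConst L (n + 1))
  set μ := (L : ℝ) ^ 2 * μn with hμdef
  have hμ : |μ| ≤ min (1 / 100) (massRadius K 𝔮 / 2) := by
    refine le_trans ?_ hv3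
    rw [hμdef, abs_mul, abs_of_nonneg (sq_nonneg (L : ℝ)), mul_assoc]
    exact mul_le_mul_of_nonneg_left hμn (sq_nonneg _)
  have hμ100 : |μ| ≤ 1 / 100 := hμ.trans (min_le_left _ _)
  have hμR : |μ| ≤ massRadius K 𝔮 / 2 := hμ.trans (min_le_right _ _)
  have hden : ∀ δ : ℝ, |δ| ≤ ρ → a - (μ + δ) ≠ 0 := fun δ hδ => by
    have h1 := abs_le.1 hμ100
    have h2 := abs_le.1 hδ
    refine ne_of_gt ?_
    linarith [h1.2, h2.2]
  have hμa : a - μ ≠ 0 := by simpa using hden 0 (by simpa using hρ.le)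
  -- On the interval of admissible `δ`, the mass of the action does not depend on `δV`.
  have hvar : ∀ δ : ℝ, |δ| ≤ ρ → ∀ δV, IsQuartic L (n + 1) δV →
      massExtraction (ofFields (actionVar K 𝔮 L T S (n + 1) μ (scaled L Vn) δ δV)) =
        ((a ^ 2 / (a - μ) - a ^ 2 / (a - (μ + δ)) : ℝ) : ℂ) := fun δ hδ δV hδV =>
    massExtraction_actionVar hL hL3 h𝔮 (hμR.trans (by linarith))
      ((abs_add_le _ _).trans (by linarith)) hδV.hasQuarticKernel
      hVn.hasQuarticKernel.scaled hμa (hden δ hδ)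
  obtain ⟨δμ, heq, hsign, hlow, hup⟩ :=
    exists_renormalization ha ha1 hμ100 (e := e) (by linarith)
  have hδρ : |δμ| ≤ ρ := by
    have : 0 < v ^ (1 - 4 * ε) := Real.rpow_pos_of_pos hv _
    linarith
  refine ⟨him, δμ, ⟨abs_le.1 hδρ, fun δV hδV => ?_⟩, fun δ' hδ' h => ?_, hsign, hlow, hup, ?_⟩
  · rw [hvar δμ hδρ δV hδV, hreal, ← Complex.ofReal_add, heq, Complex.ofReal_zero]
  · have hδ : |δ'| ≤ ρ := abs_le.2 hδ'
    have h0 := h 0 (isQuartic_zero _ _)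
    rw [hvar δ' hδ 0 (isQuartic_zero _ _), hreal, ← Complex.ofReal_add,
      Complex.ofReal_eq_zero] at h0
    have h1 : a ^ 2 / (a - (μ + δ')) = a ^ 2 / (a - (μ + δμ)) := by linarith
    have ha0 : a ^ 2 ≠ 0 := pow_ne_zero 2 (by linarith)
    rw [div_eq_div_iff (hden δ' hδ) (hden δμ hδρ)] at h1
    linarith [mul_left_cancel₀ ha0 h1]
  · rw [le_div_iff₀ (by positivity)]
    nlinarith
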